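/- \textbf{Setting.} Let $N\ge 0$, $m_\infty\ge 3$, $m_1,\dots,m_N\ge 1$ be integers, with $m_\infty\neq 3$ if $N=0$, and put $n=m_\infty-3+\sum_{\alpha=1}^N m_\alpha$. Let $M$ be the $2n$-dimensional complex manifold with coordinates $a_i^{(\infty)}$ $(0\le i\le 2m_\infty-7)$, $a_i^{(\alpha)}$ $(1\le \alpha\le N,\ 1\le i\le 2m_\alpha-1)$, $w_\alpha$ $(1\le\alpha\le N)$, consisting of those parameters for which the $w_\alpha$ are distinct, $a^{(\alpha)}_{2m_\alpha-1}\ne0$, and $$Q_0(x)=x^{2m_\infty-5}+\sum_{i=0}^{2m_\infty-7}a_i^{(\infty)}x^i+\sum_{\alpha=1}^N\sum_{i=1}^{2m_\alpha-1}\frac{a_i^{(\alpha)}}{(x-w_\alpha)^i}$$ has only simple zeros (these are local coordinates on the moduli space of quadratic differentials $Q_0(x)\,dx^2$ on $\mathbb{CP}^1$ with simple zeros and poles of orders $2m_\infty-1,2m_1-1,\dots,2m_N-1$). Let $X$ be the $4n$-dimensional complex manifold of tuples $(a,w,q,p,v)$ with $(a,w)\in M$, distinct $q_1,\dots,q_n\in\mathbb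 C$ that are neither zeros nor poles of $Q_0$, $p_I^2=Q_0(q_I)$, and $v\in\mathbb C^n$; $(a,w,q,v)$ are local coordinates on $X$, and the coordinate vector fields below refer to them, $p_I=Q_0(q_I)^{1/2}$ being a local function of $(a,w,q)$. With $F(x)=\prod_\alpha(x-w_\alpha)^{m_\alpha}$ put $$R(x)=\frac1{F(x)}\sum_{I=1}^nF(q_I)\Big(2p_Iv_I-\sum_{K\ne I}\frac{p_K}{q_I-q_K}\Big)\prod_{J\neq I}\frac{x-q_J}{q_I-q_J},$$ $$S(x)=\frac1{F(x)}\sum_{I=1}^nF(q_I)\Big(v_I^2-\sum_{K\ne I}\frac{3}{4(q_I-q_K)^2}-\sum_{K\ne I}\frac{v_K}{q_I-q_K}\Big)\prod_{J\neq I}\frac{x-q_J}{q_I-q_J},$$ $$Q_1=\sum_I\frac{p_I}{x-q_I}+R,\qquad Q_2=\sum_I\frac{3}{4(x-q_I)^2}+\sum_I\frac{v_I}{x-q_I}+S,\qquad Q=\frac{Q_0}{\hbar^2}+\frac{Q_1}{\hbar}+Q_2,\quad \hbar\in\mathbb C^*.$$ A holomorphic vector field $L$ on $X$ (with $\partial_t$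 the derivative along $L$, $x$ and $\hbar$ fixed) \emph{generates an isomonodromic flow} of $Y''=Q(x)Y$ if there is a $2\times2$ matrix $B$ of functions, meromorphic in $x\in\mathbb{CP}^1$ and holomorphic in $x$ and the point of $X$ jointly away from finitely many $x$ for each point of $X$, such that the connection $d-\begin{pmatrix}0&1\\Q&0\end{pmatrix}dx-B\,dt$ is flat. It is \emph{isopotential} if $L(Q(x))=0$. For $B$ with upper right entry $A$, flatness implies $$-2\,\partial_tQ=A'''-4QA'-2Q'A.\qquad(\ast)$$ A \emph{twistor distribution} on $X$ is a family $L(\hbar)\le TX$, $\hbar\in\mathbb C^*$, of the form $L(\hbar)=\operatorname{span}\{U_a+V_a/\hbar\}_{a=1}^{2n}$ for holomorphic vector fields $U_a,V_a$ on $X$ with $TX=\operatorname{span}\{U_a,V_a\}_{a=1}^{2n}$. \textbf{The fields.} For $1\le i\le m_\alpha$ if $\alpha=1,\dots,N$, and $0\le i\le m_\infty-4$ if $\alpha=\infty$ (call these coefficients $a^{(\alpha)}_i$ \emph{low}; there are $n$), let $$U_i^{(\alpha)}=\frac{\partial}{\partial a_i^{(\alpha)}},\qquad V_i^{(\alpha)}=-\sum_{I=1}^n\frac{\partial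 p_I}{\partial a_i^{(\alpha)}}\frac{\partial}{\partial v_I}.$$ Let $$T_i^{(\alpha)}(x)=\sum_{k=i}^{2m_\alpha-1}\frac{(2i-k-2)\,a_k^{(\alpha)}}{x^{k-i+2}},\qquad T_i^{(\infty)}(x)=(2i-2m_\infty+7)x^{2m_\infty-i-7}+\sum_{k=i+2}^{2m_\infty-7}(2i-k+2)\,a_k^{(\infty)}x^{k-i-2},$$ $$D_{IK}=\sum_{i=m_\infty-3}^{2m_\infty-7}T_i^{(\infty)}(q_I)\,q_K^i+\sum_{\alpha=1}^N\sum_{i=m_\alpha+1}^{2m_\alpha-1}\frac{T_i^{(\alpha)}(q_I-w_\alpha)}{(q_K-w_\alpha)^i}+\sum_{\alpha=1}^N\sum_{j=1}^{2m_\alpha-1}\frac{j\,a_j^{(\alpha)}}{(q_I-w_\alpha)(q_K-w_\alpha)^{j+1}},$$ and for $I=1,\dots,n$ $$\begin{aligned}U_I=&\sum_{i=m_\infty-3}^{2m_\infty-7}T_i^{(\infty)}(q_I)\frac{\partial}{\partial a_i^{(\infty)}}+\sum_{\alpha=1}^N\sum_{i=m_\alpha+1}^{2m_\alpha-1}T_i^{(\alpha)}(q_I-w_\alpha)\frac{\partial}{\partial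 a_i^{(\alpha)}}+\sum_{\alpha=1}^N\frac1{q_I-w_\alpha}\frac{\partial}{\partial w_\alpha}-2v_I\frac{\partial}{\partial q_I}-\sum_{K\ne I}\frac1{q_K-q_I}\frac{\partial}{\partial q_K}\\&+\Big(\sum_{K\ne I}\frac3{2(q_I-q_K)^3}+\sum_{K\neq I}\frac{v_K}{(q_I-q_K)^2}-S'(q_I)\Big)\frac{\partial}{\partial v_I}+\sum_{K\ne I}\Big(\frac{3}{2(q_K-q_I)^3}-\frac{v_K}{(q_K-q_I)^2}\Big)\frac{\partial}{\partial v_K},\\ V_I=&-2p_I\frac{\partial}{\partial q_I}-\sum_{K=1}^n\frac{D_{IK}}{2p_K}\frac{\partial}{\partial v_K}+\sum_{K\ne I}\Big(\frac{Q_0'(q_K)}{2p_K(q_K-q_I)}-\frac{p_K}{(q_K-q_I)^2}\Big)\frac{\partial}{\partial v_K}\\&+\Big(\frac{Q_0'(q_I)v_I}{p_I}-R'(q_I)+\sum_{K\neq I}\frac{p_K}{(q_I-q_K)^2}\Big)\frac{\partial}{\partial v_I}.\end{aligned}$$ \textbf{Proposition.} All these $4n$ vector fields are holomorphic on $X$.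 For every $\hbar\in\mathbb C^*$ the $2n$ fields $L_i^{(\alpha)}=U_i^{(\alpha)}+V_i^{(\alpha)}/\hbar$ and $L_I=U_I+V_I/\hbar$ generate isomonodromic flows and are linearly independent at every point of $X$. The $n$ fields $L_i^{(\alpha)}$ are isopotential, and $L_I$ is the unique holomorphic vector field on $X$ that satisfies $(\ast)$ with $A=(x-q_I)^{-1}$ and has no component along the low $\partial/\partial a_i^{(\alpha)}$. The $4n$ fields $U_i^{(\alpha)},V_i^{(\alpha)},U_I,V_I$ form a basis of $T_\xi X$ at every $\xi\in X$. The distribution spanned by the generators of all isomonodromic flows on $X$ is, for every $\hbar\in\mathbb C^*$, the span of the $L_i^{(\alpha)}$ and $L_I$, and is thus a twistor distribution on $X$. -/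

import Mathlib

open scoped BigOperators

/-- Pole orders of a meromorphic quadratic differential on the Riemann sphere: a distinguished pole
of odd order `2 * mInf - 1 ≥ 5` at infinity and `N` finite poles of odd orders `2 * m α - 1`, the case
of a single pole of order five being excluded. -/
structure PoleData where
  N : ℕ
  mInf : ℕ
  m : Fin N → ℕ
  three_le_mInf : 3 ≤ mInf
  one_le_m : ∀ α, 1 ≤ m α
  ne_five : N = 0 → mInf ≠ 3

namespace PoleData

noncomputable section

variable (D : PoleData)

/-- Half of the dimension of the moduli space, `dim M = 2 m_∞ - 6 + ∑ 2 m_α`. -/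
def n : ℕ := D.mInf - 3 + ∑ α, D.m α

/-- The space of the parameters `(a^{(∞)}, a^{(α)}, w)` of `Q₀`. -/
abbrev Base : Type :=
  (Fin (2 * D.mInf - 6) → ℂ) × ((α : Fin D.N) → Fin (2 * D.m α - 1) → ℂ) × (Fin D.N → ℂ)

/-- The space of all parameters `((a^{(∞)}, a^{(α)}, w), q, p, v)`. -/
abbrev Ambient : Type :=
  D.Base × (Fin D.n → ℂ) × (Fin D.n → ℂ) × (Fin D.n → ℂ)

/-- `a_i^{(∞)}` for `i = 0, …, 2 m_∞ - 7`. -/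
def aInf (b : D.Base) (i : Fin (2 * D.mInf - 6)) : ℂ := b.1 i

/-- `aFin b α i` is the Laurent coefficient `a_{i+1}^{(α)}`, where `i + 1 = 1, …, 2 m_α - 1`. -/
def aFin (b : D.Base) (α : Fin D.N) (i : Fin (2 * D.m α - 1)) : ℂ := b.2.1 α i

/-- The finite pole `w_α`. -/
def w (b : D.Base) (α : Fin D.N) : ℂ := b.2.2 α

def q (ξ : D.Ambient) (I : Fin D.n) : ℂ := ξ.2.1 I

def p (ξ : D.Ambient) (I : Fin D.n) : ℂ := ξ.2.2.1 I

def v (ξ : D.Ambient) (I : Fin D.n) : ℂ := ξ.2.2.2 I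

/-- The rational function `Q₀`; the quadratic differential is `Q₀(x) dx²`. -/
def Q0 (b : D.Base) (x : ℂ) : ℂ :=
  x ^ (2 * D.mInf - 5) + ∑ i, D.aInf b i * x ^ (i : ℕ)
    + ∑ α, ∑ i, D.aFin b α i / (x - D.w b α) ^ ((i : ℕ) + 1)

/-- The moduli space in its coordinates: distinct finite poles, poles of exactly the prescribed
orders, and simple zeros. -/
def M : Set D.Base :=
  {b | Function.Injective (D.w b) ∧
    (∀ α (i : Fin (2 * D.m α - 1)), (i : ℕ) + 1 = 2 * D.m α - 1 → D.aFin b α i ≠ 0) ∧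
    ∀ x, (∀ α, x ≠ D.w b α) → D.Q0 b x = 0 → deriv (D.Q0 b) x ≠ 0}

/-- The manifold `X`: a point of `M`, distinct points `q_I` that are neither poles nor zeros of
`Q₀`, a choice of square root `p_I` of `Q₀(q_I)`, and arbitrary `v_I`. -/
def X : Set D.Ambient :=
  {ξ | ξ.1 ∈ D.M ∧ Function.Injective (D.q ξ) ∧ (∀ I α, D.q ξ I ≠ D.w ξ.1 α) ∧
    (∀ I, D.Q0 ξ.1 (D.q ξ I) ≠ 0) ∧ ∀ I, D.p ξ I ^ 2 = D.Q0 ξ.1 (D.q ξ I)}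

/-- The tangent space of `X` at `ξ`, i.e. the kernel of the differentials of the defining equations
`p_I² - Q₀(q_I) = 0`. -/
def tangentSpace (ξ : D.Ambient) : Submodule ℂ D.Ambient :=
  ⨅ I : Fin D.n, LinearMap.ker
    (fderiv ℂ (fun η : D.Ambient => D.p η I ^ 2 - D.Q0 η.1 (D.q η I)) ξ).toLinearMap

/-- Holomorphic vector fields on `X`. Analyticity on `X` means that the field is locally the
restriction to `X` of a holomorphic map on the ambient space. -/
def IsVectorField (L : D.Ambient → D.Ambient) : Prop :=
  AnalyticOn ℂ L D.X ∧ ∀ ξ ∈ D.X, L ξ ∈ D.tangentSpace ξ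

/-! ### The potential -/

/-- `F(x) = ∏ (x - w_α)^{m_α}`. -/
def F (b : D.Base) (x : ℂ) : ℂ := ∏ α, (x - D.w b α) ^ D.m α

/-- `∏_{J ≠ I} (x - q_J) / (q_I - q_J)`. -/
def lagrange (ξ : D.Ambient) (I : Fin D.n) (x : ℂ) : ℂ :=
  ∏ J ∈ Finset.univ.erase I, (x - D.q ξ J) / (D.q ξ I - D.q ξ J)

def R (ξ : D.Ambient) (x : ℂ) : ℂ :=
  (∑ I, D.F ξ.1 (D.q ξ I) *
      (2 * D.p ξ I * D.v ξ I
        - ∑ K ∈ Finset.univ.erase I, D.p ξ K / (D.q ξ I - D.q ξ K)) * D.lagrange ξ I x)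
    / D.F ξ.1 x

def S (ξ : D.Ambient) (x : ℂ) : ℂ :=
  (∑ I, D.F ξ.1 (D.q ξ I) *
      (D.v ξ I ^ 2
        - ∑ K ∈ Finset.univ.erase I, 3 / (4 * (D.q ξ I - D.q ξ K) ^ 2)
        - ∑ K ∈ Finset.univ.erase I, D.v ξ K / (D.q ξ I - D.q ξ K)) * D.lagrange ξ I x)
    / D.F ξ.1 x

def Q1 (ξ : D.Ambient) (x : ℂ) : ℂ := ∑ I, D.p ξ I / (x - D.q ξ I) + D.R ξ x

def Q2 (ξ : D.Ambient) (x : ℂ) : ℂ :=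
  ∑ I, 3 / (4 * (x - D.q ξ I) ^ 2) + ∑ I, D.v ξ I / (x - D.q ξ I) + D.S ξ x

/-- The potential `Q = Q₀ / ħ² + Q₁ / ħ + Q₂`. -/
def Q (ħ : ℂ) (ξ : D.Ambient) (x : ℂ) : ℂ :=
  D.Q0 ξ.1 x / ħ ^ 2 + D.Q1 ξ x / ħ + D.Q2 ξ x

/-- `x` is neither one of the `w_α` nor one of the `q_I`. -/
def IsRegularPoint (ξ : D.Ambient) (x : ℂ) : Prop :=
  (∀ α, x ≠ D.w ξ.1 α) ∧ ∀ I, x ≠ D.q ξ I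

/-- The derivative of `Q(x)` at `ξ` along the tangent vector `t`, with `x` and `ħ` fixed. -/
def dQ (ħ : ℂ) (ξ t : D.Ambient) (x : ℂ) : ℂ := fderiv ℂ (fun η => D.Q ħ η x) ξ t

/-! ### Isomonodromic flows -/

/-- The matrix `C` of the first order system `dΦ/dx = C Φ` equivalent to `Y'' = Q Y`. -/
def potentialMatrix (ħ : ℂ) (ξ : D.Ambient) (x : ℂ) : Matrix (Fin 2) (Fin 2) ℂ :=
  !![0, 1; D.Q ħ ξ x, 0]

/-- A function on `ℂ` (up to its values at its poles) that is meromorphic on the Riemann sphere. -/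
def MeromorphicOnSphere (f : ℂ → ℂ) : Prop :=
  (∀ x, MeromorphicAt f x) ∧ MeromorphicAt (fun s => f s⁻¹) 0

/-- The vector field `L` generates an isomonodromic flow of `Y'' = Q Y`: there is a matrix `B` of
functions, meromorphic in `x` on the sphere and holomorphic in all variables off finitely many `x`,
such that, with `∂_t` the derivative along `L`, the connection `d - C dx - B dt` is flat, i.e.
`∂_x B - ∂_t C = C B - B C`. -/
def IsIsomonodromic (ħ : ℂ) (L : D.Ambient → D.Ambient) : Prop :=
  ∃ (B : D.Ambient → ℂ → Matrix (Fin 2) (Fin 2) ℂ) (Z : D.Ambient → Finset ℂ),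
    ∀ ξ ∈ D.X, ∀ i j,
      MeromorphicOnSphere (fun x => B ξ x i j) ∧
      ∀ x, x ∉ Z ξ → D.IsRegularPoint ξ x →
        AnalyticWithinAt ℂ (fun z : D.Ambient × ℂ => B z.1 z.2 i j) (D.X ×ˢ Set.univ) (ξ, x) ∧
        deriv (fun y => B ξ y i j) x - fderiv ℂ (fun η => D.potentialMatrix ħ η x i j) ξ (L ξ)
          = (D.potentialMatrix ħ ξ x * B ξ x - B ξ x * D.potentialMatrix ħ ξ x) i j

/-- An isopotential flow preserves `Q(x)` for every `x`. -/
def IsIsopotential (ħ : ℂ) (L : D.Ambient → D.Ambient) : Prop :=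
  ∀ ξ ∈ D.X, ∀ x, D.IsRegularPoint ξ x → D.dQ ħ ξ (L ξ) x = 0

/-- The equation `-2 ∂_t Q = A''' - 4 Q A' - 2 Q' A`, where `∂_t` is the derivative along `L` and
`A` may depend on the point of `X`. -/
def SolvesFuchs (ħ : ℂ) (A : D.Ambient → ℂ → ℂ) (L : D.Ambient → D.Ambient) : Prop :=
  ∀ ξ ∈ D.X, ∀ x, D.IsRegularPoint ξ x →
    -2 * D.dQ ħ ξ (L ξ) x =
      iteratedDeriv 3 (A ξ) x - 4 * D.Q ħ ξ x * deriv (A ξ) x - 2 * deriv (D.Q ħ ξ) x * A ξ x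

/-- The distribution spanned by the generators of the isomonodromic flows on `X`. -/
def isomonodromicDistribution (ħ : ℂ) (ξ : D.Ambient) : Submodule ℂ D.Ambient :=
  Submodule.span ℂ {t | ∃ L, D.IsVectorField L ∧ D.IsIsomonodromic ħ L ∧ t = L ξ}

/-- Twistor distributions on the `4n`-dimensional manifold `X`. -/
def IsTwistorDistribution (L : ℂ → D.Ambient → Submodule ℂ D.Ambient) : Prop :=
  ∃ U V : Fin (2 * D.n) → D.Ambient → D.Ambient,
    (∀ a, D.IsVectorField (U a) ∧ D.IsVectorField (V a)) ∧
    (∀ ħ : ℂ, ħ ≠ 0 → ∀ ξ ∈ D.X,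
      L ħ ξ = Submodule.span ℂ (Set.range fun a => U a ξ + ħ⁻¹ • V a ξ)) ∧
    ∀ ξ ∈ D.X, D.tangentSpace ξ =
      Submodule.span ℂ (Set.range (fun a => U a ξ) ∪ Set.range (fun a => V a ξ))

/-! ### The explicit vector fields -/

/-- The derivative of `p_K = Q₀(q_K)^{1/2}`, as a local function of `(a, w, q, v)`, in the direction
`(db, dq)`, where `db` is a direction in the parameters of `Q₀`. -/
def dp (ξ : D.Ambient) (db : D.Base) (dq : Fin D.n → ℂ) (K : Fin D.n) : ℂ :=
  fderiv ℂ (fun z : D.Base × ℂ => D.Q0 z.1 z.2) (ξ.1, D.q ξ K) (db, dq K) / (2 * D.p ξ K)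

/-- The tangent vector of `X` at `ξ` with components `db`, `dq`, `dv` in the local coordinates
`(a, w)`, `q`, `v`. -/
def tangentVector (ξ : D.Ambient) (db : D.Base) (dq dv : Fin D.n → ℂ) : D.Ambient :=
  (db, dq, D.dp ξ db dq, dv)

/-- Indices of the coefficients `a_i^{(∞)}`, `0 ≤ i ≤ m_∞ - 4`, and `a_i^{(α)}`, `1 ≤ i ≤ m_α`. -/
abbrev LowIndex : Type := Fin (D.mInf - 3) ⊕ (Σ α : Fin D.N, Fin (D.m α))

/-- The component of `db` at a low coefficient. -/
def lowComponent (db : D.Base) : D.LowIndex → ℂ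
  | Sum.inl i => D.aInf db (Fin.castLE (by omega) i)
  | Sum.inr ⟨α, i⟩ => D.aFin db α (Fin.castLE (by have := i.isLt; omega) i)

/-- The coordinate direction of a low coefficient. -/
def lowDirection : D.LowIndex → D.Base
  | Sum.inl i => (Pi.single (Fin.castLE (by omega) i) 1, 0, 0)
  | Sum.inr ⟨α, i⟩ =>
      (0, Pi.single α (Pi.single (Fin.castLE (by have := i.isLt; omega) i) 1), 0)

/-- `U_i^{(α)} = ∂/∂a_i^{(α)}`. -/
def UIso (k : D.LowIndex) (ξ : D.Ambient) : D.Ambient :=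
  D.tangentVector ξ (D.lowDirection k) 0 0

/-- `V_i^{(α)} = - ∑_I (∂p_I/∂a_i^{(α)}) ∂/∂v_I`. -/
def VIso (k : D.LowIndex) (ξ : D.Ambient) : D.Ambient :=
  D.tangentVector ξ 0 0 (fun I => - D.dp ξ (D.lowDirection k) 0 I)

/-- `T_i^{(∞)}(x) = (2i - 2m_∞ + 7) x^{2m_∞-i-7} + ∑_{k ≥ i+2} (2i - k + 2) a_k^{(∞)} x^{k-i-2}`. -/
def TInf (b : D.Base) (i : Fin (2 * D.mInf - 6)) (x : ℂ) : ℂ :=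
  (2 * (i : ℕ) - 2 * (D.mInf : ℂ) + 7) * x ^ (2 * D.mInf - 7 - (i : ℕ))
    + ∑ k ∈ Finset.univ.filter (fun k : Fin (2 * D.mInf - 6) => (i : ℕ) + 2 ≤ k),
        (2 * (i : ℕ) - (k : ℕ) + 2) * D.aInf b k * x ^ ((k : ℕ) - i - 2)

/-- `TFin b α i` is `T_{i+1}^{(α)}`, with
`T_i^{(α)}(x) = ∑_{k = i}^{2m_α-1} (2i - k - 2) a_k^{(α)} / x^{k-i+2}`. -/
def TFin (b : D.Base) (α : Fin D.N) (i : Fin (2 * D.m α - 1)) (x : ℂ) : ℂ :=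
  ∑ k ∈ Finset.univ.filter (fun k : Fin (2 * D.m α - 1) => i ≤ k),
    (2 * ((i : ℕ) + 1) - ((k : ℕ) + 1) - 2) * D.aFin b α k / x ^ ((k : ℕ) - i + 2)

/-- The components of `U_I` along the parameters of `Q₀`. -/
def UBase (ξ : D.Ambient) (I : Fin D.n) : D.Base :=
  (fun i => if D.mInf - 3 ≤ (i : ℕ) then D.TInf ξ.1 i (D.q ξ I) else 0,
   fun α i => if D.m α + 1 ≤ (i : ℕ) + 1 then D.TFin ξ.1 α i (D.q ξ I - D.w ξ.1 α) else 0,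
   fun α => 1 / (D.q ξ I - D.w ξ.1 α))

/-- The field `U_I`. -/
def UApp (I : Fin D.n) (ξ : D.Ambient) : D.Ambient :=
  D.tangentVector ξ (D.UBase ξ I)
    (fun K => if K = I then -2 * D.v ξ I else -1 / (D.q ξ K - D.q ξ I))
    (fun K => if K = I then
        ∑ J ∈ Finset.univ.erase I, 3 / (2 * (D.q ξ I - D.q ξ J) ^ 3)
          + ∑ J ∈ Finset.univ.erase I, D.v ξ J / (D.q ξ I - D.q ξ J) ^ 2
          - deriv (D.S ξ) (D.q ξ I)
      else
        3 / (2 * (D.q ξ K - D.q ξ I) ^ 3) - D.v ξ K / (D.q ξ K - D.q ξ I) ^ 2)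

/-- The derivative of `Q₀(x)`, at `x = q_K` fixed, along `U_I`. -/
def Q0Dot (ξ : D.Ambient) (I K : Fin D.n) : ℂ :=
  ∑ i ∈ Finset.univ.filter (fun i : Fin (2 * D.mInf - 6) => D.mInf - 3 ≤ (i : ℕ)),
      D.TInf ξ.1 i (D.q ξ I) * D.q ξ K ^ (i : ℕ)
    + ∑ α, ∑ i ∈ Finset.univ.filter
          (fun i : Fin (2 * D.m α - 1) => D.m α + 1 ≤ (i : ℕ) + 1),
        D.TFin ξ.1 α i (D.q ξ I - D.w ξ.1 α) / (D.q ξ K - D.w ξ.1 α) ^ ((i : ℕ) + 1)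
    + ∑ α, ∑ j : Fin (2 * D.m α - 1),
        ((j : ℕ) + 1) * D.aFin ξ.1 α j
          / ((D.q ξ I - D.w ξ.1 α) * (D.q ξ K - D.w ξ.1 α) ^ ((j : ℕ) + 2))

/-- The field `V_I`. -/
def VApp (I : Fin D.n) (ξ : D.Ambient) : D.Ambient :=
  D.tangentVector ξ 0
    (fun K => if K = I then -2 * D.p ξ I else 0)
    (fun K => - D.Q0Dot ξ I K / (2 * D.p ξ K) +
      if K = I then
        deriv (D.Q0 ξ.1) (D.q ξ I) * D.v ξ I / D.p ξ I - deriv (D.R ξ) (D.q ξ I)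
          + ∑ J ∈ Finset.univ.erase I, D.p ξ J / (D.q ξ I - D.q ξ J) ^ 2
      else
        deriv (D.Q0 ξ.1) (D.q ξ K) / (2 * D.p ξ K * (D.q ξ K - D.q ξ I))
          - D.p ξ K / (D.q ξ K - D.q ξ I) ^ 2)

/-- Indices of the flows: the isopotential ones and one for each `I`. -/
abbrev FlowIndex : Type := D.LowIndex ⊕ Fin D.n

def U : D.FlowIndex → D.Ambient → D.Ambient := Sum.elim D.UIso D.UApp

def V : D.FlowIndex → D.Ambient → D.Ambient := Sum.elim D.VIso D.VApp

/-- The generator `L_a = U_a + V_a / ħ`. -/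
def flow (ħ : ℂ) (a : D.FlowIndex) (ξ : D.Ambient) : D.Ambient := D.U a ξ + ħ⁻¹ • D.V a ξ

end

end PoleData

/-!
The flatness condition only involves the upper right entry `A` of `B`: it amounts to
`∂_t Q = 2 Q A' + Q' A - A''' / 2`, whose right-hand side is called `fuchs Q A`, and a solution `A`
of this equation gives back a traceless `B` (`isIsomonodromic_of_dQ_eq`,
`IsIsomonodromic.exists_dQ_eq`). Everything reduces to comparing Laurent expansions of rational
functions at the points `w_α`, `q_J` and `∞`; `HasLead` and `HasLeadInf` record their first terms.

*A rational function has `n` degrees of freedom once its principal parts are fixed.* If it has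
poles of order at most `m_α` at `w_α`, no other poles, and growth at most `x ^ (m_∞ - 4)`, then it
vanishes as soon as it has zeros at `q_1, …, q_n`, because its product with `F / ∏ (x - q_J)` is
entire and vanishes at infinity (`eq_zero_of_hasLead_poles`).

*The flows solve the equation* (`dQ_eq_fuchs`). For `A = 1 / (x - q_I)`, or `A = 0`, consider the
difference of its two sides along the flow. The components of the flow along the high coefficients
and the `w_α` cancel the principal parts of order above `m_α` at `w_α` and the terms of degree above
`m_∞ - 4` at infinity (`hasLead_dQ0_UBase`, `hasLeadInf_dQ0_UBase`). At `q_J` write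
`Q = 3 / (4 (x - q_J)²) + u / (x - q_J) + H`. The definition of `R` and `S` says that
`H(q_J) = u²`, the condition for `q_J` to be an apparent singularity (`H_node`). Together with its
infinitesimal form (`dH_node`), it makes the difference vanish at `q_J` if `q_J` and `u` move as the
flow prescribes. So the difference has no degree of freedom left.

*The `4 n` fields are a basis.* The space `T_ξ X` has dimension `4 n` (`finrank_tangentSpace`). In a
linear relation, the low components eliminate the `U_i^{(α)}`. A relation between the components of
the `U_I` along the parameters of `Q₀` would give an `A = ∑ c_I / (x - q_I)` with too many zeros at
the poles of `Q₀` (`eq_zero_of_sum_UBase`). The components along `∂ / ∂q_I` eliminate the `V_I`, and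
the differentials of the `Q₀(q_I)` are independent along the low coefficients
(`eq_zero_of_sum_lowDirection`), which eliminates the `V_i^{(α)}`.

*There are no other flows.* The poles of `Q` at `w_α` and `∞` are of odd order, and there the
operator `A ↦ 2 Q A' + Q' A` shifts orders by a fixed amount, unless the pole is simple and `A'''`
dominates; at `q_J` the indicial polynomial of the equation is `(k + 1) (k - 1) (k - 3)`. Hence the
function `A` of an isomonodromic flow has at most simple poles, at the `q_J` only, and vanishes at
infinity, which makes it a combination of the `1 / (x - q_J)` (`exists_eq_poleSum`). Subtracting the
corresponding combination of the `L_J`, and the `L_i^{(α)}` that remove the low components, leaves a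
tangent vector that preserves `Q` and has no low component; such a vector is zero
(`eq_zero_of_dQ_eq_zero`).

The last argument needs the pole of `Q` at `w_α` to have order exactly `2 m_α - 1`. When `m_α = 1`
this fails at those points of `X` at which `R / ħ + S` cancels the leading coefficient of `Q₀ / ħ²`.
A small change of one `v_I` leads away from them (`eventually_isNondegenerate_shift`). They are
treated by continuity: belonging to the span of linearly independent vectors is a closed condition
(`mem_span_range_of_tendsto`), and so is the equality of two vector fields (`eq_of_solvesFuchs`).
-/

open Filter Topology

/-! ### Leading terms of Laurent expansions -/

/-- `f` has a Laurent expansion at `c` that starts with `a * (x - c) ^ k`. The coefficient `a` may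
vanish, so that `∃ a, HasLead f c k a` says that `f` is meromorphic at `c` of order at least `k`. -/
def HasLead (f : ℂ → ℂ) (c : ℂ) (k : ℤ) (a : ℂ) : Prop :=
  ∃ g : ℂ → ℂ, AnalyticAt ℂ g c ∧ g c = a ∧ ∀ᶠ x in 𝓝[≠] c, f x = (x - c) ^ k * g x

/-- `f` has a Laurent expansion at infinity that starts with `a * x ^ (-k)`; as in `HasLead`, the
coefficient `a` may vanish. -/
def HasLeadInf (f : ℂ → ℂ) (k : ℤ) (a : ℂ) : Prop := HasLead (fun s => f s⁻¹) 0 k a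

namespace HasLead

variable {f f₁ f₂ : ℂ → ℂ} {c : ℂ} {k l : ℤ} {a b : ℂ}

lemma eventually_ne (c : ℂ) : ∀ᶠ x in 𝓝[≠] c, x - c ≠ 0 := by
  filter_upwards [self_mem_nhdsWithin] with x hx
  exact sub_ne_zero.2 hx

lemma congr (h : HasLead f₁ c k a) (e : ∀ᶠ x in 𝓝[≠] c, f₂ x = f₁ x) : HasLead f₂ c k a := by
  obtain ⟨g, hg, hga, hf⟩ := h
  refine ⟨g, hg, hga, ?_⟩
  filter_upwards [hf, e] with x h1 h2
  rw [h2, h1]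

lemma of_analyticAt (h : AnalyticAt ℂ f c) : HasLead f c 0 (f c) :=
  ⟨f, h, rfl, Eventually.of_forall fun x => by simp⟩

lemma zero : HasLead (fun _ => 0) c k 0 :=
  ⟨fun _ => 0, analyticAt_const, rfl, Eventually.of_forall fun x => by simp⟩

lemma zpow (c : ℂ) (k : ℤ) : HasLead (fun x => (x - c) ^ k) c k 1 :=
  ⟨fun _ => 1, analyticAt_const, rfl, Eventually.of_forall fun x => by simp⟩

lemma add (h₁ : HasLead f₁ c k a) (h₂ : HasLead f₂ c k b) :
    HasLead (fun x => f₁ x + f₂ x) c k (a + b) := by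
  obtain ⟨g, hg, rfl, hf⟩ := h₁
  obtain ⟨g', hg', rfl, hf'⟩ := h₂
  refine ⟨fun x => g x + g' x, hg.fun_add hg', rfl, ?_⟩
  filter_upwards [hf, hf'] with x h1 h2
  rw [h1, h2]; ring

lemma mul (h₁ : HasLead f₁ c k a) (h₂ : HasLead f₂ c l b) :
    HasLead (fun x => f₁ x * f₂ x) c (k + l) (a * b) := by
  obtain ⟨g, hg, rfl, hf⟩ := h₁
  obtain ⟨g', hg', rfl, hf'⟩ := h₂
  refine ⟨fun x => g x * g' x, hg.fun_mul hg', rfl, ?_⟩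
  filter_upwards [hf, hf', eventually_ne c] with x h1 h2 h3
  rw [h1, h2, zpow_add₀ h3]; ring

lemma const_mul (z : ℂ) (h : HasLead f c k a) : HasLead (fun x => z * f x) c k (z * a) := by
  simpa using (of_analyticAt (f := fun _ => z) (c := c) analyticAt_const).mul h

lemma neg (h : HasLead f c k a) : HasLead (fun x => -f x) c k (-a) := by
  simpa using h.const_mul (-1)

lemma sub (h₁ : HasLead f₁ c k a) (h₂ : HasLead f₂ c k b) :
    HasLead (fun x => f₁ x - f₂ x) c k (a - b) := by
  simpa [sub_eq_add_neg] using h₁.add h₂.neg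

lemma sum {ι : Type*} (s : Finset ι) {f : ι → ℂ → ℂ} {a : ι → ℂ}
    (h : ∀ i ∈ s, HasLead (f i) c k (a i)) :
    HasLead (fun x => ∑ i ∈ s, f i x) c k (∑ i ∈ s, a i) := by
  classical
  induction s using Finset.induction_on with
  | empty => simpa using zero
  | insert i s hi ih =>
    simp only [Finset.sum_insert hi]
    exact (h i (by simp)).add (ih fun j hj => h j (by simp [hj]))

lemma exists_sum {ι : Type*} (s : Finset ι) {f : ι → ℂ → ℂ}
    (h : ∀ i ∈ s, ∃ a, HasLead (f i) c k a) : ∃ a, HasLead (fun x => ∑ i ∈ s, f i x) c k a := by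
  choose! a ha using h
  exact ⟨_, sum s ha⟩

/-- Read to a lower order, the leading coefficient is zero. -/
lemma weaken (h : HasLead f c k a) (hl : l < k) : HasLead f c l 0 := by
  obtain ⟨g, hg, rfl, hf⟩ := h
  obtain ⟨n, hn⟩ := Int.eq_ofNat_of_zero_le (by lia : 0 ≤ k - l - 1)
  refine ⟨fun x => (x - c) ^ (n + 1) * g x, by fun_prop, by simp, ?_⟩
  filter_upwards [hf, eventually_ne c] with x h1 h3
  have : k = l + ((n + 1 : ℕ) : ℤ) := by push_cast; lia
  rw [h1, this, zpow_add₀ h3, zpow_natCast]; ring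

/-- Being of order at least `k` implies being of order at least `l ≤ k`. -/
lemma exists_of_le (h : HasLead f c k a) (hl : l ≤ k) : ∃ b, HasLead f c l b := by
  rcases hl.eq_or_lt with rfl | hl
  · exact ⟨a, h⟩
  · exact ⟨0, h.weaken hl⟩

lemma tendsto (h : HasLead f c 0 a) : Tendsto f (𝓝[≠] c) (𝓝 a) := by
  obtain ⟨g, hg, rfl, hf⟩ := h
  refine (hg.continuousAt.tendsto.mono_left nhdsWithin_le_nhds).congr' ?_
  filter_upwards [hf] with x hx
  simp [hx]

lemma mul_zpow (h : HasLead f c k a) (l : ℤ) :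
    HasLead (fun x => f x * (x - c) ^ l) c (k + l) a := by
  simpa using h.mul (zpow c l)

lemma unique (h₁ : HasLead f c k a) (h₂ : HasLead f c k b) : a = b := by
  have h₁ := h₁.mul_zpow (-k)
  have h₂ := h₂.mul_zpow (-k)
  rw [add_neg_cancel] at h₁ h₂
  exact tendsto_nhds_unique h₁.tendsto h₂.tendsto

lemma eventually_analyticAt (h : HasLead f c k a) : ∀ᶠ x in 𝓝[≠] c, AnalyticAt ℂ f x := by
  obtain ⟨g, hg, rfl, hf⟩ := h
  have h1 : ∀ᶠ x in 𝓝[≠] c, AnalyticAt ℂ g x :=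
    hg.eventually_analyticAt.filter_mono nhdsWithin_le_nhds
  filter_upwards [h1, eventually_ne c, eventually_eventually_nhdsWithin.2 hf,
    self_mem_nhdsWithin] with x hx h3 h4 h5
  have h6 : ∀ᶠ y in 𝓝 x, f y = (y - c) ^ k * g y := by
    rwa [isOpen_compl_singleton.nhdsWithin_eq h5] at h4
  refine AnalyticAt.congr ?_ (h6.mono fun y hy => hy.symm)
  have : AnalyticAt ℂ (fun y => (y - c) ^ k) x :=
    AnalyticAt.fun_zpow (by fun_prop) h3
  fun_prop

lemma deriv (h : HasLead f c k a) : HasLead (deriv f) c (k - 1) (k * a) := by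
  obtain ⟨g, hg, rfl, hf⟩ := h
  refine ⟨fun x => k * g x + (x - c) * _root_.deriv g x, ?_, by simp, ?_⟩
  · have := hg.deriv
    fun_prop
  have h1 : ∀ᶠ x in 𝓝[≠] c, AnalyticAt ℂ g x :=
    hg.eventually_analyticAt.filter_mono nhdsWithin_le_nhds
  filter_upwards [h1, eventually_ne c, eventually_eventually_nhdsWithin.2 hf,
    self_mem_nhdsWithin] with x hx h3 h4 h5
  have h6 : ∀ᶠ y in 𝓝 x, f y = (y - c) ^ k * g y := by
    rwa [isOpen_compl_singleton.nhdsWithin_eq h5] at h4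
  have h7 : HasDerivAt (fun y => (y - c) ^ k * g y)
      ((k * (x - c) ^ (k - 1) * 1) * g x + (x - c) ^ k * _root_.deriv g x) x := by
    have h8 := (hasDerivAt_zpow k (x - c) (Or.inl h3)).comp x ((hasDerivAt_id x).sub_const c)
    exact h8.mul hx.differentiableAt.hasDerivAt
  rw [(h7.congr_of_eventuallyEq h6).deriv]
  have : (x - c) ^ k = (x - c) ^ (k - 1) * (x - c) := by
    rw [← zpow_add_one₀ h3]; simp
  rw [this]; ring

lemma inv (h : HasLead f c k a) (ha : a ≠ 0) : HasLead (fun x => (f x)⁻¹) c (-k) a⁻¹ := by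
  obtain ⟨g, hg, rfl, hf⟩ := h
  refine ⟨fun x => (g x)⁻¹, hg.inv ha, rfl, ?_⟩
  filter_upwards [hf] with x hx
  rw [hx, mul_inv, zpow_neg]

lemma congr_order (h : HasLead f c k a) (e : l = k) : HasLead f c l a := e ▸ h

lemma congr_coeff (h : HasLead f c k a) (e : b = a) : HasLead f c k b := e ▸ h

lemma pow (h : HasLead f c k a) (n : ℕ) : HasLead (fun x => f x ^ n) c (n * k) (a ^ n) := by
  induction n with
  | zero => simpa using of_analyticAt (f := fun _ => (1 : ℂ)) (c := c) analyticAt_const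
  | succ n ih =>
    simp only [pow_succ]
    exact (ih.mul h).congr_order (by push_cast; ring)

lemma prod {ι : Type*} (s : Finset ι) {f : ι → ℂ → ℂ} {k : ι → ℤ} {a : ι → ℂ}
    (h : ∀ i ∈ s, HasLead (f i) c (k i) (a i)) :
    HasLead (fun x => ∏ i ∈ s, f i x) c (∑ i ∈ s, k i) (∏ i ∈ s, a i) := by
  classical
  induction s using Finset.induction_on with
  | empty => simpa using of_analyticAt (f := fun _ => (1 : ℂ)) (c := c) analyticAt_const
  | insert i s hi ih =>
    simp only [Finset.prod_insert hi, Finset.sum_insert hi]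
    exact (h i (by simp)).mul (ih fun j hj => h j (by simp [hj]))

/-- A vanishing leading coefficient raises the order. -/
lemma succ (h : HasLead f c k 0) : ∃ a, HasLead f c (k + 1) a := by
  obtain ⟨g, hg, hg0, hf⟩ := h
  obtain ⟨p, hp⟩ := hg
  refine ⟨dslope g c c, dslope g c, ⟨_, hp.has_fpower_series_dslope_fslope⟩, rfl, ?_⟩
  filter_upwards [hf, eventually_ne c] with x hx h3
  have h2 := sub_smul_dslope g c x
  rw [hg0, smul_eq_mul, sub_zero] at h2
  rw [hx, ← h2, zpow_add_one₀ h3]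
  ring

/-- A meromorphic germ either vanishes or has a non-zero leading coefficient. -/
lemma _root_.MeromorphicAt.eventually_zero_or_hasLead (h : MeromorphicAt f c) :
    (∀ᶠ x in 𝓝[≠] c, f x = 0) ∨ ∃ k a, a ≠ 0 ∧ HasLead f c k a := by
  rcases h.eventually_eq_zero_or_eventually_ne_zero with h0 | h0
  · exact Or.inl h0
  · right
    have h1 : meromorphicOrderAt f c ≠ ⊤ := by
      rw [meromorphicOrderAt_ne_top_iff_eventually_ne_zero h]; exact h0
    obtain ⟨g, hg, hg0, hf⟩ := (meromorphicOrderAt_ne_top_iff h).1 h1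
    exact ⟨_, g c, hg0, g, hg, rfl, hf⟩

/-- To bound the order of a meromorphic germ from below, one may assume that its leading
coefficient does not vanish. -/
lemma _root_.MeromorphicAt.exists_hasLead (h : MeromorphicAt f c)
    (hk : ∀ l a, a ≠ 0 → HasLead f c l a → k ≤ l) : ∃ a, HasLead f c k a := by
  rcases h.eventually_zero_or_hasLead with h0 | ⟨l, a, ha, hl⟩
  · exact ⟨0, zero.congr h0⟩
  · exact hl.exists_of_le (hk l a ha hl)

/-- Distinct monomials of order below `k` cannot cancel to order `k`. -/
lemma coeff_eq_zero {ι : Type*} (s : Finset ι) (coeff : ι → ℂ) (e : ι → ℤ)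
    (he : Set.InjOn e s) (h : HasLead (fun x => ∑ i ∈ s, coeff i * (x - c) ^ e i) c k a) :
    ∀ i ∈ s, e i < k → coeff i = 0 := by
  classical
  by_contra! hcon
  obtain ⟨i₁, h₁, h₁', h₁''⟩ := hcon
  -- the non-zero coefficient of least exponent is the leading coefficient of the sum
  obtain ⟨i, hi, hmin⟩ := Finset.exists_min_image (s.filter fun i => coeff i ≠ 0) e
    ⟨i₁, by simp [h₁, h₁'']⟩
  simp only [Finset.mem_filter, and_imp] at hi hmin
  have h2 : HasLead (fun x => ∑ j ∈ s, coeff j * (x - c) ^ e j) c (e i)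
      (∑ j ∈ s, if j = i then coeff i else 0) := by
    refine sum s fun j hj => ?_
    by_cases hji : j = i
    · subst hji; simpa using (zpow c (e j)).const_mul (coeff j)
    · rw [if_neg hji]
      by_cases hc : coeff j = 0
      · simpa [hc] using zero
      · have := hmin j hj hc
        have hne : e i ≠ e j := fun h => hji (he hj hi.1 h.symm)
        exact (((zpow c (e j)).const_mul (coeff j))).weaken (lt_of_le_of_ne this hne)
  have h3 := h2.unique (h.weaken (lt_of_le_of_lt (hmin i₁ h₁ h₁'') h₁'))
  rw [Finset.sum_ite_eq' s i] at h3
  simp [hi.1, hi.2] at h3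

end HasLead

namespace HasLeadInf

variable {f f₁ f₂ : ℂ → ℂ} {k l : ℤ} {a b : ℂ}

/-- Over the punctured neighbourhoods of `0`, `s ↦ s⁻¹` runs through the neighbourhoods of `∞`. -/
lemma eventually_inv {P : ℂ → Prop} (h : ∀ᶠ x in cocompact ℂ, P x) :
    ∀ᶠ s in 𝓝[≠] (0 : ℂ), P s⁻¹ := by
  rw [← Metric.cobounded_eq_cocompact] at h
  exact tendsto_inv₀_nhdsNE_zero.eventually h

lemma congr (h : HasLeadInf f₁ k a) (e : ∀ᶠ x in cocompact ℂ, f₂ x = f₁ x) : HasLeadInf f₂ k a :=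
  HasLead.congr h (eventually_inv e)

lemma congr_order (h : HasLeadInf f k a) (e : l = k) : HasLeadInf f l a := e ▸ h

lemma congr_coeff (h : HasLeadInf f k a) (e : b = a) : HasLeadInf f k b := e ▸ h

lemma zero : HasLeadInf (fun _ => 0) k 0 := HasLead.zero

lemma const (z : ℂ) : HasLeadInf (fun _ => z) 0 z :=
  HasLead.of_analyticAt (f := fun _ => z) analyticAt_const

lemma add (h₁ : HasLeadInf f₁ k a) (h₂ : HasLeadInf f₂ k b) :
    HasLeadInf (fun x => f₁ x + f₂ x) k (a + b) := HasLead.add h₁ h₂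

lemma sub (h₁ : HasLeadInf f₁ k a) (h₂ : HasLeadInf f₂ k b) :
    HasLeadInf (fun x => f₁ x - f₂ x) k (a - b) := HasLead.sub h₁ h₂

lemma neg (h : HasLeadInf f k a) : HasLeadInf (fun x => -f x) k (-a) := HasLead.neg h

lemma mul (h₁ : HasLeadInf f₁ k a) (h₂ : HasLeadInf f₂ l b) :
    HasLeadInf (fun x => f₁ x * f₂ x) (k + l) (a * b) := HasLead.mul h₁ h₂

lemma const_mul (z : ℂ) (h : HasLeadInf f k a) : HasLeadInf (fun x => z * f x) k (z * a) :=
  HasLead.const_mul z h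

lemma sum {ι : Type*} (s : Finset ι) {f : ι → ℂ → ℂ} {a : ι → ℂ}
    (h : ∀ i ∈ s, HasLeadInf (f i) k (a i)) :
    HasLeadInf (fun x => ∑ i ∈ s, f i x) k (∑ i ∈ s, a i) := HasLead.sum s h

lemma exists_sum {ι : Type*} (s : Finset ι) {f : ι → ℂ → ℂ}
    (h : ∀ i ∈ s, ∃ a, HasLeadInf (f i) k a) : ∃ a, HasLeadInf (fun x => ∑ i ∈ s, f i x) k a :=
  HasLead.exists_sum s h

lemma prod {ι : Type*} (s : Finset ι) {f : ι → ℂ → ℂ} {k : ι → ℤ} {a : ι → ℂ}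
    (h : ∀ i ∈ s, HasLeadInf (f i) (k i) (a i)) :
    HasLeadInf (fun x => ∏ i ∈ s, f i x) (∑ i ∈ s, k i) (∏ i ∈ s, a i) := HasLead.prod s h

lemma pow (h : HasLeadInf f k a) (n : ℕ) : HasLeadInf (fun x => f x ^ n) (n * k) (a ^ n) :=
  HasLead.pow h n

lemma inv (h : HasLeadInf f k a) (ha : a ≠ 0) : HasLeadInf (fun x => (f x)⁻¹) (-k) a⁻¹ :=
  HasLead.inv h ha

lemma weaken (h : HasLeadInf f k a) (hl : l < k) : HasLeadInf f l 0 := HasLead.weaken h hl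

lemma exists_of_le (h : HasLeadInf f k a) (hl : l ≤ k) : ∃ b, HasLeadInf f l b :=
  HasLead.exists_of_le h hl

lemma unique (h₁ : HasLeadInf f k a) (h₂ : HasLeadInf f k b) : a = b := HasLead.unique h₁ h₂

lemma id : HasLeadInf (fun x => x) (-1) 1 :=
  (HasLead.zpow 0 (-1)).congr (Eventually.of_forall fun s => by simp)

lemma sub_const (q : ℂ) : HasLeadInf (fun x => x - q) (-1) 1 := by
  simpa using id.sub ((const q).weaken (by norm_num : (-1 : ℤ) < 0))

lemma inv_sub_const (q : ℂ) : HasLeadInf (fun x => (x - q)⁻¹) 1 1 := by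
  simpa using (sub_const q).inv one_ne_zero

lemma tendsto (h : HasLeadInf f 0 a) : Tendsto f (cocompact ℂ) (𝓝 a) := by
  have h1 := HasLead.tendsto h
  rw [← Metric.cobounded_eq_cocompact]
  simpa [Function.comp_def] using h1.comp (tendsto_inv₀_cobounded' (α := ℂ))

lemma deriv (h : HasLeadInf f k a) : HasLeadInf (deriv f) (k + 1) (-(k * a)) := by
  -- in the coordinate `s = x⁻¹` the derivation `d / dx` is `-s² d / ds`
  have h1 := (HasLead.deriv h).mul_zpow 2 |>.neg
  refine (h1.congr_order (by ring)).congr ?_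
  filter_upwards [HasLead.eventually_analyticAt h, HasLead.eventually_ne 0] with s hs hs0
  rw [sub_zero] at hs0
  have h2 : HasDerivAt (fun x : ℂ => f (x⁻¹)⁻¹)
      (_root_.deriv (fun s => f s⁻¹) s * (-((s⁻¹) ^ 2)⁻¹)) s⁻¹ := by
    have h4 : HasDerivAt (fun s => f s⁻¹) (_root_.deriv (fun s => f s⁻¹) s) (s⁻¹)⁻¹ := by
      rw [inv_inv]; exact hs.differentiableAt.hasDerivAt
    exact h4.comp s⁻¹ (hasDerivAt_inv (inv_ne_zero hs0))
  simp only [inv_inv] at h2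
  rw [h2.deriv]
  simp

/-- A polynomial that is small at infinity has no terms of high degree. -/
lemma coeff_eq_zero {ι : Type*} (s : Finset ι) (coeff : ι → ℂ) (e : ι → ℕ)
    (he : Set.InjOn e s) (h : HasLeadInf (fun x => ∑ i ∈ s, coeff i * x ^ e i) k a) :
    ∀ i ∈ s, -(e i : ℤ) < k → coeff i = 0 := by
  have h1 : HasLead (fun x => ∑ i ∈ s, coeff i * (x - 0) ^ (-(e i : ℤ))) 0 k a := by
    refine HasLead.congr h (Eventually.of_forall fun x => ?_)
    simp
  exact HasLead.coeff_eq_zero s coeff (fun i => -(e i : ℤ))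
    (fun i hi j hj hij => he hi hj (by simpa using hij)) h1

end HasLeadInf

lemma HasLead.meromorphicAt {f : ℂ → ℂ} {c a : ℂ} {k : ℤ} (h : HasLead f c k a) :
    MeromorphicAt f c := by
  obtain ⟨g, hg, -, hf⟩ := h
  have : MeromorphicAt (fun x => (x - c) ^ k * g x) c :=
    (((MeromorphicAt.id c).sub (MeromorphicAt.const c c)).zpow k).mul hg.meromorphicAt
  exact this.congr (hf.mono fun x hx => hx.symm)

lemma MeromorphicAt.exists_order_hasLead {f : ℂ → ℂ} {c : ℂ} (h : MeromorphicAt f c) :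
    ∃ k a, HasLead f c k a := by
  rcases h.eventually_zero_or_hasLead with h | ⟨k, a, -, h⟩
  · exact ⟨0, 0, HasLead.zero.congr h⟩
  · exact ⟨k, a, h⟩

/-! ### Liouville's theorem -/

/-- Liouville's theorem for functions with removable singularities that vanish at infinity. -/
lemma eq_zero_of_hasLead {f : ℂ → ℂ} (W : Set ℂ) (hW : W.Finite)
    (hf : ∀ x ∉ W, DifferentiableAt ℂ f x) (hs : ∀ c ∈ W, ∃ a, HasLead f c 0 a)
    (hi : ∃ a, HasLeadInf f 1 a) : ∀ x ∉ W, f x = 0 := by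
  classical
  choose! a ha using hs
  -- the removable singularities are filled in with the leading coefficients
  set g : ℂ → ℂ := fun x => if x ∈ W then a x else f x with hg
  have hopen (c : ℂ) : ∀ᶠ x in 𝓝[≠] c, x ∉ W := by
    have h1 : (W \ {c})ᶜ ∈ 𝓝 c :=
      (hW.subset Set.sdiff_subset).isClosed.isOpen_compl.mem_nhds (by simp)
    filter_upwards [nhdsWithin_le_nhds h1, self_mem_nhdsWithin] with x hx hxc hxW
    exact hx ⟨hxW, hxc⟩
  have hd : Differentiable ℂ g := by
    intro c
    by_cases hc : c ∈ W
    · obtain ⟨g', hg', hga, hfe⟩ := ha c hc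
      refine hg'.differentiableAt.congr_of_eventuallyEq ?_
      have : ∀ᶠ x in 𝓝[≠] c, g x = g' x := by
        filter_upwards [hfe, hopen c] with x hx hxW
        simp [hg, hxW, hx]
      rw [Filter.EventuallyEq]
      rw [eventually_nhdsWithin_iff] at this
      filter_upwards [this] with x hx
      by_cases hxc : x = c
      · subst hxc; simp [hg, hc, hga]
      · exact hx hxc
    · refine (hf c hc).congr_of_eventuallyEq ?_
      filter_upwards [hW.isClosed.isOpen_compl.mem_nhds hc] with x hx
      simp only [hg, if_neg (show x ∉ W from hx)]
  obtain ⟨b, hb⟩ := hi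
  have ht : Tendsto g (cocompact ℂ) (𝓝 0) := by
    refine (hb.weaken one_pos).tendsto.congr' ?_
    have : ∀ᶠ x in cocompact ℂ, x ∉ W := hW.isCompact.compl_mem_cocompact
    filter_upwards [this] with x hx
    simp [hg, hx]
  intro x hx
  have := hd.apply_eq_of_tendsto_cocompact x ht
  simpa [hg, hx] using this

/-! ### Orders of solutions of `A''' - 4 Q A' - 2 Q' A = -2 ∂_t Q` -/

/-- At a pole of odd order `r` of `Q` the operator `A ↦ 2 Q A' + Q' A` lowers the order by exactly
`r + 1`, because `2 k ≠ r` for every integer `k`. A multiple of `A'''` does not interfere if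
`r ≥ 3`. -/
lemma exists_hasLead_of_odd_pole {Q A : ℂ → ℂ} {c a : ℂ} {r l : ℤ} {z : ℂ} (hr : Odd r)
    (ha : a ≠ 0) (hQ : HasLead Q c (-r) a) (hA : MeromorphicAt A c) (hz : z = 0 ∨ 3 ≤ r)
    (h : ∃ b, HasLead (fun x => 2 * (Q x * deriv A x) + deriv Q x * A x
      + z * deriv (deriv (deriv A)) x) c l b) :
    ∃ b, HasLead A c (l + r + 1) b := by
  refine hA.exists_hasLead fun k b hb hk => ?_
  by_contra! hlt
  obtain ⟨d, h⟩ := h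
  have h1 : HasLead (fun x => 2 * (Q x * deriv A x) + deriv Q x * A x) c (k - r - 1)
      ((2 * k - r) * a * b) :=
    ((((hQ.mul hk.deriv).const_mul 2).congr_order (by ring)).add
      ((hQ.deriv.mul hk).congr_order (by ring))).congr_coeff (by push_cast; ring)
  have h2 : HasLead (fun x => z * deriv (deriv (deriv A)) x) c (k - r - 1) 0 := by
    rcases hz with rfl | hz
    · simpa using HasLead.zero
    · exact (hk.deriv.deriv.deriv.const_mul z).weaken (by linarith)
  have h3 := (h1.add h2).unique (h.weaken (by linarith))
  have h4 : (2 * k - r : ℂ) ≠ 0 := by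
    obtain ⟨j, rfl⟩ := hr
    have : (2 * k - (2 * j + 1) : ℤ) ≠ 0 := by lia
    exact_mod_cast this
  simp [h4, ha, hb] at h3

/-- At infinity a potential of odd positive degree `r` dominates the term `A'''`. -/
lemma exists_hasLeadInf_of_odd_pole {Q A : ℂ → ℂ} {a : ℂ} {r l : ℤ} {z : ℂ} (hr : Odd r)
    (hr' : 0 < r) (ha : a ≠ 0) (hQ : HasLeadInf Q (-r) a) (hA : MeromorphicAt (fun s => A s⁻¹) 0)
    (h : ∃ b, HasLeadInf (fun x => 2 * (Q x * deriv A x) + deriv Q x * A x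
      + z * deriv (deriv (deriv A)) x) l b) :
    ∃ b, HasLeadInf A (l + r - 1) b := by
  refine hA.exists_hasLead fun k b hb hk => ?_
  by_contra! hlt
  obtain ⟨d, h⟩ := h
  replace hk : HasLeadInf A k b := hk
  have h1 : HasLeadInf (fun x => 2 * (Q x * deriv A x) + deriv Q x * A x) (k - r + 1)
      ((r - 2 * k) * a * b) :=
    ((((hQ.mul hk.deriv).const_mul 2).congr_order (by ring)).add
      ((hQ.deriv.mul hk).congr_order (by ring))).congr_coeff (by push_cast; ring)
  have h2 : HasLeadInf (fun x => z * deriv (deriv (deriv A)) x) (k - r + 1) 0 :=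
    (hk.deriv.deriv.deriv.const_mul z).weaken (by linarith)
  have h3 := (h1.add h2).unique (h.weaken (by linarith))
  have h4 : (r - 2 * k : ℂ) ≠ 0 := by
    obtain ⟨j, rfl⟩ := hr
    have : ((2 * j + 1) - 2 * k : ℤ) ≠ 0 := by lia
    exact_mod_cast this
  simp [h4, ha, hb] at h3

/-- Where `Q` has at most a simple pole, a pole of `A` would persist in `A'''`. -/
lemma exists_hasLead_of_simple_pole {Q A : ℂ → ℂ} {c a : ℂ}
    (hQ : HasLead Q c (-1) a) (hA : MeromorphicAt A c)
    (h : ∃ b, HasLead (fun x => 2 * (Q x * deriv A x) + deriv Q x * A x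
      + (-1 / 2) * deriv (deriv (deriv A)) x) c (-3) b) :
    ∃ b, HasLead A c 0 b := by
  refine hA.exists_hasLead fun k b hb hk => ?_
  by_contra! hlt
  obtain ⟨d, h⟩ := h
  have h1 : HasLead (fun x => 2 * (Q x * deriv A x) + deriv Q x * A x) c (k - 3) 0 :=
    ((((hQ.mul hk.deriv).const_mul 2).congr_order (l := k - 2) (by ring)).add
      ((hQ.deriv.mul hk).congr_order (by ring))).weaken (by linarith)
  have h2 : HasLead (fun x => (-1 / 2) * deriv (deriv (deriv A)) x) c (k - 3)
      ((-1 / 2) * (k * (k - 1) * (k - 2) * b)) :=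
    ((hk.deriv.deriv.deriv.const_mul (-1 / 2)).congr_order (by ring)).congr_coeff
      (by push_cast; ring)
  have h3 := (h1.add h2).unique (h.weaken (by linarith))
  have h4 : (k * (k - 1) * (k - 2) : ℂ) ≠ 0 := by
    have : (k * (k - 1) * (k - 2) : ℤ) ≠ 0 := by
      have h1 : k ≠ 0 := by lia
      have h2 : k - 1 ≠ 0 := by lia
      have h3 : k - 2 ≠ 0 := by lia
      positivity
    exact_mod_cast this
  rw [zero_add] at h3
  have h5 : (-1 / 2 : ℂ) * (k * (k - 1) * (k - 2) * b) ≠ 0 :=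
    mul_ne_zero (by norm_num) (mul_ne_zero h4 hb)
  exact h5 h3

/-- At a double pole `3 / (4 y ^ 2)` of `Q` the indicial polynomial of the equation for `A` is
`(k + 1) (k - 1) (k - 3)`, so that `A` has at most a simple pole. -/
lemma exists_hasLead_of_apparent_pole {Q A : ℂ → ℂ} {c : ℂ}
    (hQ : HasLead Q c (-2) (3 / 4)) (hA : MeromorphicAt A c)
    (h : ∃ b, HasLead (fun x => 2 * (Q x * deriv A x) + deriv Q x * A x
      + (-1 / 2) * deriv (deriv (deriv A)) x) c (-4) b) :
    ∃ b, HasLead A c (-1) b := by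
  refine hA.exists_hasLead fun k b hb hk => ?_
  by_contra! hlt
  obtain ⟨d, h⟩ := h
  have h1 : HasLead (fun x => 2 * (Q x * deriv A x) + deriv Q x * A x) c (k - 3)
      (3 / 2 * (k - 1) * b) :=
    ((((hQ.mul hk.deriv).const_mul 2).congr_order (l := k - 3) (by ring)).add
      ((hQ.deriv.mul hk).congr_order (by ring))).congr_coeff (by push_cast; ring)
  have h2 : HasLead (fun x => (-1 / 2) * deriv (deriv (deriv A)) x) c (k - 3)
      ((-1 / 2) * (k * (k - 1) * (k - 2) * b)) :=
    ((hk.deriv.deriv.deriv.const_mul (-1 / 2)).congr_order (by ring)).congr_coeff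
      (by push_cast; ring)
  have h3 := (h1.add h2).unique (h.weaken (by linarith))
  have h4 : ((k + 1) * (k - 1) * (k - 3) : ℂ) ≠ 0 := by
    have : ((k + 1) * (k - 1) * (k - 3) : ℤ) ≠ 0 := by
      have h1 : k + 1 ≠ 0 := by lia
      have h2 : k - 1 ≠ 0 := by lia
      have h3 : k - 3 ≠ 0 := by lia
      positivity
    exact_mod_cast this
  exact mul_ne_zero h4 hb (by linear_combination (-2) * h3)

/-! ### Analytic dependence on parameters -/

section Parameters

variable {E : Type*} [NormedAddCommGroup E] [NormedSpace ℂ E]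

@[fun_prop]
lemma AnalyticAt.comp_fst {F G : Type*} [NormedAddCommGroup F] [NormedSpace ℂ F]
    [NormedAddCommGroup G] [NormedSpace ℂ G] {f : E → F × G} {e : E} (hf : AnalyticAt ℂ f e) :
    AnalyticAt ℂ (fun e => (f e).1) e :=
  analyticAt_fst.fun_comp hf

@[fun_prop]
lemma AnalyticAt.comp_snd {F G : Type*} [NormedAddCommGroup F] [NormedSpace ℂ F]
    [NormedAddCommGroup G] [NormedSpace ℂ G] {f : E → F × G} {e : E} (hf : AnalyticAt ℂ f e) :
    AnalyticAt ℂ (fun e => (f e).2) e :=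
  analyticAt_snd.fun_comp hf

lemma AnalyticAt.deriv_snd {f : E × ℂ → ℂ} {ξ : E} {x : ℂ} (h : AnalyticAt ℂ f (ξ, x)) :
    AnalyticAt ℂ (fun z : E × ℂ => deriv (fun y => f (z.1, y)) z.2) (ξ, x) := by
  have h1 : AnalyticAt ℂ (fun z => fderiv ℂ f z (0, 1)) (ξ, x) :=
    (ContinuousLinearMap.apply ℂ ℂ ((0, 1) : E × ℂ)).analyticAt _ |>.comp h.fderiv
  refine h1.congr ?_
  filter_upwards [h.eventually_analyticAt] with z hz
  have h2 : HasDerivAt (fun y : ℂ => ((z.1, y) : E × ℂ)) (0, 1) z.2 :=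
    (hasDerivAt_const z.2 z.1).prodMk (hasDerivAt_id z.2)
  exact (HasFDerivAt.comp_hasDerivAt z.2 hz.differentiableAt.hasFDerivAt h2).deriv.symm

lemma AnalyticAt.fderiv_fst {f : E × ℂ → ℂ} {ξ : E} {x : ℂ} (h : AnalyticAt ℂ f (ξ, x)) (t : E) :
    AnalyticAt ℂ (fun y : ℂ => fderiv ℂ (fun η => f (η, y)) ξ t) x := by
  have h0 : AnalyticAt ℂ (fun y : ℂ => ((ξ, y) : E × ℂ)) x := by fun_prop
  have h1 : AnalyticAt ℂ (fun y : ℂ => fderiv ℂ f (ξ, y) (t, 0)) x :=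
    ((ContinuousLinearMap.apply ℂ ℂ ((t, 0) : E × ℂ)).analyticAt _ |>.comp h.fderiv).fun_comp h0
  refine h1.congr ?_
  filter_upwards [h0.continuousAt.eventually h.eventually_analyticAt] with y hy
  have h2 : HasFDerivAt (fun η : E => ((η, y) : E × ℂ)) (ContinuousLinearMap.inl ℂ E ℂ) ξ :=
    hasFDerivAt_prodMk_left ξ y
  have h3 := HasFDerivAt.comp ξ (f := fun η : E => ((η, y) : E × ℂ))
    hy.differentiableAt.hasFDerivAt h2
  have h4 := h3.fderiv
  simp only [Function.comp_def] at h4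
  rw [h4]
  simp

lemma AnalyticAt.curry_right' {f : E × ℂ → ℂ} {ξ : E} {x : ℂ} (h : AnalyticAt ℂ f (ξ, x)) :
    AnalyticAt ℂ (fun y => f (ξ, y)) x :=
  h.fun_comp (f := fun y : ℂ => ((ξ, y) : E × ℂ)) (by fun_prop)

/-- The total differential of a function of a parameter and of `x`. -/
lemma AnalyticAt.fderiv_prod_apply {f : E × ℂ → ℂ} {ξ : E} {x : ℂ} (h : AnalyticAt ℂ f (ξ, x))
    (t : E) (y : ℂ) : fderiv ℂ f (ξ, x) (t, y)
      = fderiv ℂ (fun η => f (η, x)) ξ t + deriv (fun x => f (ξ, x)) x * y := by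
  have hd := h.differentiableAt.hasFDerivAt
  have h1 := (hd.comp ξ (f := fun η : E => ((η, x) : E × ℂ)) (hasFDerivAt_prodMk_left ξ x)).fderiv
  have h2 : HasDerivAt (fun y : ℂ => ((ξ, y) : E × ℂ)) (0, 1) x :=
    (hasDerivAt_const x ξ).prodMk (hasDerivAt_id x)
  have h3 := (HasFDerivAt.comp_hasDerivAt x hd h2).deriv
  simp only [Function.comp_def] at h1 h3
  rw [h1, h3]
  have : ((t, y) : E × ℂ) = (t, 0) + y • ((0, 1) : E × ℂ) := by simp
  rw [this, map_add, map_smul]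
  simp [mul_comm]

lemma hasFDerivAt_of_eq_clm {F : Type*} [NormedAddCommGroup F] [NormedSpace ℂ F] {f : E → F}
    (L : E →L[ℂ] F) (h : ∀ e, f e = L e) (e : E) : HasFDerivAt f L e :=
  L.hasFDerivAt.congr_of_eventuallyEq (Eventually.of_forall h)

lemma fderiv_eq_of_hasDerivAt_line {f : E → ℂ} {ξ t : E} (h : DifferentiableAt ℂ f ξ) {d : ℂ}
    (hd : HasDerivAt (fun s : ℂ => f (ξ + s • t)) d 0) : fderiv ℂ f ξ t = d := by
  rw [← h.lineDeriv_eq_fderiv, lineDeriv, hd.deriv]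

end Parameters

/-- Taylor's formula with an analytic remainder, to second order. -/
lemma AnalyticAt.exists_taylor_two {f : ℂ → ℂ} {c : ℂ} (h : AnalyticAt ℂ f c) :
    ∃ g, AnalyticAt ℂ g c ∧ ∀ x, f x = f c + (x - c) * deriv f c + (x - c) ^ 2 * g x := by
  have h1 : ∀ {f : ℂ → ℂ}, AnalyticAt ℂ f c → AnalyticAt ℂ (dslope f c) c := by
    intro f hf
    obtain ⟨p, hp⟩ := hf
    exact ⟨_, hp.has_fpower_series_dslope_fslope⟩
  refine ⟨dslope (dslope f c) c, h1 (h1 h), fun x => ?_⟩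
  have h2 := sub_smul_dslope f c x
  have h3 := sub_smul_dslope (dslope f c) c x
  simp only [smul_eq_mul, dslope_same] at h2 h3
  linear_combination -h2 - (x - c) * h3

lemma AnalyticAt.exists_taylor_one {f : ℂ → ℂ} {c : ℂ} (h : AnalyticAt ℂ f c) :
    ∃ g, AnalyticAt ℂ g c ∧ ∀ x, f x = f c + (x - c) * g x := by
  obtain ⟨g, hg, hf⟩ := h.exists_taylor_two
  exact ⟨fun x => deriv f c + (x - c) * g x, by fun_prop, fun x => by rw [hf x]; ring⟩

namespace PoleData

noncomputable section

variable (D : PoleData)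

/-! ### The potential and its singular parts -/

/-- The residue of `Q(x)` at the apparent singularity `q_I`. It is linear in `ξ`, so that
`residue ħ t I` is also its derivative along a tangent vector `t`. -/
def residue (ħ : ℂ) (ξ : D.Ambient) (I : Fin D.n) : ℂ := D.p ξ I / ħ + D.v ξ I

/-- The value at `q_I` of `R / ħ + S`. -/
def nodeValue (ħ : ℂ) (ξ : D.Ambient) (I : Fin D.n) : ℂ :=
  (2 * D.p ξ I * D.v ξ I
        - ∑ K ∈ Finset.univ.erase I, D.p ξ K / (D.q ξ I - D.q ξ K)) / ħ +
  (D.v ξ I ^ 2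
        - ∑ K ∈ Finset.univ.erase I, 3 / (4 * (D.q ξ I - D.q ξ K) ^ 2)
        - ∑ K ∈ Finset.univ.erase I, D.v ξ K / (D.q ξ I - D.q ξ K))

/-- The numerator of `R / ħ + S`, a polynomial of degree less than `n` in `x`. -/
def numer (ħ : ℂ) (ξ : D.Ambient) (x : ℂ) : ℂ :=
  ∑ I, D.F ξ.1 (D.q ξ I) * D.nodeValue ħ ξ I * D.lagrange ξ I x

/-- The summand `R / ħ + S` of the potential. -/
def G (ħ : ℂ) (ξ : D.Ambient) (x : ℂ) : ℂ := D.numer ħ ξ x / D.F ξ.1 x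

/-- The principal part of the potential at `q_J`. -/
def polar (ħ : ℂ) (ξ : D.Ambient) (J : Fin D.n) (x : ℂ) : ℂ :=
  3 / (4 * (x - D.q ξ J) ^ 2) + D.residue ħ ξ J / (x - D.q ξ J)

/-- The potential without its principal part at `q_J`. -/
def H (ħ : ℂ) (ξ : D.Ambient) (J : Fin D.n) (x : ℂ) : ℂ :=
  D.Q0 ξ.1 x / ħ ^ 2 + D.G ħ ξ x + ∑ K ∈ Finset.univ.erase J, D.polar ħ ξ K x

lemma G_eq (ħ : ℂ) (ξ : D.Ambient) (x : ℂ) : D.G ħ ξ x = D.R ξ x / ħ + D.S ξ x := by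
  simp only [G, R, S, numer, nodeValue]
  rw [div_right_comm, ← add_div]
  congr 1
  rw [Finset.sum_div, ← Finset.sum_add_distrib]
  refine Finset.sum_congr rfl fun I _ => ?_
  ring

lemma Q_eq (ħ : ℂ) (ξ : D.Ambient) (x : ℂ) :
    D.Q ħ ξ x = D.Q0 ξ.1 x / ħ ^ 2 + D.G ħ ξ x + ∑ J, D.polar ħ ξ J x := by
  simp only [Q, Q1, Q2, G_eq, polar, residue, Finset.sum_add_distrib, add_div, Finset.sum_div]
  have (J : Fin D.n) : D.p ξ J / (x - D.q ξ J) / ħ = D.p ξ J / ħ / (x - D.q ξ J) :=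
    div_right_comm ..
  simp only [this]
  ring

lemma Q_eq_polar_add_H (ħ : ℂ) (ξ : D.Ambient) (J : Fin D.n) (x : ℂ) :
    D.Q ħ ξ x = D.polar ħ ξ J x + D.H ħ ξ J x := by
  rw [Q_eq, H, ← Finset.add_sum_erase _ _ (Finset.mem_univ J)]
  ring

/-! ### Analyticity -/

section Analytic

variable {D} {E : Type*} [NormedAddCommGroup E] [NormedSpace ℂ E] {e : E}

@[fun_prop]
lemma analyticAt_aInf {f : E → D.Base} (hf : AnalyticAt ℂ f e) (i) :
    AnalyticAt ℂ (fun e => D.aInf (f e) i) e :=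
  analyticAt_pi_iff.1 hf.comp_fst i

@[fun_prop]
lemma analyticAt_aFin {f : E → D.Base} (hf : AnalyticAt ℂ f e) (α i) :
    AnalyticAt ℂ (fun e => D.aFin (f e) α i) e :=
  analyticAt_pi_iff.1 (analyticAt_pi_iff.1 hf.comp_snd.comp_fst α) i

@[fun_prop]
lemma analyticAt_w {f : E → D.Base} (hf : AnalyticAt ℂ f e) (α) :
    AnalyticAt ℂ (fun e => D.w (f e) α) e :=
  analyticAt_pi_iff.1 hf.comp_snd.comp_snd α

@[fun_prop]
lemma analyticAt_q {f : E → D.Ambient} (hf : AnalyticAt ℂ f e) (I) :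
    AnalyticAt ℂ (fun e => D.q (f e) I) e :=
  analyticAt_pi_iff.1 hf.comp_snd.comp_fst I

@[fun_prop]
lemma analyticAt_p {f : E → D.Ambient} (hf : AnalyticAt ℂ f e) (I) :
    AnalyticAt ℂ (fun e => D.p (f e) I) e :=
  analyticAt_pi_iff.1 hf.comp_snd.comp_snd.comp_fst I

@[fun_prop]
lemma analyticAt_v {f : E → D.Ambient} (hf : AnalyticAt ℂ f e) (I) :
    AnalyticAt ℂ (fun e => D.v (f e) I) e :=
  analyticAt_pi_iff.1 hf.comp_snd.comp_snd.comp_snd I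

lemma analyticAt_Q0 {f : E → D.Base} {x : E → ℂ} (hf : AnalyticAt ℂ f e) (hx : AnalyticAt ℂ x e)
    (h : ∀ α, x e ≠ D.w (f e) α) : AnalyticAt ℂ (fun e => D.Q0 (f e) (x e)) e := by
  have h (α) : x e - D.w (f e) α ≠ 0 := sub_ne_zero.2 (h α)
  unfold Q0
  fun_prop (disch := simp [h])

@[fun_prop]
lemma analyticAt_F {f : E → D.Base} {x : E → ℂ} (hf : AnalyticAt ℂ f e) (hx : AnalyticAt ℂ x e) :
    AnalyticAt ℂ (fun e => D.F (f e) (x e)) e := by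
  unfold F
  fun_prop

variable {f : E → D.Ambient} {x : E → ℂ}

lemma analyticAt_sum_div (hf : AnalyticAt ℂ f e) (hq : Function.Injective (D.q (f e))) (I : Fin D.n)
    (m : ℕ) {g : Fin D.n → E → ℂ} (hg : ∀ K, AnalyticAt ℂ (g K) e) (c : ℂ) (hc : c ≠ 0) :
    AnalyticAt ℂ (fun e => ∑ K ∈ Finset.univ.erase I, g K e /
      (c * (D.q (f e) I - D.q (f e) K) ^ m)) e := by
  refine Finset.analyticAt_fun_sum _ fun K hK => ?_
  have : D.q (f e) I - D.q (f e) K ≠ 0 :=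
    sub_ne_zero.2 fun h => (Finset.ne_of_mem_erase hK) (hq h).symm
  have h2 := hg K
  fun_prop (disch := simp [this, hc])

lemma analyticAt_lagrange (hf : AnalyticAt ℂ f e) (hx : AnalyticAt ℂ x e)
    (hq : Function.Injective (D.q (f e))) (I : Fin D.n) :
    AnalyticAt ℂ (fun e => D.lagrange (f e) I (x e)) e := by
  unfold lagrange
  refine Finset.analyticAt_fun_prod _ fun K hK => ?_
  have : D.q (f e) I - D.q (f e) K ≠ 0 :=
    sub_ne_zero.2 fun h => (Finset.ne_of_mem_erase hK) (hq h).symm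
  fun_prop (disch := simp [this])

lemma analyticAt_R (hf : AnalyticAt ℂ f e) (hx : AnalyticAt ℂ x e)
    (hq : Function.Injective (D.q (f e))) (h : D.F (f e).1 (x e) ≠ 0) :
    AnalyticAt ℂ (fun e => D.R (f e) (x e)) e := by
  have h1 (I) := analyticAt_sum_div hf hq I 1 (g := fun K e => D.p (f e) K) (by fun_prop) 1
    one_ne_zero
  have h2 := analyticAt_lagrange hf hx hq
  simp only [one_mul, pow_one] at h1
  unfold R
  fun_prop (disch := exact h)

lemma analyticAt_S (hf : AnalyticAt ℂ f e) (hx : AnalyticAt ℂ x e)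
    (hq : Function.Injective (D.q (f e))) (h : D.F (f e).1 (x e) ≠ 0) :
    AnalyticAt ℂ (fun e => D.S (f e) (x e)) e := by
  have h1 (I) := analyticAt_sum_div hf hq I 1 (g := fun K e => D.v (f e) K) (by fun_prop) 1
    one_ne_zero
  have h3 (I) := analyticAt_sum_div hf hq I 2 (g := fun K e => 3) (by fun_prop) 4 (by norm_num)
  have h2 := analyticAt_lagrange hf hx hq
  simp only [one_mul, pow_one] at h1
  unfold S
  fun_prop (disch := exact h)

lemma analyticAt_numer (ħ : ℂ) (hf : AnalyticAt ℂ f e) (hx : AnalyticAt ℂ x e)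
    (hq : Function.Injective (D.q (f e))) :
    AnalyticAt ℂ (fun e => D.numer ħ (f e) (x e)) e := by
  have h1 (I) := analyticAt_sum_div hf hq I 1 (g := fun K e => D.v (f e) K) (by fun_prop) 1
    one_ne_zero
  have h4 (I) := analyticAt_sum_div hf hq I 1 (g := fun K e => D.p (f e) K) (by fun_prop) 1
    one_ne_zero
  have h3 (I) := analyticAt_sum_div hf hq I 2 (g := fun K e => 3) (by fun_prop) 4 (by norm_num)
  have h2 := analyticAt_lagrange hf hx hq
  simp only [one_mul, pow_one] at h1 h4
  unfold numer nodeValue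
  simp only [div_eq_mul_inv] at *
  fun_prop

lemma F_ne_zero {b : D.Base} {x : ℂ} (h : ∀ α, x ≠ D.w b α) : D.F b x ≠ 0 :=
  Finset.prod_ne_zero_iff.2 fun α _ => pow_ne_zero _ (sub_ne_zero.2 (h α))

lemma analyticAt_G (ħ : ℂ) (hf : AnalyticAt ℂ f e) (hx : AnalyticAt ℂ x e)
    (hq : Function.Injective (D.q (f e))) (h : ∀ α, x e ≠ D.w (f e).1 α) :
    AnalyticAt ℂ (fun e => D.G ħ (f e) (x e)) e :=
  (analyticAt_numer ħ hf hx hq).fun_div (by fun_prop) (F_ne_zero h)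

lemma analyticAt_polar (ħ : ℂ) (hf : AnalyticAt ℂ f e) (hx : AnalyticAt ℂ x e) (J : Fin D.n)
    (h : x e ≠ D.q (f e) J) : AnalyticAt ℂ (fun e => D.polar ħ (f e) J (x e)) e := by
  have h := sub_ne_zero.2 h
  unfold polar residue
  simp only [div_eq_mul_inv]
  fun_prop (disch := simp [h])

lemma analyticAt_H (ħ : ℂ) (hf : AnalyticAt ℂ f e) (hx : AnalyticAt ℂ x e)
    (hq : Function.Injective (D.q (f e))) (h : ∀ α, x e ≠ D.w (f e).1 α) (J : Fin D.n)
    (h' : ∀ K, K ≠ J → x e ≠ D.q (f e) K) : AnalyticAt ℂ (fun e => D.H ħ (f e) J (x e)) e := by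
  have h1 := analyticAt_Q0 hf.comp_fst hx h
  have h2 := analyticAt_G ħ hf hx hq h
  have h3 := Finset.analyticAt_fun_sum (Finset.univ.erase J) (fun K hK =>
    analyticAt_polar ħ hf hx K (h' K (Finset.ne_of_mem_erase hK)))
  unfold H
  simp only [div_eq_mul_inv] at *
  fun_prop

lemma analyticAt_Q (ħ : ℂ) (hf : AnalyticAt ℂ f e) (hx : AnalyticAt ℂ x e)
    (hq : Function.Injective (D.q (f e))) (h : D.IsRegularPoint (f e) (x e)) :
    AnalyticAt ℂ (fun e => D.Q ħ (f e) (x e)) e := by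
  have h1 := analyticAt_Q0 hf.comp_fst hx h.1
  have h2 := analyticAt_G ħ hf hx hq h.1
  have h3 := Finset.analyticAt_fun_sum Finset.univ (fun K _ =>
    analyticAt_polar ħ hf hx K (h.2 K))
  simp only [Q_eq]
  simp only [div_eq_mul_inv] at *
  fun_prop

end Analytic

/-! ### The derivative of the potential along a tangent vector -/

/-- The derivative of `Q₀(x)` in the direction `db` of its parameters. -/
def dQ0 (b db : D.Base) (x : ℂ) : ℂ :=
  ∑ i, D.aInf db i * x ^ (i : ℕ) + ∑ α, ∑ i, D.aFin db α i / (x - D.w b α) ^ ((i : ℕ) + 1)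
    + ∑ α, ∑ i : Fin (2 * D.m α - 1),
      ((i : ℕ) + 1) * D.aFin b α i * D.w db α / (x - D.w b α) ^ ((i : ℕ) + 2)

/-- The derivative of the principal part of `Q(x)` at `q_J` along a tangent vector `t`. -/
def dpolar (ħ : ℂ) (ξ t : D.Ambient) (J : Fin D.n) (x : ℂ) : ℂ :=
  3 / 2 * D.q t J / (x - D.q ξ J) ^ 3 + D.residue ħ ξ J * D.q t J / (x - D.q ξ J) ^ 2
    + D.residue ħ t J / (x - D.q ξ J)

variable {D}

lemma fderiv_Q0 {b : D.Base} {x : ℂ} (h : ∀ α, x ≠ D.w b α) (db : D.Base) :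
    fderiv ℂ (fun b => D.Q0 b x) b db = D.dQ0 b db x := by
  refine fderiv_eq_of_hasDerivAt_line
    (analyticAt_Q0 (f := fun b => b) analyticAt_id analyticAt_const h).differentiableAt ?_
  have h (α) : x - D.w b α ≠ 0 := sub_ne_zero.2 (h α)
  have h1 : ∀ i, HasDerivAt (fun s : ℂ => D.aInf (b + s • db) i * x ^ (i : ℕ))
      (D.aInf db i * x ^ (i : ℕ)) 0 := by
    intro i
    have : HasDerivAt (fun s : ℂ => D.aInf b i + s * D.aInf db i) (D.aInf db i) 0 := by
      simpa using ((hasDerivAt_id (0 : ℂ)).mul_const (D.aInf db i)).const_add (D.aInf b i)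
    exact this.mul_const _
  have h2 : ∀ α i, HasDerivAt
      (fun s : ℂ => D.aFin (b + s • db) α i / (x - D.w (b + s • db) α) ^ ((i : ℕ) + 1))
      (D.aFin db α i / (x - D.w b α) ^ ((i : ℕ) + 1) +
       ((i : ℕ) + 1) * D.aFin b α i * D.w db α / (x - D.w b α) ^ ((i : ℕ) + 2)) 0 := by
    intro α i
    have h3 : HasDerivAt (fun s : ℂ => D.aFin b α i + s * D.aFin db α i) (D.aFin db α i) 0 := by
      simpa using ((hasDerivAt_id (0 : ℂ)).mul_const (D.aFin db α i)).const_add (D.aFin b α i)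
    have h4 : HasDerivAt (fun s : ℂ => x - (D.w b α + s * D.w db α)) (-D.w db α) 0 := by
      simpa using (((hasDerivAt_id (0 : ℂ)).mul_const (D.w db α)).const_add (D.w b α)).const_sub x
    have h5 := h3.fun_div (h4.fun_pow ((i : ℕ) + 1)) (by simp [h])
    refine h5.congr_deriv ?_
    have := h α
    simp only [zero_mul, add_zero]
    field_simp
    push_cast
    ring
  have h6 := ((HasDerivAt.fun_sum (u := Finset.univ) fun i _ => h1 i).const_add
    (x ^ (2 * D.mInf - 5))).fun_add (HasDerivAt.fun_sum (u := Finset.univ) fun α _ =>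
      HasDerivAt.fun_sum (u := Finset.univ) fun i _ => h2 α i)
  refine h6.congr_deriv ?_
  simp only [dQ0, Finset.sum_add_distrib]
  ring

/-- The total differential of `Q₀(q)` in the parameters and in `q`. -/
lemma fderiv_Q0_prod {b : D.Base} {x : ℂ} (h : ∀ α, x ≠ D.w b α) (db : D.Base) (y : ℂ) :
    fderiv ℂ (fun z : D.Base × ℂ => D.Q0 z.1 z.2) (b, x) (db, y)
      = D.dQ0 b db x + deriv (D.Q0 b) x * y := by
  have h1 : AnalyticAt ℂ (fun z : D.Base × ℂ => D.Q0 z.1 z.2) (b, x) :=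
    analyticAt_Q0 analyticAt_fst analyticAt_snd h
  rw [h1.fderiv_prod_apply, fderiv_Q0 h]

lemma fderiv_polar {ħ : ℂ} {ξ : D.Ambient} {x : ℂ} (J : Fin D.n) (h : x ≠ D.q ξ J) (t : D.Ambient) :
    fderiv ℂ (fun η => D.polar ħ η J x) ξ t = D.dpolar ħ ξ t J x := by
  refine fderiv_eq_of_hasDerivAt_line
    (analyticAt_polar ħ (f := fun b => b) analyticAt_id analyticAt_const J h).differentiableAt ?_
  have h : x - D.q ξ J ≠ 0 := sub_ne_zero.2 h
  have h3 : HasDerivAt (fun s : ℂ => D.residue ħ ξ J + s * D.residue ħ t J)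
      (D.residue ħ t J) 0 := by
    simpa using ((hasDerivAt_id (0 : ℂ)).mul_const (D.residue ħ t J)).const_add (D.residue ħ ξ J)
  have h4 : HasDerivAt (fun s : ℂ => x - (D.q ξ J + s * D.q t J)) (-D.q t J) 0 := by
    simpa using (((hasDerivAt_id (0 : ℂ)).mul_const (D.q t J)).const_add (D.q ξ J)).const_sub x
  have h5 := ((hasDerivAt_const (0 : ℂ) (3 : ℂ)).fun_div ((h4.fun_pow 2).const_mul 4)
    (by simp [h])).fun_add (h3.fun_div h4 (by simp [h]))
  refine (h5.congr_of_eventuallyEq (Eventually.of_forall fun s => ?_)).congr_deriv ?_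
  · simp only [polar, residue]
    have e1 : D.q (ξ + s • t) J = D.q ξ J + s * D.q t J := rfl
    have e2 : D.p (ξ + s • t) J = D.p ξ J + s * D.p t J := rfl
    have e3 : D.v (ξ + s • t) J = D.v ξ J + s * D.v t J := rfl
    rw [e1, e2, e3]
    ring
  · simp only [zero_mul, add_zero, dpolar]
    field_simp
    push_cast
    ring

/-! ### Laurent expansions of the constituents of the potential -/

/-- The index of the leading Laurent coefficient `a_{2 m_α - 1}^{(α)}`. -/
def top (D : PoleData) (α : Fin D.N) : Fin (2 * D.m α - 1) :=
  ⟨2 * D.m α - 2, by have := D.one_le_m α; omega⟩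

lemma n_eq (D : PoleData) : (D.n : ℤ) = D.mInf - 3 + ∑ α, (D.m α : ℤ) := by
  have := D.three_le_mInf
  unfold n
  push_cast [this]
  ring

lemma n_pos (D : PoleData) : 0 < D.n := by
  have h1 := D.three_le_mInf
  have h2 := D.ne_five
  unfold n
  rcases Nat.eq_zero_or_pos D.N with h | h
  · have := h2 h
    omega
  · have h3 : D.m ⟨0, h⟩ ≤ ∑ α, D.m α :=
      Finset.single_le_sum (fun _ _ => Nat.zero_le _) (Finset.mem_univ _)
    have := D.one_le_m ⟨0, h⟩
    omega

lemma eventually_isRegularPoint (ξ : D.Ambient) (c : ℂ) :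
    ∀ᶠ x in 𝓝[≠] c, D.IsRegularPoint ξ x := by
  have h (a : ℂ) : ∀ᶠ x in 𝓝[≠] c, x ≠ a := by
    by_cases hc : c = a
    · subst hc; exact self_mem_nhdsWithin
    · exact nhdsWithin_le_nhds (isOpen_ne.mem_nhds hc)
  exact (eventually_all.2 fun α => h _).and (eventually_all.2 fun I => h _)

lemma eventually_cocompact_isRegularPoint (ξ : D.Ambient) :
    ∀ᶠ x in cocompact ℂ, D.IsRegularPoint ξ x := by
  have h (a : ℂ) : ∀ᶠ x in cocompact ℂ, x ≠ a := isCompact_singleton.compl_mem_cocompact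
  exact (eventually_all.2 fun α => h _).and (eventually_all.2 fun I => h _)

lemma IsRegularPoint.eventually {ξ : D.Ambient} {x : ℂ} (h : D.IsRegularPoint ξ x) :
    ∀ᶠ y in 𝓝 x, D.IsRegularPoint ξ y :=
  (eventually_all.2 fun α => isOpen_ne.mem_nhds (h.1 α)).and
    (eventually_all.2 fun I => isOpen_ne.mem_nhds (h.2 I))

/-- The set of the poles `w_α` and `q_I` of the potential. -/
def poles (ξ : D.Ambient) : Set ℂ := Set.range (D.w ξ.1) ∪ Set.range (D.q ξ)

lemma finite_poles (ξ : D.Ambient) : (D.poles ξ).Finite :=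
  (Set.finite_range _).union (Set.finite_range _)

lemma notMem_poles {ξ : D.Ambient} {x : ℂ} : x ∉ D.poles ξ ↔ D.IsRegularPoint ξ x := by
  simp [poles, IsRegularPoint, eq_comm]

lemma hasLead_sub_pow (c : ℂ) (i : ℕ) (a : ℂ) : HasLead (fun x => a / (x - c) ^ i) c (-i) a := by
  simpa [div_eq_mul_inv] using (HasLead.zpow c (-i)).const_mul a

lemma hasLeadInf_div_pow (c : ℂ) (i : ℕ) (a : ℂ) : HasLeadInf (fun x => a / (x - c) ^ i) i a := by
  have h := ((HasLeadInf.inv_sub_const c).pow i).const_mul a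
  simpa [div_eq_mul_inv, HasLeadInf] using h

lemma hasLead_F {b : D.Base} (hw : Function.Injective (D.w b)) (α : Fin D.N) :
    ∃ a, a ≠ 0 ∧ HasLead (D.F b) (D.w b α) (D.m α) a := by
  refine ⟨∏ β ∈ Finset.univ.erase α, (D.w b α - D.w b β) ^ D.m β, ?_, ?_⟩
  · exact Finset.prod_ne_zero_iff.2 fun β hβ => pow_ne_zero _
      (sub_ne_zero.2 fun h => Finset.ne_of_mem_erase hβ (hw h).symm)
  · refine ⟨fun x => ∏ β ∈ Finset.univ.erase α, (x - D.w b β) ^ D.m β, by fun_prop, rfl, ?_⟩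
    refine Eventually.of_forall fun x => ?_
    rw [F, ← Finset.mul_prod_erase _ _ (Finset.mem_univ α), zpow_natCast]

lemma hasLeadInf_F (b : D.Base) : HasLeadInf (D.F b) (-∑ α, (D.m α : ℤ)) 1 := by
  have h := HasLeadInf.prod Finset.univ
    (f := fun α x => (x - D.w b α) ^ D.m α)
    (fun α _ => (HasLeadInf.sub_const (D.w b α)).pow (D.m α))
  simp only [mul_neg, mul_one, one_pow, Finset.prod_const_one, Finset.sum_neg_distrib] at h
  exact h

lemma hasLeadInf_lagrange (ξ : D.Ambient) (I : Fin D.n) :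
    ∃ a, HasLeadInf (D.lagrange ξ I) (1 - D.n) a := by
  have h := HasLeadInf.prod (Finset.univ.erase I)
    (f := fun J x => (D.q ξ I - D.q ξ J)⁻¹ * (x - D.q ξ J))
    (fun J _ => (HasLeadInf.sub_const (D.q ξ J)).const_mul (D.q ξ I - D.q ξ J)⁻¹)
  refine ⟨_, (h.congr_order ?_).congr (Eventually.of_forall fun x => ?_)⟩
  · have := D.n_pos
    simp [Finset.card_erase_of_mem]
    push_cast [Nat.cast_sub this]
    ring
  · exact Finset.prod_congr rfl fun J _ => by rw [div_eq_mul_inv, mul_comm]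

/-- A polynomial of degree less than `n`, divided by `F`, has order at least `4 - m_∞` at
infinity. -/
lemma hasLeadInf_div_F (ξ : D.Ambient) (a : Fin D.n → ℂ) :
    ∃ b, HasLeadInf (fun x => (∑ I, a I * D.lagrange ξ I x) / D.F ξ.1 x) (4 - D.mInf) b := by
  choose b hb using D.hasLeadInf_lagrange ξ
  have h1 := HasLeadInf.sum Finset.univ fun I _ => (hb I).const_mul (a I)
  have h2 := h1.mul ((hasLeadInf_F ξ.1).inv one_ne_zero)
  refine ⟨_, h2.congr_order ?_⟩
  rw [n_eq]; ring

lemma analyticAt_lagrange_sum (ξ : D.Ambient) (a : Fin D.n → ℂ) (x : ℂ) :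
    AnalyticAt ℂ (fun x => ∑ I, a I * D.lagrange ξ I x) x := by
  unfold lagrange
  simp only [div_eq_mul_inv]
  fun_prop

lemma hasLead_div_F {ξ : D.Ambient} (hw : Function.Injective (D.w ξ.1)) (a : Fin D.n → ℂ)
    (α : Fin D.N) :
    ∃ b, HasLead (fun x => (∑ I, a I * D.lagrange ξ I x) / D.F ξ.1 x) (D.w ξ.1 α) (-D.m α) b := by
  obtain ⟨b, hb, h⟩ := hasLead_F hw α
  have h1 := (HasLead.of_analyticAt (analyticAt_lagrange_sum ξ a (D.w ξ.1 α))).mul (h.inv hb)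
  exact ⟨_, h1.congr_order (by simp)⟩

/-- As a polynomial of degree less than `n`, the numerator of `R / ħ + S` at any point `η` can be
interpolated at the nodes `q_J` of a fixed point `ξ`. Hence its derivative in `η` is again a
polynomial of degree less than `n`. -/
lemma numer_eq_interpolate {ξ : D.Ambient} (hq : Function.Injective (D.q ξ)) (ħ : ℂ)
    (η : D.Ambient) (x : ℂ) : D.numer ħ η x = ∑ J, D.numer ħ η (D.q ξ J) * D.lagrange ξ J x := by
  have hl (ζ : D.Ambient) (I : Fin D.n) (x : ℂ) :
      (Lagrange.basis Finset.univ (D.q ζ) I).eval x = D.lagrange ζ I x := by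
    simp only [Lagrange.basis, Lagrange.basisDivisor, lagrange, Polynomial.eval_prod]
    refine Finset.prod_congr rfl fun J _ => ?_
    simp [div_eq_mul_inv, mul_comm]
  set P : Polynomial ℂ := ∑ I, Polynomial.C (D.F η.1 (D.q η I) * D.nodeValue ħ η I) *
    Lagrange.basis Finset.univ (D.q η) I with hP
  have hPe (x : ℂ) : P.eval x = D.numer ħ η x := by
    simp [hP, Polynomial.eval_finsetSum, hl, numer]
  have hdeg : P.degree < (Finset.univ : Finset (Fin D.n)).card := by
    refine (Polynomial.degree_sum_le _ _).trans_lt ?_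
    rw [Finset.sup_lt_iff (by simp [bot_lt_iff_ne_bot])]
    intro I _
    refine lt_of_le_of_lt Polynomial.degree_le_natDegree ?_
    have h1 : (Lagrange.basis Finset.univ (D.q η) I).natDegree ≤ (Finset.univ.erase I).card := by
      refine (Polynomial.natDegree_prod_le _ _).trans ?_
      rw [Finset.card_eq_sum_ones]
      refine Finset.sum_le_sum fun J _ => ?_
      unfold Lagrange.basisDivisor
      exact (Polynomial.natDegree_C_mul_le _ _).trans (Polynomial.natDegree_X_sub_C_le _)
    have h2 : (Finset.univ.erase I).card < (Finset.univ : Finset (Fin D.n)).card :=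
      Finset.card_erase_lt_of_mem (Finset.mem_univ I)
    exact_mod_cast ((Polynomial.natDegree_C_mul_le _ _).trans h1).trans_lt h2
  have h3 := Lagrange.eq_interpolate
    (hq.injOn (s := ((Finset.univ : Finset (Fin D.n)) : Set _))) hdeg
  rw [← hPe, h3]
  simp [Lagrange.interpolate_apply, Polynomial.eval_finsetSum, hl, hPe]

lemma fderiv_F {b : D.Base} {x : ℂ} (h : ∀ α, x ≠ D.w b α) (db : D.Base) :
    fderiv ℂ (fun b => D.F b x) b db = -(D.F b x * ∑ α, D.m α * D.w db α / (x - D.w b α)) := by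
  refine fderiv_eq_of_hasDerivAt_line
    (analyticAt_F (f := fun b => b) analyticAt_id analyticAt_const).differentiableAt ?_
  have h1 (α) : HasDerivAt (fun s : ℂ => (x - D.w (b + s • db) α) ^ D.m α)
      (D.m α * (x - D.w b α) ^ (D.m α - 1) * -D.w db α) 0 := by
    have h4 : HasDerivAt (fun s : ℂ => x - (D.w b α + s * D.w db α)) (-D.w db α) 0 := by
      simpa using (((hasDerivAt_id (0 : ℂ)).mul_const (D.w db α)).const_add (D.w b α)).const_sub x
    exact (h4.fun_pow (D.m α)).congr_deriv (by simp)
  have h2 := HasDerivAt.fun_finsetProd (u := Finset.univ) fun α _ => h1 α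
  refine h2.congr_deriv ?_
  rw [Finset.mul_sum, ← Finset.sum_neg_distrib]
  refine Finset.sum_congr rfl fun α _ => ?_
  have h3 : x - D.w b α ≠ 0 := sub_ne_zero.2 (h α)
  have h4 : D.F b x = (∏ β ∈ Finset.univ.erase α, (x - D.w b β) ^ D.m β) *
      ((x - D.w b α) ^ (D.m α - 1) * (x - D.w b α)) := by
    rw [F, ← Finset.prod_erase_mul _ _ (Finset.mem_univ α), ← pow_succ,
      Nat.sub_add_cancel (D.one_le_m α)]
  rw [h4]
  simp only [zero_smul, add_zero, smul_eq_mul]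
  field_simp

/-- The derivative of `R / ħ + S` along a tangent vector is a polynomial of degree less than `n`
divided by `F`, up to the contribution of the moving poles. -/
lemma fderiv_G {ξ : D.Ambient} (hq : Function.Injective (D.q ξ)) (ħ : ℂ) (t : D.Ambient) :
    ∃ a : Fin D.n → ℂ, ∀ x, (∀ α, x ≠ D.w ξ.1 α) → fderiv ℂ (fun η => D.G ħ η x) ξ t =
      (∑ J, a J * D.lagrange ξ J x) / D.F ξ.1 x
        + D.G ħ ξ x * ∑ α, D.m α * D.w t.1 α / (x - D.w ξ.1 α) := by
  have hn (x : ℂ) : DifferentiableAt ℂ (fun η => D.numer ħ η x) ξ :=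
    (analyticAt_numer ħ (f := fun η => η) analyticAt_id analyticAt_const hq).differentiableAt
  refine ⟨fun J => fderiv ℂ (fun η => D.numer ħ η (D.q ξ J)) ξ t, fun x hx => ?_⟩
  have h1 : fderiv ℂ (fun η => D.numer ħ η x) ξ t =
      ∑ J, fderiv ℂ (fun η => D.numer ħ η (D.q ξ J)) ξ t * D.lagrange ξ J x := by
    have h2 : HasFDerivAt (fun η => D.numer ħ η x)
        (∑ J, D.lagrange ξ J x • fderiv ℂ (fun η => D.numer ħ η (D.q ξ J)) ξ) ξ := by
      have h3 := HasFDerivAt.fun_sum (u := Finset.univ) fun J _ =>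
        ((hn (D.q ξ J)).hasFDerivAt.mul_const (D.lagrange ξ J x))
      refine h3.congr_of_eventuallyEq (Eventually.of_forall fun η => ?_)
      exact numer_eq_interpolate hq ħ η x
    rw [h2.fderiv]
    simp [mul_comm]
  have hF : DifferentiableAt ℂ (fun b => D.F b x) ξ.1 :=
    (analyticAt_F (f := fun b => b) analyticAt_id analyticAt_const).differentiableAt
  have hF' : HasFDerivAt (fun η : D.Ambient => D.F η.1 x)
      ((fderiv ℂ (fun b => D.F b x) ξ.1).comp (ContinuousLinearMap.fst ℂ _ _)) ξ :=
    hF.hasFDerivAt.comp ξ (hasFDerivAt_fst)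
  have hF0 := F_ne_zero hx
  have h5 := ((hn x).hasFDerivAt.mul ((hasDerivAt_inv hF0).comp_hasFDerivAt ξ hF')).fderiv
  have h6 : (fun η => D.G ħ η x) = (fun η => D.numer ħ η x) * (Inv.inv ∘ fun η => D.F η.1 x) := by
    ext η; simp [G, div_eq_mul_inv]
  rw [h6, h5]
  simp only [add_apply, smul_apply, Function.comp_apply,
    ContinuousLinearMap.comp_apply, ContinuousLinearMap.coe_fst', smul_eq_mul, h1, fderiv_F hx, G]
  field_simp
  ring

/-- The principal part of `Q₀` at `w_α`. -/
lemma exists_Q0_eq_principal {b : D.Base} (hw : Function.Injective (D.w b)) (α : Fin D.N) :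
    ∃ g, AnalyticAt ℂ g (D.w b α) ∧
      ∀ x, D.Q0 b x = ∑ i, D.aFin b α i / (x - D.w b α) ^ ((i : ℕ) + 1) + g x := by
  refine ⟨fun x => x ^ (2 * D.mInf - 5) + ∑ i, D.aInf b i * x ^ (i : ℕ)
    + ∑ β ∈ Finset.univ.erase α, ∑ i, D.aFin b β i / (x - D.w b β) ^ ((i : ℕ) + 1),
    ?_, fun x => ?_⟩
  · have h : AnalyticAt ℂ (fun x => ∑ β ∈ Finset.univ.erase α,
        ∑ i, D.aFin b β i / (x - D.w b β) ^ ((i : ℕ) + 1)) (D.w b α) := by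
      refine Finset.analyticAt_fun_sum _ fun β hβ => ?_
      have : D.w b α - D.w b β ≠ 0 := sub_ne_zero.2 fun h => Finset.ne_of_mem_erase hβ (hw h).symm
      fun_prop (disch := simp [this])
    fun_prop
  · rw [Q0, ← Finset.add_sum_erase _ _ (Finset.mem_univ α)]
    ring

/-- The principal part at `w_α` of a derivative of `Q₀`; its second sum is due to the motion of
`w_α`. -/
lemma exists_dQ0_eq_principal {b : D.Base} (hw : Function.Injective (D.w b)) (db : D.Base)
    (α : Fin D.N) :
    ∃ g, AnalyticAt ℂ g (D.w b α) ∧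
      ∀ x, D.dQ0 b db x = ∑ i, D.aFin db α i / (x - D.w b α) ^ ((i : ℕ) + 1)
        + ∑ i : Fin (2 * D.m α - 1),
          ((i : ℕ) + 1) * D.aFin b α i * D.w db α / (x - D.w b α) ^ ((i : ℕ) + 2) + g x := by
  refine ⟨fun x => ∑ i, D.aInf db i * x ^ (i : ℕ)
    + ∑ β ∈ Finset.univ.erase α, (∑ i, D.aFin db β i / (x - D.w b β) ^ ((i : ℕ) + 1)
      + ∑ i : Fin (2 * D.m β - 1),
        ((i : ℕ) + 1) * D.aFin b β i * D.w db β / (x - D.w b β) ^ ((i : ℕ) + 2)), ?_, fun x => ?_⟩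
  · have h : AnalyticAt ℂ (fun x => ∑ β ∈ Finset.univ.erase α,
        (∑ i, D.aFin db β i / (x - D.w b β) ^ ((i : ℕ) + 1)
      + ∑ i : Fin (2 * D.m β - 1),
        ((i : ℕ) + 1) * D.aFin b β i * D.w db β / (x - D.w b β) ^ ((i : ℕ) + 2))) (D.w b α) := by
      refine Finset.analyticAt_fun_sum _ fun β hβ => ?_
      have : D.w b α - D.w b β ≠ 0 := sub_ne_zero.2 fun h => Finset.ne_of_mem_erase hβ (hw h).symm
      fun_prop (disch := simp [this])
    fun_prop
  · rw [dQ0, add_assoc, ← Finset.sum_add_distrib, ← Finset.add_sum_erase _ _ (Finset.mem_univ α)]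
    ring

lemma exists_hasLeadInf_div_pow (c : ℂ) (i : ℕ) (a : ℂ) :
    ∃ b, HasLeadInf (fun x => a / (x - c) ^ (i + 1)) 1 b :=
  (hasLeadInf_div_pow c (i + 1) a).exists_of_le (by push_cast; lia)

/-- The polynomial part of `Q₀`. -/
lemma exists_Q0_eq_principal_inf (b : D.Base) :
    ∃ g, (∃ a, HasLeadInf g 1 a) ∧
      ∀ x, D.Q0 b x = x ^ (2 * D.mInf - 5) + ∑ i, D.aInf b i * x ^ (i : ℕ) + g x :=
  ⟨fun x => ∑ α, ∑ i, D.aFin b α i / (x - D.w b α) ^ ((i : ℕ) + 1),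
    HasLeadInf.exists_sum _ fun _ _ => HasLeadInf.exists_sum _ fun _ _ =>
      exists_hasLeadInf_div_pow _ _ _, fun _ => rfl⟩

/-- The polynomial part of a derivative of `Q₀`. -/
lemma exists_dQ0_eq_principal_inf (b db : D.Base) :
    ∃ g, (∃ a, HasLeadInf g 1 a) ∧
      ∀ x, D.dQ0 b db x = ∑ i, D.aInf db i * x ^ (i : ℕ) + g x := by
  obtain ⟨a, ha⟩ : ∃ a, HasLeadInf
      (fun x => ∑ α, ∑ i, D.aFin db α i / (x - D.w b α) ^ ((i : ℕ) + 1)) 1 a :=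
    HasLeadInf.exists_sum _ fun _ _ => HasLeadInf.exists_sum _ fun _ _ =>
      exists_hasLeadInf_div_pow _ _ _
  obtain ⟨a', ha'⟩ : ∃ a, HasLeadInf (fun x => ∑ α, ∑ i : Fin (2 * D.m α - 1),
      ((i : ℕ) + 1) * D.aFin b α i * D.w db α / (x - D.w b α) ^ ((i : ℕ) + 2)) 1 a :=
    HasLeadInf.exists_sum _ fun _ _ => HasLeadInf.exists_sum _ fun _ _ =>
      exists_hasLeadInf_div_pow _ _ _
  exact ⟨_, ⟨_, ha.add ha'⟩, fun x => by rw [dQ0]; ring⟩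

lemma hasLead_Q0 {b : D.Base} (hw : Function.Injective (D.w b)) (α : Fin D.N) :
    HasLead (D.Q0 b) (D.w b α) (-(2 * D.m α - 1)) (D.aFin b α (D.top α)) := by
  have hm := D.one_le_m α
  obtain ⟨g, hg, hQ⟩ := exists_Q0_eq_principal hw α
  have h1 : HasLead (fun x => ∑ i, D.aFin b α i / (x - D.w b α) ^ ((i : ℕ) + 1)) (D.w b α)
      (-(2 * D.m α - 1)) (∑ i, if i = D.top α then D.aFin b α i else 0) := by
    refine HasLead.sum _ fun i _ => ?_
    have h := hasLead_sub_pow (D.w b α) ((i : ℕ) + 1) (D.aFin b α i)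
    have hi := i.isLt
    split_ifs with h0
    · subst h0
      refine h.congr_order ?_
      simp only [top]
      push_cast [Nat.cast_sub (by omega : 2 ≤ 2 * D.m α)]
      ring
    · refine h.weaken ?_
      have : (i : ℕ) ≠ 2 * D.m α - 2 := fun h => h0 (Fin.ext h)
      push_cast
      omega
  have h2 := h1.add ((HasLead.of_analyticAt hg).weaken (by lia : -(2 * (D.m α : ℤ) - 1) < 0))
  simp only [Finset.sum_ite_eq', Finset.mem_univ, if_true, add_zero] at h2
  exact h2.congr (Eventually.of_forall hQ)

lemma hasLeadInf_pow (i : ℕ) (a : ℂ) : HasLeadInf (fun x => a * x ^ i) (-i) a := by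
  have := (HasLeadInf.id.pow i).const_mul a
  simpa [HasLeadInf] using this

lemma exists_hasLeadInf_sum {M : ℕ} (a : Fin M → ℂ) :
    ∃ b, HasLeadInf (fun x => ∑ i, a i * x ^ (i : ℕ)) (1 - M) b := by
  have h (i : Fin M) : ∃ b, HasLeadInf (fun x => a i * x ^ (i : ℕ)) (1 - M) b :=
    (hasLeadInf_pow i (a i)).exists_of_le (by have := i.isLt; lia)
  choose b hb using h
  exact ⟨_, HasLeadInf.sum _ fun i _ => hb i⟩

lemma hasLeadInf_Q0 (b : D.Base) : HasLeadInf (D.Q0 b) (-(2 * D.mInf - 5)) 1 := by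
  have hm := D.three_le_mInf
  obtain ⟨g, ⟨a, hg⟩, hQ⟩ := exists_Q0_eq_principal_inf b
  obtain ⟨a', h1⟩ := exists_hasLeadInf_sum (D.aInf b)
  have h2 := ((hasLeadInf_pow (2 * D.mInf - 5) 1).congr_order (l := -(2 * D.mInf - 5)) (by lia)).add
    (h1.weaken (l := -(2 * D.mInf - 5)) (by lia)) |>.add (hg.weaken (by lia))
  simp only [add_zero, one_mul] at h2
  exact h2.congr (Eventually.of_forall hQ)

lemma hasLead_dQ0 {b : D.Base} (hw : Function.Injective (D.w b)) (db : D.Base) (α : Fin D.N) :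
    HasLead (D.dQ0 b db) (D.w b α) (-(2 * D.m α))
      ((2 * D.m α - 1) * D.aFin b α (D.top α) * D.w db α) := by
  have hm := D.one_le_m α
  obtain ⟨g, hg, hQ⟩ := exists_dQ0_eq_principal hw db α
  have h1 : HasLead (fun x => ∑ i : Fin (2 * D.m α - 1),
      ((i : ℕ) + 1) * D.aFin b α i * D.w db α / (x - D.w b α) ^ ((i : ℕ) + 2)) (D.w b α)
      (-(2 * D.m α)) (∑ i, if i = D.top α then
        (2 * D.m α - 1) * D.aFin b α (D.top α) * D.w db α else 0) := by
    refine HasLead.sum _ fun i _ => ?_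
    have h := hasLead_sub_pow (D.w b α) ((i : ℕ) + 2) (((i : ℕ) + 1) * D.aFin b α i * D.w db α)
    have hi := i.isLt
    split_ifs with h0
    · subst h0
      refine (h.congr_order ?_).congr_coeff ?_
      · simp only [top]; push_cast [Nat.cast_sub (by omega : 2 ≤ 2 * D.m α)]; ring
      · have : (((D.top α : Fin _) : ℕ) : ℂ) + 1 = 2 * D.m α - 1 := by
          simp only [top]; push_cast [Nat.cast_sub (by omega : 2 ≤ 2 * D.m α)]; ring
        rw [this]
    · refine h.weaken ?_
      have : (i : ℕ) ≠ 2 * D.m α - 2 := fun h => h0 (Fin.ext h)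
      push_cast
      omega
  have h3 : HasLead (fun x => ∑ i, D.aFin db α i / (x - D.w b α) ^ ((i : ℕ) + 1)) (D.w b α)
      (-(2 * D.m α)) (∑ i : Fin (2 * D.m α - 1), 0) := by
    refine HasLead.sum _ fun i _ => (hasLead_sub_pow _ _ _).weaken ?_
    have hi := i.isLt
    push_cast
    omega
  have h2 := (h3.add h1).add ((HasLead.of_analyticAt hg).weaken (by lia : -(2 * (D.m α : ℤ)) < 0))
  simp only [Finset.sum_ite_eq', Finset.mem_univ, if_true, add_zero, Finset.sum_const_zero,
    zero_add] at h2
  exact h2.congr (Eventually.of_forall hQ)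

lemma hasLeadInf_dQ0 (b db : D.Base) : ∃ a, HasLeadInf (D.dQ0 b db) (-(2 * D.mInf - 7)) a := by
  have hm := D.three_le_mInf
  obtain ⟨g, ⟨a, hg⟩, hQ⟩ := exists_dQ0_eq_principal_inf b db
  obtain ⟨a', h1⟩ := exists_hasLeadInf_sum (D.aInf db)
  obtain ⟨a'', hg⟩ := hg.exists_of_le (l := -(2 * D.mInf - 7)) (by lia)
  exact ⟨_, ((h1.congr_order (l := -(2 * D.mInf - 7)) (by lia)).add hg).congr
    (Eventually.of_forall hQ)⟩

lemma hasLead_G {ξ : D.Ambient} (hξ : ξ ∈ D.X) (ħ : ℂ) (α : Fin D.N) :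
    ∃ b, HasLead (D.G ħ ξ) (D.w ξ.1 α) (-D.m α) b :=
  hasLead_div_F hξ.1.1 (fun I => D.F ξ.1 (D.q ξ I) * D.nodeValue ħ ξ I) α

lemma hasLeadInf_G (ξ : D.Ambient) (ħ : ℂ) : ∃ b, HasLeadInf (D.G ħ ξ) (4 - D.mInf) b :=
  hasLeadInf_div_F ξ (fun I => D.F ξ.1 (D.q ξ I) * D.nodeValue ħ ξ I)

/-- The derivative of `R(x) / ħ + S(x)` along a tangent vector, with `x` and `ħ` fixed. -/
def dG (ħ : ℂ) (ξ t : D.Ambient) (x : ℂ) : ℂ := fderiv ℂ (fun η => D.G ħ η x) ξ t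

/-- The derivative of the regular part of `Q(x)` at `q_J` along a tangent vector. -/
def dH (ħ : ℂ) (ξ t : D.Ambient) (J : Fin D.n) (x : ℂ) : ℂ := fderiv ℂ (fun η => D.H ħ η J x) ξ t

/-- The coefficient of the highest possible pole of `∂_t (R / ħ + S)` at `w_α` is due to the motion
of `w_α`. -/
lemma hasLead_dG {ξ : D.Ambient} (hξ : ξ ∈ D.X) (ħ : ℂ) (t : D.Ambient) (α : Fin D.N) {g : ℂ}
    (hg : HasLead (D.G ħ ξ) (D.w ξ.1 α) (-D.m α) g) :
    HasLead (D.dG ħ ξ t) (D.w ξ.1 α) (-(D.m α + 1)) (D.m α * D.w t.1 α * g) := by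
  obtain ⟨a, ha⟩ := fderiv_G hξ.2.1 ħ t
  obtain ⟨b, hb⟩ := hasLead_div_F hξ.1.1 a α
  have h1 : AnalyticAt ℂ (fun x => ∑ β ∈ Finset.univ.erase α, D.m β * D.w t.1 β / (x - D.w ξ.1 β))
      (D.w ξ.1 α) := by
    refine Finset.analyticAt_fun_sum _ fun β hβ => ?_
    have : D.w ξ.1 α - D.w ξ.1 β ≠ 0 :=
      sub_ne_zero.2 fun h => Finset.ne_of_mem_erase hβ (hξ.1.1 h).symm
    fun_prop (disch := simp [this])
  have h2 : HasLead (fun x => ∑ β, D.m β * D.w t.1 β / (x - D.w ξ.1 β)) (D.w ξ.1 α) (-1)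
      (D.m α * D.w t.1 α) := by
    have h3 := hasLead_sub_pow (D.w ξ.1 α) 1 (D.m α * D.w t.1 α)
    simp only [pow_one, Nat.cast_one] at h3
    have h4 := h3.add ((HasLead.of_analyticAt h1).weaken (by norm_num : (-1 : ℤ) < 0))
    rw [add_zero] at h4
    refine h4.congr (Eventually.of_forall fun x => ?_)
    rw [← Finset.add_sum_erase _ _ (Finset.mem_univ α)]
  have h5 := (hb.weaken (by lia : -((D.m α : ℤ) + 1) < -D.m α)).add
    ((hg.mul h2).congr_order (by ring))
  refine (h5.congr_coeff (by ring)).congr ?_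
  filter_upwards [eventually_isRegularPoint ξ (D.w ξ.1 α)] with x hx
  exact ha x hx.1

lemma hasLeadInf_dG {ξ : D.Ambient} (hξ : ξ ∈ D.X) (ħ : ℂ) (t : D.Ambient) :
    ∃ b, HasLeadInf (D.dG ħ ξ t) (4 - D.mInf) b := by
  obtain ⟨a, ha⟩ := fderiv_G hξ.2.1 ħ t
  obtain ⟨b, hb⟩ := hasLeadInf_div_F ξ a
  obtain ⟨g, hg⟩ := hasLeadInf_G ξ ħ
  have h2 : HasLeadInf (fun x => ∑ β, D.m β * D.w t.1 β / (x - D.w ξ.1 β)) 1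
      (∑ β, D.m β * D.w t.1 β) := by
    refine HasLeadInf.sum _ fun β _ => ?_
    simpa using hasLeadInf_div_pow (D.w ξ.1 β) 1 (D.m β * D.w t.1 β)
  refine ⟨_, (hb.add ((hg.mul h2).weaken (by lia))).congr ?_⟩
  filter_upwards [eventually_cocompact_isRegularPoint ξ] with x hx
  exact ha x hx.1

lemma dQ_eq {ħ : ℂ} {ξ : D.Ambient} (hξ : ξ ∈ D.X) (t : D.Ambient) {x : ℂ}
    (hx : D.IsRegularPoint ξ x) :
    D.dQ ħ ξ t x = D.dQ0 ξ.1 t.1 x / ħ ^ 2 + D.dG ħ ξ t x + ∑ J, D.dpolar ħ ξ t J x := by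
  have h1 := (analyticAt_Q0 (f := fun b => b) (analyticAt_id (z := ξ.1)) analyticAt_const
    hx.1).differentiableAt.hasFDerivAt
  have h1' : HasFDerivAt (fun η : D.Ambient => D.Q0 η.1 x)
      ((fderiv ℂ (fun b => D.Q0 b x) ξ.1).comp (ContinuousLinearMap.fst ℂ _ _)) ξ :=
    h1.comp ξ (hasFDerivAt_fst)
  have h2 := (analyticAt_G ħ (f := fun b => b) (analyticAt_id (z := ξ)) analyticAt_const
    hξ.2.1 hx.1).differentiableAt.hasFDerivAt
  have h3 (J) := (analyticAt_polar ħ (f := fun b => b) (analyticAt_id (z := ξ)) analyticAt_const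
    J (hx.2 J)).differentiableAt.hasFDerivAt
  have h4 := ((h1'.mul_const (ħ ^ 2)⁻¹).fun_add h2).fun_add
    (HasFDerivAt.fun_sum (u := Finset.univ) fun J _ => h3 J)
  have h5 : HasFDerivAt (fun η => D.Q ħ η x) _ ξ :=
    h4.congr_of_eventuallyEq (Eventually.of_forall fun η => by simp only [Q_eq, div_eq_mul_inv])
  rw [dQ, h5.fderiv]
  have h6 := fderiv_Q0 hx.1 t.1
  have h7 (J) := fderiv_polar (ħ := ħ) J (hx.2 J) t
  simp [h6, h7, dG, div_eq_inv_mul]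

lemma dQ_eq_dpolar_add_dH {ħ : ℂ} {ξ : D.Ambient} (hξ : ξ ∈ D.X) (t : D.Ambient) (J : Fin D.n)
    {x : ℂ} (hx : D.IsRegularPoint ξ x) :
    D.dQ ħ ξ t x = D.dpolar ħ ξ t J x + D.dH ħ ξ t J x := by
  have h2 := (analyticAt_H ħ (f := fun b => b) (analyticAt_id (z := ξ)) analyticAt_const
    hξ.2.1 hx.1 J (fun K _ => hx.2 K)).differentiableAt.hasFDerivAt
  have h3 := (analyticAt_polar ħ (f := fun b => b) (analyticAt_id (z := ξ)) analyticAt_const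
    J (hx.2 J)).differentiableAt.hasFDerivAt
  have h5 : HasFDerivAt (fun η => D.Q ħ η x) _ ξ := (h3.fun_add h2).congr_of_eventuallyEq
    (Eventually.of_forall fun η => D.Q_eq_polar_add_H ħ η J x)
  rw [dQ, h5.fderiv]
  simp [dH, fderiv_polar J (hx.2 J) t]

/-! ### Apparent singularities -/

lemma lagrange_node (ξ : D.Ambient) {I J : Fin D.n} (h : I ≠ J) : D.lagrange ξ I (D.q ξ J) = 0 :=
  Finset.prod_eq_zero (Finset.mem_erase.2 ⟨h.symm, Finset.mem_univ J⟩) (by simp)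

lemma lagrange_node_self {ξ : D.Ambient} {J : Fin D.n} (h : ∀ K, K ≠ J → D.q ξ J ≠ D.q ξ K) :
    D.lagrange ξ J (D.q ξ J) = 1 :=
  Finset.prod_eq_one fun K hK => div_self (sub_ne_zero.2 (h K (Finset.ne_of_mem_erase hK)))

/-- The constant term of `Q(x)` at `q_J` is the square of the residue. This is the condition that
`q_J` is an apparent singularity of `Y'' = Q Y`. -/
lemma H_node {ħ : ℂ} {ξ : D.Ambient} {J : Fin D.n} (h : ∀ K, K ≠ J → D.q ξ J ≠ D.q ξ K)
    (hw : ∀ α, D.q ξ J ≠ D.w ξ.1 α) :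
    D.H ħ ξ J (D.q ξ J) =
      D.residue ħ ξ J ^ 2 - (D.p ξ J ^ 2 - D.Q0 ξ.1 (D.q ξ J)) * (ħ ^ 2)⁻¹ := by
  have h1 : D.numer ħ ξ (D.q ξ J) = D.F ξ.1 (D.q ξ J) * D.nodeValue ħ ξ J := by
    rw [numer, Finset.sum_eq_single J]
    · rw [lagrange_node_self h, mul_one]
    · intro I _ hI
      rw [lagrange_node ξ hI, mul_zero]
    · simp
  have h2 : D.G ħ ξ (D.q ξ J) = D.nodeValue ħ ξ J := by
    rw [G, h1, mul_div_cancel_left₀ _ (F_ne_zero hw)]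
  rw [H, h2, nodeValue]
  simp only [polar, residue, Finset.sum_add_distrib, add_div, sub_div, Finset.sum_div]
  have h3 (K : Fin D.n) : D.p ξ K / (D.q ξ J - D.q ξ K) / ħ = D.p ξ K / ħ / (D.q ξ J - D.q ξ K) :=
    div_right_comm ..
  simp only [h3]
  ring

lemma mem_tangentSpace {ξ t : D.Ambient} (hξ : ξ ∈ D.X) : t ∈ D.tangentSpace ξ ↔
    ∀ I, 2 * D.p ξ I * D.p t I
      = fderiv ℂ (fun z : D.Base × ℂ => D.Q0 z.1 z.2) (ξ.1, D.q ξ I) (t.1, D.q t I) := by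
  simp only [tangentSpace, Submodule.mem_iInf, LinearMap.mem_ker]
  refine forall_congr' fun I => ?_
  have h1 : HasFDerivAt (fun η : D.Ambient => D.p η I)
      ((ContinuousLinearMap.proj I).comp ((ContinuousLinearMap.fst ℂ _ _).comp
        ((ContinuousLinearMap.snd ℂ _ _).comp (ContinuousLinearMap.snd ℂ _ _)))) ξ :=
    hasFDerivAt_of_eq_clm _ (fun η => by rfl) ξ
  have h2 : HasFDerivAt (fun η : D.Ambient => ((η.1, D.q η I) : D.Base × ℂ))
      ((ContinuousLinearMap.fst ℂ _ _).prod ((ContinuousLinearMap.proj I).comp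
        ((ContinuousLinearMap.fst ℂ _ _).comp (ContinuousLinearMap.snd ℂ _ _)))) ξ :=
    hasFDerivAt_of_eq_clm _ (fun η => by rfl) ξ
  have h3 : AnalyticAt ℂ (fun z : D.Base × ℂ => D.Q0 z.1 z.2) (ξ.1, D.q ξ I) :=
    analyticAt_Q0 analyticAt_fst analyticAt_snd (hξ.2.2.1 I)
  have h4 := (HasFDerivAt.pow h1 2).fun_sub (h3.differentiableAt.hasFDerivAt.comp ξ h2)
  simp only [Function.comp_def] at h4
  rw [h4.fderiv]
  simp [sub_eq_zero, p, mul_assoc]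
  rfl

/-- The infinitesimal form of the condition that `q_J` is an apparent singularity. -/
lemma dH_node {ħ : ℂ} {ξ t : D.Ambient} (hξ : ξ ∈ D.X) (ht : t ∈ D.tangentSpace ξ) (J : Fin D.n) :
    D.dH ħ ξ t J (D.q ξ J)
      = 2 * D.residue ħ ξ J * D.residue ħ t J - deriv (D.H ħ ξ J) (D.q ξ J) * D.q t J := by
  have hw := hξ.2.2.1 J
  have hq : ∀ K, K ≠ J → D.q ξ J ≠ D.q ξ K := fun K hK h => hK (hξ.2.1 h).symm
  have h1 : AnalyticAt ℂ (fun z : D.Ambient × ℂ => D.H ħ z.1 J z.2) (ξ, D.q ξ J) :=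
    analyticAt_H ħ analyticAt_fst analyticAt_snd hξ.2.1 hw J hq
  have h2 : HasFDerivAt (fun η : D.Ambient => ((η, D.q η J) : D.Ambient × ℂ))
      ((ContinuousLinearMap.id ℂ _).prod ((ContinuousLinearMap.proj J).comp
        ((ContinuousLinearMap.fst ℂ _ _).comp (ContinuousLinearMap.snd ℂ _ _)))) ξ :=
    hasFDerivAt_of_eq_clm _ (fun η => by rfl) ξ
  have h3 := (h1.differentiableAt.hasFDerivAt.comp ξ h2).fderiv
  have h4 : fderiv ℂ (fun η : D.Ambient => D.H ħ η J (D.q η J)) ξ t =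
      D.dH ħ ξ t J (D.q ξ J) + deriv (D.H ħ ξ J) (D.q ξ J) * D.q t J := by
    rw [dH, ← h1.fderiv_prod_apply]
    simp only [Function.comp_def] at h3
    rw [h3]
    rfl
  have hev : ∀ᶠ η in 𝓝 ξ, D.H ħ η J (D.q η J) =
      D.residue ħ η J ^ 2 - (D.p η J ^ 2 - D.Q0 η.1 (D.q η J)) * (ħ ^ 2)⁻¹ := by
    have hc (K) : ContinuousAt (fun η : D.Ambient => D.q η K) ξ :=
      (analyticAt_q (f := fun η => η) analyticAt_id K).continuousAt
    have hc' (α) : ContinuousAt (fun η : D.Ambient => D.w η.1 α) ξ :=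
      (analyticAt_w (f := fun η : D.Ambient => η.1) analyticAt_fst α).continuousAt
    have e1 : ∀ᶠ η in 𝓝 ξ, ∀ K, K ≠ J → D.q η J ≠ D.q η K :=
      eventually_all.2 fun K => by
        by_cases hK : K = J
        · simp [hK]
        · filter_upwards [((hc J).sub (hc K)).eventually_ne (sub_ne_zero.2 (hq K hK))] with η h _
          exact sub_ne_zero.1 h
    have e2 : ∀ᶠ η in 𝓝 ξ, ∀ α, D.q η J ≠ D.w η.1 α :=
      eventually_all.2 fun α =>
        (((hc J).sub (hc' α)).eventually_ne (sub_ne_zero.2 (hw α))).mono fun η h => sub_ne_zero.1 h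
    filter_upwards [e1, e2] with η h1 h2 using H_node h1 h2
  have h5 : AnalyticAt ℂ (fun η : D.Ambient => D.p η J ^ 2 - D.Q0 η.1 (D.q η J)) ξ := by
    have := analyticAt_Q0 (f := fun η : D.Ambient => η.1) (x := fun η => D.q η J) (e := ξ)
      (by fun_prop) (by fun_prop) hw
    fun_prop
  have h6 : HasFDerivAt (fun η : D.Ambient => D.residue ħ η J)
      (ħ⁻¹ • ((ContinuousLinearMap.proj J).comp ((ContinuousLinearMap.fst ℂ _ _).comp
        ((ContinuousLinearMap.snd ℂ _ _).comp (ContinuousLinearMap.snd ℂ _ _)))) +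
        ((ContinuousLinearMap.proj J).comp ((ContinuousLinearMap.snd ℂ _ _).comp
        ((ContinuousLinearMap.snd ℂ _ _).comp (ContinuousLinearMap.snd ℂ _ _))))) ξ := by
    refine (ContinuousLinearMap.hasFDerivAt _).congr_of_eventuallyEq
      (Eventually.of_forall fun η => ?_)
    simp [residue, p, v, div_eq_inv_mul]
  have h7 := ((HasFDerivAt.pow h6 2).fun_sub
    (h5.differentiableAt.hasFDerivAt.mul_const (ħ ^ 2)⁻¹)).congr_of_eventuallyEq hev
  have h8 : fderiv ℂ (fun η : D.Ambient => D.p η J ^ 2 - D.Q0 η.1 (D.q η J)) ξ t = 0 := by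
    simp only [tangentSpace, Submodule.mem_iInf, LinearMap.mem_ker] at ht
    exact ht J
  rw [h7.fderiv] at h4
  have h9 : D.residue ħ t J = ħ⁻¹ * D.p t J + D.v t J := by rw [residue, div_eq_inv_mul]
  rw [eq_sub_iff_add_eq, ← h4, h9]
  simp only [p] at h8
  simp [p, v]
  rw [h8]
  ring

lemma hasLead_Q_node {ħ : ℂ} {ξ : D.Ambient} (hξ : ξ ∈ D.X) (J : Fin D.n) :
    HasLead (D.Q ħ ξ) (D.q ξ J) (-2) (3 / 4) := by
  have h1 : AnalyticAt ℂ (fun x => D.H ħ ξ J x) (D.q ξ J) :=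
    analyticAt_H ħ analyticAt_const analyticAt_id hξ.2.1 (hξ.2.2.1 J) J
      (fun K hK h => hK (hξ.2.1 h).symm)
  have h2 := ((hasLead_sub_pow (D.q ξ J) 2 (3 / 4)).add
    ((hasLead_sub_pow (D.q ξ J) 1 (D.residue ħ ξ J)).weaken (l := -2) (by norm_num))).add
    ((HasLead.of_analyticAt h1).weaken (l := -2) (by norm_num))
  refine (h2.congr_coeff (by ring)).congr (Eventually.of_forall fun x => ?_)
  simp only [Q_eq_polar_add_H _ _ _ J, polar, pow_one]
  rw [div_mul_eq_div_div]

lemma hasLeadInf_polar (ħ : ℂ) (ξ : D.Ambient) (J : Fin D.n) :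
    HasLeadInf (D.polar ħ ξ J) 1 (D.residue ħ ξ J) := by
  have h2 := ((hasLeadInf_div_pow (D.q ξ J) 2 (3 / 4)).weaken (l := 1) (by norm_num)).add
    (hasLeadInf_div_pow (D.q ξ J) 1 (D.residue ħ ξ J))
  refine (h2.congr_coeff (by ring)).congr (Eventually.of_forall fun x => ?_)
  simp only [polar, pow_one]
  rw [div_mul_eq_div_div]

lemma hasLeadInf_dpolar (ħ : ℂ) (ξ t : D.Ambient) (J : Fin D.n) :
    HasLeadInf (D.dpolar ħ ξ t J) 1 (D.residue ħ t J) := by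
  have h2 := (((hasLeadInf_div_pow (D.q ξ J) 3 (3 / 2 * D.q t J)).weaken (l := 1) (by norm_num)).add
    ((hasLeadInf_div_pow (D.q ξ J) 2 (D.residue ħ ξ J * D.q t J)).weaken (l := 1)
      (by norm_num))).add
    (hasLeadInf_div_pow (D.q ξ J) 1 (D.residue ħ t J))
  refine (h2.congr_coeff (by ring)).congr (Eventually.of_forall fun x => ?_)
  simp only [dpolar, pow_one]

lemma hasLeadInf_Q {ħ : ℂ} (ξ : D.Ambient) :
    HasLeadInf (D.Q ħ ξ) (-(2 * D.mInf - 5)) (ħ ^ 2)⁻¹ := by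
  have hm := D.three_le_mInf
  obtain ⟨g, hg⟩ := hasLeadInf_G ξ ħ
  have h := (((hasLeadInf_Q0 ξ.1).const_mul (ħ ^ 2)⁻¹).add (hg.weaken (by lia))).add
    ((HasLeadInf.sum Finset.univ fun J _ => hasLeadInf_polar ħ ξ J).weaken (by lia))
  refine (h.congr_coeff (by ring)).congr (Eventually.of_forall fun x => ?_)
  rw [Q_eq, div_eq_inv_mul]

lemma hasLeadInf_dQ {ħ : ℂ} {ξ : D.Ambient} (hξ : ξ ∈ D.X) (t : D.Ambient) :
    ∃ a, HasLeadInf (D.dQ ħ ξ t) (-(2 * D.mInf - 7)) a := by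
  have hm := D.three_le_mInf
  obtain ⟨g, hg⟩ := hasLeadInf_dG hξ ħ t
  obtain ⟨a, ha⟩ := hasLeadInf_dQ0 ξ.1 t.1
  obtain ⟨g', hg⟩ := hg.exists_of_le (l := -(2 * D.mInf - 7)) (by lia)
  obtain ⟨g'', h3⟩ := (HasLeadInf.sum Finset.univ fun J _ =>
    hasLeadInf_dpolar ħ ξ t J).exists_of_le (l := -(2 * D.mInf - 7)) (by lia)
  refine ⟨_, (((ha.const_mul (ħ ^ 2)⁻¹).add hg).add h3).congr ?_⟩
  filter_upwards [eventually_cocompact_isRegularPoint ξ] with x hx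
  rw [dQ_eq hξ t hx, div_eq_inv_mul]

lemma analyticAt_polar_w {ħ : ℂ} {ξ : D.Ambient} (hξ : ξ ∈ D.X) (α : Fin D.N) :
    AnalyticAt ℂ (fun x => ∑ J, D.polar ħ ξ J x) (D.w ξ.1 α) :=
  Finset.analyticAt_fun_sum _ fun J _ =>
    analyticAt_polar ħ analyticAt_const analyticAt_id J (hξ.2.2.1 J α).symm

lemma analyticAt_dpolar_w {ħ : ℂ} {ξ : D.Ambient} (hξ : ξ ∈ D.X) (t : D.Ambient) (α : Fin D.N) :
    AnalyticAt ℂ (fun x => ∑ J, D.dpolar ħ ξ t J x) (D.w ξ.1 α) := by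
  refine Finset.analyticAt_fun_sum _ fun J _ => ?_
  have : D.w ξ.1 α - D.q ξ J ≠ 0 := sub_ne_zero.2 (hξ.2.2.1 J α).symm
  unfold dpolar
  fun_prop (disch := simp [this])

end
end PoleData

/-! ### The isomonodromy equation at an apparent singularity -/

/-- The expression `2 Q A' + Q' A - A''' / 2`, for which `-2 ∂_t Q = A''' - 4 Q A' - 2 Q' A` reads
`∂_t Q = fuchs Q A`. -/
noncomputable def fuchs (Q A : ℂ → ℂ) (x : ℂ) : ℂ :=
  2 * (Q x * deriv A x) + deriv Q x * A x + (-1 / 2) * deriv (deriv (deriv A)) x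

/-- The derivative of a Taylor expansion with analytic remainder, in the same form. -/
lemma deriv_add_mul_pow {a b c₂ z : ℂ} {f K : ℂ → ℂ} (hK : AnalyticAt ℂ K z) (n : ℕ)
    (hf : ∀ᶠ x in 𝓝 z, f x = a + b * (x - z) + c₂ * (x - z) ^ 2 + (x - z) ^ (n + 1) * K x) :
    ∀ᶠ x in 𝓝 z, deriv f x = b + 2 * c₂ * (x - z)
      + (x - z) ^ n * ((n + 1) * K x + (x - z) * deriv K x) := by
  filter_upwards [hK.eventually_analyticAt, eventually_eventually_nhds.2 hf] with x hx hfx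
  have h1 : HasDerivAt (fun x => x - z) 1 x := (hasDerivAt_id x).sub_const z
  have h2 := (((h1.const_mul b).const_add a).fun_add ((h1.fun_pow 2).const_mul c₂)).fun_add
    ((h1.fun_pow (n + 1)).fun_mul hx.differentiableAt.hasDerivAt)
  rw [(h2.congr_of_eventuallyEq hfx).deriv]
  push_cast
  ring

/-- Derivative of a potential with an apparent singularity at `c`. -/
lemma deriv_polar_add {Q h : ℂ → ℂ} {c u : ℂ} (hh : AnalyticAt ℂ h c)
    (hQ : ∀ᶠ x in 𝓝[≠] c, Q x = 3 / (4 * (x - c) ^ 2) + u / (x - c) + h x) :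
    ∀ᶠ x in 𝓝[≠] c, deriv Q x = -3 / (2 * (x - c) ^ 3) - u / (x - c) ^ 2 + deriv h x := by
  have h1 : ∀ᶠ x in 𝓝[≠] c, AnalyticAt ℂ h x :=
    hh.eventually_analyticAt.filter_mono nhdsWithin_le_nhds
  filter_upwards [h1, HasLead.eventually_ne c, eventually_eventually_nhdsWithin.2 hQ,
    self_mem_nhdsWithin] with x hx h3 h4 h5
  rw [isOpen_compl_singleton.nhdsWithin_eq h5] at h4
  have h6 : HasDerivAt (fun x => x - c) 1 x := (hasDerivAt_id x).sub_const c
  have h7 := (((hasDerivAt_const x (3 : ℂ)).fun_div ((h6.fun_pow 2).const_mul 4)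
    (by simp [h3])).fun_add ((hasDerivAt_const x u).fun_div h6 h3)).fun_add
    hx.differentiableAt.hasDerivAt
  rw [(h7.congr_of_eventuallyEq h4).deriv]
  field_simp
  push_cast
  ring

/-- At an apparent singularity `c` where `A` is holomorphic, the flow equations `∂_t c = -A` and
`∂_t u = 3 A'' / 4 + u A'` for the singularity and its residue `u` make the Laurent expansions of
both sides of the isomonodromy equation agree up to the constant term. -/
lemma hasLead_sub_fuchs_of_analyticAt {Q A h dh : ℂ → ℂ} {c u dq du : ℂ} (hA : AnalyticAt ℂ A c)
    (hh : AnalyticAt ℂ h c) (hdh : AnalyticAt ℂ dh c)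
    (hQ : ∀ᶠ x in 𝓝[≠] c, Q x = 3 / (4 * (x - c) ^ 2) + u / (x - c) + h x)
    (hu : h c = u ^ 2) (hdu : dh c = 2 * u * du - deriv h c * dq)
    (hdq : dq = -A c) (hdu' : du = 3 / 4 * deriv (deriv A) c + u * deriv A c) :
    ∃ a, HasLead (fun x => (3 / 2 * dq / (x - c) ^ 3 + u * dq / (x - c) ^ 2 + du / (x - c) + dh x)
      - fuchs Q A x) c 1 a := by
  obtain ⟨B, hB, hAB⟩ := hA.exists_taylor_two
  obtain ⟨K, hK, hBK⟩ := hB.exists_taylor_one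
  have hK' := hK.deriv
  have hK'' := hK'.deriv
  set b := B c
  set A₀ := A c
  set A₁ := deriv A c
  have e0 (x : ℂ) : A x = A₀ + A₁ * (x - c) + b * (x - c) ^ 2 + (x - c) ^ (2 + 1) * K x := by
    rw [hAB, hBK]; ring
  have e1 := deriv_add_mul_pow hK 2 (Eventually.of_forall e0)
  set K₁ : ℂ → ℂ := fun x => 3 * K x + (x - c) * deriv K x with hK₁
  have hK₁a : AnalyticAt ℂ K₁ c := by fun_prop
  have e1' : ∀ᶠ x in 𝓝 c, deriv A x = A₁ + 2 * b * (x - c) + 0 * (x - c) ^ 2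
      + (x - c) ^ (1 + 1) * K₁ x := by
    filter_upwards [e1] with x hx
    rw [hx, hK₁]; push_cast; ring
  have e2 := deriv_add_mul_pow hK₁a 1 e1'
  set K₂ : ℂ → ℂ := fun x => 2 * K₁ x + (x - c) * deriv K₁ x with hK₂
  have hK₂a : AnalyticAt ℂ K₂ c := by
    have := hK₁a.deriv
    fun_prop
  have e2' : ∀ᶠ x in 𝓝 c, deriv (deriv A) x = 2 * b + 0 * (x - c) + 0 * (x - c) ^ 2
      + (x - c) ^ (0 + 1) * K₂ x := by
    filter_upwards [e2] with x hx
    rw [hx, hK₂]; push_cast; ring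
  have e3 := deriv_add_mul_pow hK₂a 0 e2'
  have hb : deriv (deriv A) c = 2 * b := by simpa using e2'.self_of_nhds
  have hK₂d := hK₂a.deriv
  have hhd := hh.deriv
  have hAd := hA.deriv
  -- the difference of the two sides once their polar parts have cancelled
  set E : ℂ → ℂ := fun x => dh x + 3 / 2 * K x + u * (b + (x - c) * K x) - deriv h x * A x
    - 3 / 2 * K₁ x - 2 * u * (2 * b + (x - c) * K₁ x) - 2 * h x * deriv A x
    + (K₂ x + (x - c) * deriv K₂ x) / 2 with hE
  have hEa : AnalyticAt ℂ E c := by fun_prop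
  have hE0 : E c = 0 := by
    simp only [hE, hK₂, hK₁, sub_self, zero_mul, add_zero, hdu, hu, hdu', hb, hdq]
    ring
  have key : HasLead (fun x => (3 / 2 * dq / (x - c) ^ 3 + u * dq / (x - c) ^ 2 + du / (x - c)
      + dh x) - fuchs Q A x) c 0 0 := by
    refine ((HasLead.of_analyticAt hEa).congr_coeff hE0.symm).congr ?_
    filter_upwards [hQ, deriv_polar_add hh hQ, nhdsWithin_le_nhds e1', nhdsWithin_le_nhds e3,
      HasLead.eventually_ne c] with x h1 h2 h3 h4 h5
    rw [fuchs, h1, h2, h4]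
    simp only [hE, h3, e0 x, hdu', hb, hdq]
    field_simp
    push_cast
    ring
  simpa using key.succ

/-- The analogue of `hasLead_sub_fuchs_of_analyticAt` at a simple pole of `A`, where the flow
equations are `∂_t c = -2 u` and `∂_t u = -h'(c)`. -/
lemma hasLead_sub_fuchs_inv {Q A h dh : ℂ → ℂ} {c u dq du : ℂ} (hA : ∀ x, A x = (x - c)⁻¹)
    (hh : AnalyticAt ℂ h c) (hdh : AnalyticAt ℂ dh c)
    (hQ : ∀ᶠ x in 𝓝[≠] c, Q x = 3 / (4 * (x - c) ^ 2) + u / (x - c) + h x)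
    (hu : h c = u ^ 2) (hdu : dh c = 2 * u * du - deriv h c * dq)
    (hdq : dq = -2 * u) (hdu' : du = -deriv h c) :
    ∃ a, HasLead (fun x => (3 / 2 * dq / (x - c) ^ 3 + u * dq / (x - c) ^ 2 + du / (x - c) + dh x)
      - fuchs Q A x) c 1 a := by
  obtain ⟨g, hg, hhg⟩ := hh.exists_taylor_two
  have hgd := hg.deriv
  have e0 (x : ℂ) : h x = h c + deriv h c * (x - c) + 0 * (x - c) ^ 2
      + (x - c) ^ (1 + 1) * g x := by
    rw [hhg]; ring
  have e1 := deriv_add_mul_pow hg 1 (Eventually.of_forall e0)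
  have hAd (n : ℕ) : ∀ x, x - c ≠ 0 → HasDerivAt (fun x => ((x - c) ^ (n + 1))⁻¹)
      (-(n + 1) * ((x - c) ^ (n + 1 + 1))⁻¹) x := by
    intro x hx
    have h6 : HasDerivAt (fun x => x - c) 1 x := (hasDerivAt_id x).sub_const c
    refine ((h6.fun_pow (n + 1)).fun_inv (pow_ne_zero _ hx)).congr_deriv ?_
    field_simp
    simp
    ring
  have hne (x : ℂ) (hx : x - c ≠ 0) : ∀ᶠ y in 𝓝 x, y - c ≠ 0 :=
    (continuous_id.sub continuous_const).continuousAt.eventually_ne hx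
  have d1 : ∀ x, x - c ≠ 0 → deriv A x = -((x - c) ^ 2)⁻¹ := by
    intro x hx
    have : A = fun x => ((x - c) ^ (0 + 1))⁻¹ := by ext x; simp [hA]
    rw [this, (hAd 0 x hx).deriv]
    simp
  have d2 : ∀ x, x - c ≠ 0 → deriv (deriv A) x = 2 * ((x - c) ^ 3)⁻¹ := by
    intro x hx
    have h1 := (hAd 1 x hx).fun_neg.congr_of_eventuallyEq ((hne x hx).mono fun y hy => d1 y hy)
    rw [h1.deriv]
    norm_num
  have d3 : ∀ x, x - c ≠ 0 → deriv (deriv (deriv A)) x = -6 * ((x - c) ^ 4)⁻¹ := by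
    intro x hx
    have h1 := ((hAd 2 x hx).const_mul 2).congr_of_eventuallyEq
      ((hne x hx).mono fun y hy => d2 y hy)
    rw [h1.deriv]
    norm_num
    ring
  -- the difference of the two sides once their polar parts have cancelled
  set E : ℂ → ℂ := fun x => dh x - (x - c) * deriv g x with hE
  have hEa : AnalyticAt ℂ E c := by fun_prop
  have hE0 : E c = 0 := by
    simp only [hE, sub_self, zero_mul, sub_zero, hdu, hdu', hdq]
    ring
  have key : HasLead (fun x => (3 / 2 * dq / (x - c) ^ 3 + u * dq / (x - c) ^ 2 + du / (x - c)
      + dh x) - fuchs Q A x) c 0 0 := by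
    refine ((HasLead.of_analyticAt hEa).congr_coeff hE0.symm).congr ?_
    filter_upwards [hQ, deriv_polar_add hh hQ, nhdsWithin_le_nhds e1, HasLead.eventually_ne c]
      with x h1 h2 h3 h5
    rw [fuchs, h1, h2, d1 x h5, d3 x h5, hA]
    simp only [hE, h3, e0 x, hdu', hdq, hu]
    field_simp
    push_cast
    ring
  simpa using key.succ

namespace PoleData

noncomputable section

variable {D : PoleData}

/-! ### Rational functions determined by their principal parts -/

/-- The polynomial `∏ (x - q_J)`. -/
def nodePoly (ξ : D.Ambient) (x : ℂ) : ℂ := ∏ J, (x - D.q ξ J)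

lemma analyticAt_nodePoly (ξ : D.Ambient) (x : ℂ) : AnalyticAt ℂ (D.nodePoly ξ) x := by
  unfold nodePoly
  fun_prop

lemma nodePoly_ne_zero {ξ : D.Ambient} {x : ℂ} (h : ∀ J, x ≠ D.q ξ J) : D.nodePoly ξ x ≠ 0 :=
  Finset.prod_ne_zero_iff.2 fun J _ => sub_ne_zero.2 (h J)

lemma hasLead_nodePoly {ξ : D.Ambient} (hq : Function.Injective (D.q ξ)) (J : Fin D.n) :
    ∃ a, a ≠ 0 ∧ HasLead (D.nodePoly ξ) (D.q ξ J) 1 a := by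
  refine ⟨∏ K ∈ Finset.univ.erase J, (D.q ξ J - D.q ξ K), ?_, ?_⟩
  · exact Finset.prod_ne_zero_iff.2 fun K hK =>
      sub_ne_zero.2 fun h => Finset.ne_of_mem_erase hK (hq h).symm
  · refine ⟨fun x => ∏ K ∈ Finset.univ.erase J, (x - D.q ξ K), by fun_prop, rfl, ?_⟩
    refine Eventually.of_forall fun x => ?_
    rw [nodePoly, ← Finset.mul_prod_erase _ _ (Finset.mem_univ J), zpow_one]

lemma hasLeadInf_nodePoly (ξ : D.Ambient) : HasLeadInf (D.nodePoly ξ) (-D.n) 1 := by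
  have h := HasLeadInf.prod Finset.univ
    (f := fun J x => x - D.q ξ J) (fun J _ => HasLeadInf.sub_const (D.q ξ J))
  simp only [Finset.prod_const_one] at h
  exact h.congr_order (by simp)

lemma analyticAt_F' (b : D.Base) (x : ℂ) : AnalyticAt ℂ (D.F b) x :=
  analyticAt_F (f := fun _ => b) analyticAt_const analyticAt_id

/-- A rational function with poles of order at most `m_α` at `w_α` and growth at most
`x ^ (m_∞ - 4)` at infinity has `n` degrees of freedom: it vanishes if it has zeros at
`q_1, …, q_n`. -/
lemma eq_zero_of_hasLead_poles {ξ : D.Ambient} (hξ : ξ ∈ D.X) {f : ℂ → ℂ}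
    (hf : ∀ x, D.IsRegularPoint ξ x → AnalyticAt ℂ f x)
    (hw : ∀ α, ∃ a, HasLead f (D.w ξ.1 α) (-D.m α) a)
    (hq : ∀ J, ∃ a, HasLead f (D.q ξ J) 1 a)
    (hi : ∃ a, HasLeadInf f (4 - D.mInf) a) : ∀ x, D.IsRegularPoint ξ x → f x = 0 := by
  -- `f F / ∏ (x - q_J)` is entire and vanishes at infinity
  have key := eq_zero_of_hasLead (f := fun x => f x * D.F ξ.1 x * (D.nodePoly ξ x)⁻¹)
    (D.poles ξ) (D.finite_poles ξ) ?_ ?_ ?_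
  · intro x hx
    have h1 := key x (notMem_poles.2 hx)
    simpa [F_ne_zero hx.1, nodePoly_ne_zero hx.2] using h1
  · intro x hx
    rw [notMem_poles] at hx
    exact (((hf x hx).fun_mul (analyticAt_F' ξ.1 x)).fun_mul
      ((analyticAt_nodePoly ξ x).fun_inv (nodePoly_ne_zero hx.2))).differentiableAt
  · rintro _ (⟨α, rfl⟩ | ⟨J, rfl⟩)
    · obtain ⟨a, ha⟩ := hw α
      obtain ⟨b, -, hb⟩ := hasLead_F hξ.1.1 α
      exact ⟨_, ((ha.mul hb).mul (HasLead.of_analyticAt ((analyticAt_nodePoly ξ _).inv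
        (nodePoly_ne_zero fun J => (hξ.2.2.1 J α).symm)))).congr_order (by ring)⟩
    · obtain ⟨a, ha⟩ := hq J
      obtain ⟨b, hb0, hb⟩ := hasLead_nodePoly hξ.2.1 J
      exact ⟨_, ((ha.mul (HasLead.of_analyticAt (analyticAt_F' ξ.1 _))).mul
        (hb.inv hb0)).congr_order (by ring)⟩
  · obtain ⟨a, ha⟩ := hi
    refine ⟨_, ((ha.mul (hasLeadInf_F ξ.1)).mul
      ((hasLeadInf_nodePoly ξ).inv one_ne_zero)).congr_order ?_⟩
    rw [n_eq]; ring

lemma analyticAt_Q_x {ħ : ℂ} {ξ : D.Ambient} (hξ : ξ ∈ D.X) {x : ℂ} (hx : D.IsRegularPoint ξ x) :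
    AnalyticAt ℂ (D.Q ħ ξ) x :=
  analyticAt_Q ħ analyticAt_const analyticAt_id hξ.2.1 hx

lemma analyticAt_Q0_x {b : D.Base} {x : ℂ} (hx : ∀ α, x ≠ D.w b α) : AnalyticAt ℂ (D.Q0 b) x :=
  analyticAt_Q0 analyticAt_const analyticAt_id hx

lemma analyticAt_G_x {ħ : ℂ} {ξ : D.Ambient} (hξ : ξ ∈ D.X) {x : ℂ} (hx : ∀ α, x ≠ D.w ξ.1 α) :
    AnalyticAt ℂ (D.G ħ ξ) x :=
  analyticAt_G ħ analyticAt_const analyticAt_id hξ.2.1 hx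

lemma analyticAt_H_x {ħ : ℂ} {ξ : D.Ambient} (hξ : ξ ∈ D.X) (J : Fin D.n) :
    AnalyticAt ℂ (D.H ħ ξ J) (D.q ξ J) :=
  analyticAt_H ħ analyticAt_const analyticAt_id hξ.2.1 (hξ.2.2.1 J) J
    fun _ hK h => hK (hξ.2.1 h).symm

lemma analyticAt_polar_x {ħ : ℂ} {ξ : D.Ambient} {x : ℂ} (hx : D.IsRegularPoint ξ x) :
    AnalyticAt ℂ (fun x => ∑ J, D.polar ħ ξ J x) x :=
  Finset.analyticAt_fun_sum _ fun J _ =>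
    analyticAt_polar ħ analyticAt_const analyticAt_id J (hx.2 J)

lemma analyticAt_dQ {ħ : ℂ} {ξ : D.Ambient} (hξ : ξ ∈ D.X) (t : D.Ambient) {x : ℂ}
    (hx : D.IsRegularPoint ξ x) : AnalyticAt ℂ (D.dQ ħ ξ t) x :=
  AnalyticAt.fderiv_fst (f := fun z => D.Q ħ z.1 z.2)
    (analyticAt_Q ħ analyticAt_fst analyticAt_snd hξ.2.1 hx) t

lemma analyticAt_dH {ħ : ℂ} {ξ : D.Ambient} (hξ : ξ ∈ D.X) (t : D.Ambient) (J : Fin D.n) :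
    AnalyticAt ℂ (D.dH ħ ξ t J) (D.q ξ J) :=
  AnalyticAt.fderiv_fst (f := fun z => D.H ħ z.1 J z.2)
    (analyticAt_H ħ analyticAt_fst analyticAt_snd hξ.2.1 (hξ.2.2.1 J) J
      fun _ hK h => hK (hξ.2.1 h).symm) t

lemma deriv_Q_eq {ħ : ℂ} {ξ : D.Ambient} (hξ : ξ ∈ D.X) {x : ℂ} (hx : D.IsRegularPoint ξ x) :
    deriv (D.Q ħ ξ) x = deriv (D.Q0 ξ.1) x / ħ ^ 2 + deriv (D.G ħ ξ) x
      + deriv (fun x => ∑ J, D.polar ħ ξ J x) x := by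
  have h := (((analyticAt_Q0_x hx.1).differentiableAt.hasDerivAt.div_const (ħ ^ 2)).fun_add
    (analyticAt_G_x (ħ := ħ) hξ hx.1).differentiableAt.hasDerivAt).fun_add
    (analyticAt_polar_x (ħ := ħ) hx).differentiableAt.hasDerivAt
  exact (h.congr_of_eventuallyEq (Eventually.of_forall fun y => D.Q_eq ħ ξ y)).deriv

/-- If the poles `w_α` move by `-A(w_α)`, then `R / ħ + S` changes at `w_α` as it would under
the vector field `-A ∂_x`, up to terms of order at least `-m_α`. -/
lemma hasLead_dG_sub {ħ : ℂ} {ξ t : D.Ambient} (hξ : ξ ∈ D.X) (α : Fin D.N) {A : ℂ → ℂ}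
    (hA : AnalyticAt ℂ A (D.w ξ.1 α)) (hAw : A (D.w ξ.1 α) = -D.w t.1 α) :
    ∃ a, HasLead (fun x => D.dG ħ ξ t x - (2 * (D.G ħ ξ x * deriv A x) + deriv (D.G ħ ξ) x * A x))
      (D.w ξ.1 α) (-D.m α) a := by
  obtain ⟨g, hg⟩ := hasLead_G hξ ħ α
  have h1 := hasLead_dG hξ ħ t α hg
  have h2 := ((hg.mul (HasLead.of_analyticAt hA.deriv)).const_mul 2).weaken
    (l := -(D.m α + 1)) (by lia)
  have h3 := (hg.deriv.mul (HasLead.of_analyticAt hA)).congr_order (l := -(D.m α + 1)) (by ring)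
  have h4 := (h1.sub (h2.add h3)).congr_coeff (b := 0) (by rw [hAw]; push_cast; ring)
  obtain ⟨b, hb⟩ := h4.succ
  exact ⟨b, hb.congr_order (by ring)⟩

/-- At infinity `R / ħ + S` contributes nothing of degree above `m_∞ - 4` to the equation. -/
lemma hasLeadInf_dG_sub {ħ : ℂ} {ξ t : D.Ambient} (hξ : ξ ∈ D.X) {A : ℂ → ℂ} {a : ℂ}
    (hA : HasLeadInf A 1 a) :
    ∃ a, HasLeadInf
      (fun x => D.dG ħ ξ t x - (2 * (D.G ħ ξ x * deriv A x) + deriv (D.G ħ ξ) x * A x))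
      (4 - D.mInf) a := by
  obtain ⟨g, hg⟩ := hasLeadInf_G ξ ħ
  obtain ⟨b, hb⟩ := hasLeadInf_dG hξ ħ t
  have h2 := ((hg.mul hA.deriv).const_mul 2).weaken (l := 4 - D.mInf) (by lia)
  have h3 := (hg.deriv.mul hA).weaken (l := 4 - D.mInf) (by lia)
  exact ⟨_, hb.sub (h2.add h3)⟩

/-- A tangent vector `t` of `X` whose components match the principal parts of
`2 Q A' + Q' A - A''' / 2` satisfies `∂_t Q = 2 Q A' + Q' A - A''' / 2`: the difference of the two
sides has `n` degrees of freedom left, and vanishes at the apparent singularities `q_1, …, q_n`. -/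
theorem dQ_eq_fuchs {ħ : ℂ} {ξ t : D.Ambient} (hξ : ξ ∈ D.X) (ht : t ∈ D.tangentSpace ξ)
    {A : ℂ → ℂ} (hA : ∀ x, D.IsRegularPoint ξ x → AnalyticAt ℂ A x)
    (hAw : ∀ α, AnalyticAt ℂ A (D.w ξ.1 α) ∧ A (D.w ξ.1 α) = -D.w t.1 α)
    {a : ℂ} (hAi : HasLeadInf A 1 a)
    (h0w : ∀ α, ∃ a, HasLead (fun x => D.dQ0 ξ.1 t.1 x
      - (2 * (D.Q0 ξ.1 x * deriv A x) + deriv (D.Q0 ξ.1) x * A x)) (D.w ξ.1 α) (-D.m α) a)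
    (h0i : ∃ a, HasLeadInf (fun x => D.dQ0 ξ.1 t.1 x
      - (2 * (D.Q0 ξ.1 x * deriv A x) + deriv (D.Q0 ξ.1) x * A x)) (4 - D.mInf) a)
    (hq : ∀ J, (AnalyticAt ℂ A (D.q ξ J) ∧ D.q t J = -A (D.q ξ J) ∧ D.residue ħ t J
        = 3 / 4 * deriv (deriv A) (D.q ξ J) + D.residue ħ ξ J * deriv A (D.q ξ J)) ∨
      ((∀ x, A x = (x - D.q ξ J)⁻¹) ∧ D.q t J = -2 * D.residue ħ ξ J ∧
        D.residue ħ t J = -deriv (D.H ħ ξ J) (D.q ξ J)))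
    {x : ℂ} (hx : D.IsRegularPoint ξ x) : D.dQ ħ ξ t x = fuchs (D.Q ħ ξ) A x := by
  have hm := D.three_le_mInf
  have hsplit : ∀ x, D.IsRegularPoint ξ x → D.dQ ħ ξ t x - fuchs (D.Q ħ ξ) A x =
      (ħ ^ 2)⁻¹ * (D.dQ0 ξ.1 t.1 x
        - (2 * (D.Q0 ξ.1 x * deriv A x) + deriv (D.Q0 ξ.1) x * A x)) +
      (D.dG ħ ξ t x - (2 * (D.G ħ ξ x * deriv A x) + deriv (D.G ħ ξ) x * A x)) +
      (∑ J, D.dpolar ħ ξ t J x - fuchs (fun x => ∑ J, D.polar ħ ξ J x) A x) := by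
    intro x hx
    rw [fuchs, fuchs, deriv_Q_eq hξ hx, dQ_eq hξ t hx, Q_eq]
    ring
  refine sub_eq_zero.1 (eq_zero_of_hasLead_poles hξ (f := fun x => D.dQ ħ ξ t x
    - fuchs (D.Q ħ ξ) A x) ?_ ?_ ?_ ?_ x hx)
  · intro x hx
    have h1 := analyticAt_dQ (ħ := ħ) hξ t hx
    have h2 := hA x hx
    have h3 := h2.deriv
    have h4 := h3.deriv.deriv
    have h5 := analyticAt_Q_x (ħ := ħ) hξ hx
    have h6 := h5.deriv
    unfold fuchs
    fun_prop
  · intro α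
    obtain ⟨a, ha⟩ := h0w α
    obtain ⟨b, hb⟩ := hasLead_dG_sub (ħ := ħ) hξ α (hAw α).1 (hAw α).2
    have h1 : AnalyticAt ℂ (fun x => ∑ J, D.dpolar ħ ξ t J x
        - fuchs (fun x => ∑ J, D.polar ħ ξ J x) A x) (D.w ξ.1 α) := by
      have h2 := (hAw α).1
      have h3 := h2.deriv
      have h4 := h3.deriv.deriv
      have h5 := analyticAt_polar_w (ħ := ħ) hξ α
      have h6 := h5.deriv
      have h7 := analyticAt_dpolar_w (ħ := ħ) hξ t α
      unfold fuchs
      fun_prop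
    have h2 := (HasLead.of_analyticAt h1).weaken (l := -D.m α)
      (by have := D.one_le_m α; lia)
    refine ⟨_, (((ha.const_mul (ħ ^ 2)⁻¹).add hb).add h2).congr ?_⟩
    filter_upwards [eventually_isRegularPoint ξ (D.w ξ.1 α)] with x hx using hsplit x hx
  · intro J
    have hQ : ∀ᶠ x in 𝓝[≠] (D.q ξ J), D.Q ħ ξ x = 3 / (4 * (x - D.q ξ J) ^ 2)
        + D.residue ħ ξ J / (x - D.q ξ J) + D.H ħ ξ J x :=
      Eventually.of_forall fun x => D.Q_eq_polar_add_H ħ ξ J x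
    have hu : D.H ħ ξ J (D.q ξ J) = D.residue ħ ξ J ^ 2 := by
      rw [H_node (fun _ hK h => hK (hξ.2.1 h).symm) (hξ.2.2.1 J), hξ.2.2.2.2 J]
      ring
    have hdu := dH_node (ħ := ħ) hξ ht J
    have : ∃ a, HasLead (fun x => (3 / 2 * D.q t J / (x - D.q ξ J) ^ 3
        + D.residue ħ ξ J * D.q t J / (x - D.q ξ J) ^ 2 + D.residue ħ t J / (x - D.q ξ J)
        + D.dH ħ ξ t J x) - fuchs (D.Q ħ ξ) A x) (D.q ξ J) 1 a := by
      rcases hq J with ⟨h1, h2, h3⟩ | ⟨h1, h2, h3⟩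
      · exact hasLead_sub_fuchs_of_analyticAt h1 (analyticAt_H_x hξ J) (analyticAt_dH hξ t J)
          hQ hu hdu h2 h3
      · exact hasLead_sub_fuchs_inv h1 (analyticAt_H_x hξ J) (analyticAt_dH hξ t J)
          hQ hu hdu h2 h3
    obtain ⟨a, ha⟩ := this
    refine ⟨a, ha.congr ?_⟩
    filter_upwards [eventually_isRegularPoint ξ (D.q ξ J)] with x hx
    rw [dQ_eq_dpolar_add_dH hξ t J hx, dpolar]
  · obtain ⟨b, hb⟩ := h0i
    obtain ⟨g, hg⟩ := hasLeadInf_dG_sub (ħ := ħ) (t := t) hξ hAi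
    have h1 := HasLeadInf.sum Finset.univ fun J _ => hasLeadInf_dpolar ħ ξ t J
    have h2 := HasLeadInf.sum Finset.univ fun J _ => hasLeadInf_polar ħ ξ J
    have h3 := ((((h2.mul hAi.deriv).const_mul 2).weaken (l := 1) (by lia)).add
      ((h2.deriv.mul hAi).weaken (l := 1) (by lia))).add
      ((hAi.deriv.deriv.deriv.const_mul (-1 / 2)).weaken (l := 1) (by lia))
    obtain ⟨d, h4⟩ := (h1.sub h3).exists_of_le (l := 4 - D.mInf) (by lia)
    refine ⟨_, (((hb.const_mul (ħ ^ 2)⁻¹).add hg).add h4).congr ?_⟩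
    filter_upwards [eventually_cocompact_isRegularPoint ξ] with x hx using hsplit x hx

end
end PoleData

/-! ### The principal parts of `2 Q₀ A' + Q₀' A` for `A = 1 / (x - q)` -/

lemma sum_inv_pow_mul_inv_pow {y s : ℂ} (hy : y ≠ 0) (hs : s ≠ 0) (hys : y - s ≠ 0) (K : ℕ) :
    ∑ i ∈ Finset.range K, (s ^ (K + 1 - i) * y ^ (i + 1))⁻¹
      = -((y ^ K)⁻¹ - (s ^ K)⁻¹) / (s * (y - s)) := by
  induction K with
  | zero => simp
  | succ K ih =>
    have h : ∀ i ∈ Finset.range K, (s ^ (K + 1 + 1 - i) * y ^ (i + 1))⁻¹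
        = s⁻¹ * (s ^ (K + 1 - i) * y ^ (i + 1))⁻¹ := by
      intro i hi
      have : K + 1 + 1 - i = (K + 1 - i) + 1 := by have := Finset.mem_range.1 hi; omega
      rw [this, pow_succ, ← mul_inv]
      ring
    rw [Finset.sum_range_succ, Finset.sum_congr rfl h, ← Finset.mul_sum, ih]
    have : K + 1 + 1 - K = 2 := by omega
    rw [this]
    field_simp
    ring

lemma sum_mul_inv_pow_mul_inv_pow {y s : ℂ} (hy : y ≠ 0) (hs : s ≠ 0) (hys : y - s ≠ 0) (K : ℕ) :
    ∑ i ∈ Finset.range K, i * (s ^ (K + 1 - i) * y ^ (i + 1))⁻¹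
      = 1 / 2 * (-K * (y ^ K)⁻¹ / (y * (y - s)) - 2 * (y ^ K)⁻¹ / (y - s) ^ 2
        - K * (y ^ K)⁻¹ / (s * y) - (K + 2) * (s ^ K)⁻¹ / (s * (y - s))
        + 2 * y * (s ^ K)⁻¹ / (s * (y - s) ^ 2)
        - K * ((y ^ K)⁻¹ - (s ^ K)⁻¹) / (s * (y - s))) := by
  induction K with
  | zero =>
    simp
    field_simp
    ring
  | succ K ih =>
    have h : ∀ i ∈ Finset.range K, i * (s ^ (K + 1 + 1 - i) * y ^ (i + 1))⁻¹
        = s⁻¹ * (i * (s ^ (K + 1 - i) * y ^ (i + 1))⁻¹) := by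
      intro i hi
      have : K + 1 + 1 - i = (K + 1 - i) + 1 := by have := Finset.mem_range.1 hi; omega
      rw [this, pow_succ, mul_left_comm, ← mul_inv]
      ring
    rw [Finset.sum_range_succ, Finset.sum_congr rfl h, ← Finset.mul_sum, ih]
    have : K + 1 + 1 - K = 2 := by omega
    rw [this]
    push_cast
    field_simp
    ring

/-- The principal part at `y = 0` of `2 f A' + f' A` for `f = 1 / y ^ (k + 1)` and
`A = 1 / (y - s)`. -/
lemma principal_part_finite {y s : ℂ} (hy : y ≠ 0) (hs : s ≠ 0) (hys : y - s ≠ 0) (k : ℕ) :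
    2 * ((y ^ (k + 1))⁻¹ * -((y - s) ^ 2)⁻¹) + -(k + 1) * (y ^ (k + 2))⁻¹ * (y - s)⁻¹
      = (k + 1) * (1 / s) / y ^ (k + 2)
        + ∑ i ∈ Finset.range (k + 1),
          (2 * (i + 1) - (k + 1) - 2) / s ^ (k - i + 2) / y ^ (i + 1)
        + ((k + 3) / (s ^ (k + 2) * (y - s)) - 2 * y / (s ^ (k + 2) * (y - s) ^ 2)) := by
  have h : ∀ i ∈ Finset.range (k + 1),
      (2 * ((i : ℂ) + 1) - (k + 1) - 2) / s ^ (k - i + 2) / y ^ (i + 1)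
        = 2 * (i * (s ^ (k + 1 + 1 - i) * y ^ (i + 1))⁻¹)
          - (k + 1) * (s ^ (k + 1 + 1 - i) * y ^ (i + 1))⁻¹ := by
    intro i hi
    have : k + 1 + 1 - i = k - i + 2 := by have := Finset.mem_range.1 hi; omega
    rw [this, div_div, div_eq_mul_inv]
    ring
  rw [Finset.sum_congr rfl h, Finset.sum_sub_distrib, ← Finset.mul_sum, ← Finset.mul_sum,
    sum_inv_pow_mul_inv_pow hy hs hys, sum_mul_inv_pow_mul_inv_pow hy hs hys]
  push_cast
  field_simp
  ring

lemma sum_pow_mul_pow {x q : ℂ} (h : x - q ≠ 0) (j : ℕ) :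
    ∑ i ∈ Finset.range j, q ^ (j - 1 - i) * x ^ i = (x ^ j - q ^ j) / (x - q) := by
  rw [eq_div_iff h, ← geom_sum₂_mul]
  simp only [mul_comm]

lemma sum_mul_pow_mul_pow {x q : ℂ} (h : x - q ≠ 0) (j : ℕ) :
    ∑ i ∈ Finset.range j, i * (q ^ (j - 1 - i) * x ^ i) =
      1 / 2 * (-2 * (x ^ (j + 1) - q ^ (j + 1)) / (x - q) ^ 2 + (j + 1) * (x ^ j + q ^ j) / (x - q)
        - (1 - j) * ((x ^ j - q ^ j) / (x - q))) := by
  induction j with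
  | zero =>
    simp
    field_simp
    ring
  | succ j ih =>
    have h' : ∀ i ∈ Finset.range j, i * (q ^ (j + 1 - 1 - i) * x ^ i)
        = q * (i * (q ^ (j - 1 - i) * x ^ i)) := by
      intro i hi
      have : j + 1 - 1 - i = (j - 1 - i) + 1 := by have := Finset.mem_range.1 hi; omega
      rw [this, pow_succ]
      ring
    rw [Finset.sum_range_succ, Finset.sum_congr rfl h', ← Finset.mul_sum, ih]
    have : j + 1 - 1 - j = 0 := by omega
    rw [this]
    push_cast
    field_simp
    ring

/-- The polynomial part of `2 f A' + f' A` for `f = x ^ k` and `A = 1 / (x - q)`. -/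
lemma principal_part_infinite {x q : ℂ} (h : x - q ≠ 0) (k : ℕ) :
    2 * (x ^ k * -((x - q) ^ 2)⁻¹) + k * x ^ (k - 1) * (x - q)⁻¹
      = ∑ i ∈ Finset.range (k - 1), (2 * i - k + 2) * q ^ (k - i - 2) * x ^ i
        + (-2 * q ^ k / (x - q) ^ 2 - k * q ^ (k - 1) / (x - q) ^ 1) := by
  rcases k with - | j
  · simp; field_simp
  · have h' : ∀ i ∈ Finset.range j, (2 * (i : ℂ) - (j + 1 : ℕ) + 2) * q ^ (j + 1 - i - 2) * x ^ i
        = 2 * (i * (q ^ (j - 1 - i) * x ^ i)) + (1 - j) * (q ^ (j - 1 - i) * x ^ i) := by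
      intro i hi
      have : j + 1 - i - 2 = j - 1 - i := by omega
      rw [this]
      push_cast
      ring
    rw [Nat.add_sub_cancel, Finset.sum_congr rfl h', Finset.sum_add_distrib, ← Finset.mul_sum,
      ← Finset.mul_sum, sum_pow_mul_pow h, sum_mul_pow_mul_pow h]
    push_cast
    field_simp
    ring

lemma sum_range_eq_sum_fin {M k : ℕ} (hk : k ≤ M) (f : ℕ → ℂ) :
    ∑ i ∈ Finset.range k, f i = ∑ i : Fin M, if (i : ℕ) < k then f i else 0 := by
  rw [Fin.sum_univ_eq_sum_range (fun i => if i < k then f i else 0), ← Finset.sum_filter]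
  congr 1
  ext i
  simp only [Finset.mem_filter, Finset.mem_range]
  omega

lemma deriv_inv_sub {x c : ℂ} (h : x - c ≠ 0) :
    deriv (fun x => (x - c)⁻¹) x = -((x - c) ^ 2)⁻¹ := by
  have h6 : HasDerivAt (fun x => x - c) 1 x := (hasDerivAt_id x).sub_const c
  rw [(h6.fun_inv h).deriv]
  simp [neg_div]

lemma deriv_deriv_inv_sub {x c : ℂ} (h : x - c ≠ 0) :
    deriv (deriv fun x => (x - c)⁻¹) x = 2 * ((x - c) ^ 3)⁻¹ := by
  have h6 : HasDerivAt (fun x => x - c) 1 x := (hasDerivAt_id x).sub_const c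
  have hne : ∀ᶠ y in 𝓝 x, y - c ≠ 0 :=
    (continuous_id.sub continuous_const).continuousAt.eventually_ne h
  rw [(((h6.fun_pow 2).fun_inv (pow_ne_zero _ h)).fun_neg.congr_of_eventuallyEq
    (hne.mono fun y hy => deriv_inv_sub hy)).deriv]
  field_simp
  norm_num
  ring

namespace PoleData

noncomputable section

variable {D : PoleData}

/-- The components of `U_I` along the `w_α` and the high coefficients are chosen so that they cancel
the principal part of `2 Q₀ A' + Q₀' A` at `w_α`, for `A = 1 / (x - q_I)`, down to order `m_α`. -/
lemma hasLead_dQ0_UBase {ξ : D.Ambient} (hξ : ξ ∈ D.X) (I : Fin D.n) (α : Fin D.N) :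
    ∃ a, HasLead (fun x => D.dQ0 ξ.1 (D.UBase ξ I) x - (2 * (D.Q0 ξ.1 x
      * deriv (fun x => (x - D.q ξ I)⁻¹) x) + deriv (D.Q0 ξ.1) x * (x - D.q ξ I)⁻¹))
      (D.w ξ.1 α) (-D.m α) a := by
  obtain ⟨g, hg, hQ⟩ := exists_Q0_eq_principal hξ.1.1 α
  obtain ⟨g', hg', hdQ⟩ := exists_dQ0_eq_principal hξ.1.1 (D.UBase ξ I) α
  set c := D.w ξ.1 α with hc
  set q := D.q ξ I with hq
  set s := q - c with hs
  have hs0 : s ≠ 0 := sub_ne_zero.2 (hξ.2.2.1 I α)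
  have hcq : c - q ≠ 0 := sub_ne_zero.2 (hξ.2.2.1 I α).symm
  set a := D.aFin ξ.1 α with ha
  have hA : AnalyticAt ℂ (fun x => (x - q)⁻¹) c := by fun_prop (disch := exact hcq)
  have hA' := hA.deriv
  have hgd := hg.deriv
  set T : Fin (2 * D.m α - 1) → ℂ := fun i => D.TFin ξ.1 α i s with hT
  have hdQ0 : ∀ᶠ x in 𝓝[≠] c, deriv (D.Q0 ξ.1) x
      = ∑ k, a k * (-((k : ℕ) + 1) * ((x - c) ^ ((k : ℕ) + 2))⁻¹) + deriv g x := by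
    have h1 : ∀ᶠ x in 𝓝[≠] c, AnalyticAt ℂ g x :=
      hg.eventually_analyticAt.filter_mono nhdsWithin_le_nhds
    filter_upwards [h1, HasLead.eventually_ne c] with x hx h3
    have h6 : HasDerivAt (fun x => x - c) 1 x := (hasDerivAt_id x).sub_const c
    have h7 (k : Fin (2 * D.m α - 1)) : HasDerivAt (fun x => a k / (x - c) ^ ((k : ℕ) + 1))
        (a k * (-((k : ℕ) + 1) * ((x - c) ^ ((k : ℕ) + 2))⁻¹)) x := by
      refine ((hasDerivAt_const x (a k)).fun_div (h6.fun_pow ((k : ℕ) + 1))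
        (pow_ne_zero _ h3)).congr_deriv ?_
      field_simp
      push_cast
      ring
    have h8 := (HasDerivAt.fun_sum (u := Finset.univ) fun k _ => h7 k).fun_add
      hx.differentiableAt.hasDerivAt
    exact (h8.congr_of_eventuallyEq (Eventually.of_forall hQ)).deriv
  -- the principal parts of order above `m_α` cancel, and those of order up to `m_α` remain
  obtain ⟨b, hb⟩ : ∃ b, HasLead (fun x => ∑ i : Fin (2 * D.m α - 1),
      if D.m α ≤ (i : ℕ) then 0 else T i / (x - c) ^ ((i : ℕ) + 1)) c (-D.m α) b := by
    refine HasLead.exists_sum _ fun i _ => ?_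
    split_ifs with h
    · exact ⟨0, HasLead.zero⟩
    · exact (hasLead_sub_pow c ((i : ℕ) + 1) (T i)).exists_of_le (by push_cast; omega)
  have hr : AnalyticAt ℂ (fun x => g' x - (2 * (g x * deriv (fun x => (x - q)⁻¹) x)
      + deriv g x * (x - q)⁻¹) - ∑ k : Fin (2 * D.m α - 1), a k *
      (((k : ℕ) + 3) / (s ^ ((k : ℕ) + 2) * (x - q))
        - 2 * (x - c) / (s ^ ((k : ℕ) + 2) * (x - q) ^ 2))) c := by
    fun_prop (disch := simp [hs0, hcq])
  obtain ⟨b', hb'⟩ := (HasLead.of_analyticAt hr).exists_of_le (l := -D.m α) (by lia)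
  refine ⟨_, (hb'.sub hb).congr ?_⟩
  filter_upwards [hdQ0, HasLead.eventually_ne c, eventually_isRegularPoint ξ c] with x h1 h2 h3
  have hxq : x - q ≠ 0 := sub_ne_zero.2 (h3.2 I)
  have hy : x - c - s = x - q := by rw [hs]; ring
  have e1 : ∑ i, D.aFin (D.UBase ξ I) α i / (x - c) ^ ((i : ℕ) + 1) =
      ∑ i, T i / (x - c) ^ ((i : ℕ) + 1)
        - ∑ i : Fin (2 * D.m α - 1),
          if D.m α ≤ (i : ℕ) then 0 else T i / (x - c) ^ ((i : ℕ) + 1) := by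
    rw [← Finset.sum_sub_distrib]
    refine Finset.sum_congr rfl fun i _ => ?_
    simp only [aFin, UBase, Nat.add_le_add_iff_right]
    split_ifs
    · simp [hT, hs, hc, hq]
    · simp
  have e2 : ∑ i : Fin (2 * D.m α - 1),
      ((i : ℕ) + 1) * a i * D.w (D.UBase ξ I) α / (x - c) ^ ((i : ℕ) + 2)
      = ∑ k : Fin (2 * D.m α - 1),
        a k * (((k : ℕ) + 1) * (1 / s) / (x - c) ^ ((k : ℕ) + 2)) := by
    refine Finset.sum_congr rfl fun i _ => ?_
    have : D.w (D.UBase ξ I) α = 1 / s := rfl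
    rw [this]
    ring
  have e3 : ∑ i, T i / (x - c) ^ ((i : ℕ) + 1) = ∑ k : Fin (2 * D.m α - 1), a k *
      ∑ i ∈ Finset.range ((k : ℕ) + 1),
          (2 * ((i : ℂ) + 1) - ((k : ℕ) + 1) - 2) / s ^ ((k : ℕ) - i + 2) / (x - c) ^ (i + 1) := by
    have (k : Fin (2 * D.m α - 1)) := sum_range_eq_sum_fin (M := 2 * D.m α - 1) (k := (k : ℕ) + 1)
      (by omega) (fun i => (2 * ((i : ℂ) + 1) - ((k : ℕ) + 1) - 2) / s ^ ((k : ℕ) - i + 2)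
        / (x - c) ^ (i + 1))
    simp only [this, hT, TFin, Finset.sum_div, Finset.mul_sum]
    rw [Finset.sum_comm' (t' := Finset.univ) (s' := fun k => Finset.univ.filter (· ≤ k)) (by simp)]
    refine Finset.sum_congr rfl fun k _ => ?_
    rw [Finset.sum_filter]
    refine Finset.sum_congr rfl fun i _ => ?_
    simp only [Nat.lt_add_one_iff, Fin.val_fin_le]
    split_ifs
    · simp only [ha]; ring
    · simp
  rw [hdQ, hQ, h1, e1, e2, e3, deriv_inv_sub hxq]
  have e4 (k : Fin (2 * D.m α - 1)) := principal_part_finite h2 hs0 (by rwa [hy]) (k : ℕ)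
  simp only [hy] at e4
  have e5 : ∑ k, a k * (2 * (((x - c) ^ ((k : ℕ) + 1))⁻¹ * -((x - q) ^ 2)⁻¹)
      + -((k : ℕ) + 1) * ((x - c) ^ ((k : ℕ) + 2))⁻¹ * (x - q)⁻¹) =
      2 * ((∑ k, a k / (x - c) ^ ((k : ℕ) + 1)) * -((x - q) ^ 2)⁻¹)
        + (∑ k, a k * (-((k : ℕ) + 1) * ((x - c) ^ ((k : ℕ) + 2))⁻¹)) * (x - q)⁻¹ := by
    rw [Finset.sum_mul, Finset.mul_sum, Finset.sum_mul, ← Finset.sum_add_distrib]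
    refine Finset.sum_congr rfl fun k _ => ?_
    ring
  have e6 : ∑ k, a k * (2 * (((x - c) ^ ((k : ℕ) + 1))⁻¹ * -((x - q) ^ 2)⁻¹)
      + -((k : ℕ) + 1) * ((x - c) ^ ((k : ℕ) + 2))⁻¹ * (x - q)⁻¹) =
      ∑ k : Fin (2 * D.m α - 1), a k * (((k : ℕ) + 1) * (1 / s) / (x - c) ^ ((k : ℕ) + 2))
      + ∑ k : Fin (2 * D.m α - 1), a k * ∑ i ∈ Finset.range ((k : ℕ) + 1),
          (2 * ((i : ℂ) + 1) - ((k : ℕ) + 1) - 2) / s ^ ((k : ℕ) - i + 2) / (x - c) ^ (i + 1)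
      + ∑ k : Fin (2 * D.m α - 1), a k * (((k : ℕ) + 3) / (s ^ ((k : ℕ) + 2) * (x - q))
        - 2 * (x - c) / (s ^ ((k : ℕ) + 2) * (x - q) ^ 2)) := by
    rw [← Finset.sum_add_distrib, ← Finset.sum_add_distrib]
    refine Finset.sum_congr rfl fun k _ => ?_
    rw [e4 k]
    ring
  simp only [ha] at e5 e6 ⊢
  linear_combination e5 - e6

/-- The components of `U_I` along the high coefficients at infinity cancel the terms of
`2 Q₀ A' + Q₀' A` of degree above `m_∞ - 4`, for `A = 1 / (x - q_I)`. -/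
lemma hasLeadInf_dQ0_UBase {ξ : D.Ambient} (I : Fin D.n) :
    ∃ a, HasLeadInf (fun x => D.dQ0 ξ.1 (D.UBase ξ I) x - (2 * (D.Q0 ξ.1 x
      * deriv (fun x => (x - D.q ξ I)⁻¹) x) + deriv (D.Q0 ξ.1) x * (x - D.q ξ I)⁻¹))
      (4 - D.mInf) a := by
  have hm := D.three_le_mInf
  obtain ⟨g, ⟨z, hg⟩, hQ⟩ := exists_Q0_eq_principal_inf ξ.1
  obtain ⟨g', ⟨z', hg'⟩, hdQ⟩ := exists_dQ0_eq_principal_inf ξ.1 (D.UBase ξ I)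
  set q := D.q ξ I with hq
  set a := D.aInf ξ.1 with ha
  set r := 2 * D.mInf - 5 with hr
  have hA := HasLeadInf.inv_sub_const q
  set T : Fin (2 * D.mInf - 6) → ℂ := fun i => D.TInf ξ.1 i q with hT
  have hdQ0 : ∀ᶠ x in cocompact ℂ, deriv (D.Q0 ξ.1) x
      = r * x ^ (r - 1) + ∑ k, a k * ((k : ℕ) * x ^ ((k : ℕ) - 1)) + deriv g x := by
    have h1 : ∀ᶠ x in cocompact ℂ, D.IsRegularPoint ξ x := eventually_cocompact_isRegularPoint ξ
    filter_upwards [h1] with x hx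
    have h2 : AnalyticAt ℂ g x := by
      have h3 : g = fun x => D.Q0 ξ.1 x - (x ^ r + ∑ i, a i * x ^ (i : ℕ)) := by
        ext x; rw [hQ]; ring
      rw [h3]
      have := analyticAt_Q0_x hx.1
      fun_prop
    have h7 (k : Fin (2 * D.mInf - 6)) := (hasDerivAt_pow (k : ℕ) x).const_mul (a k)
    have h8 := ((hasDerivAt_pow r x).fun_add (HasDerivAt.fun_sum (u := Finset.univ)
      fun k _ => h7 k)).fun_add h2.differentiableAt.hasDerivAt
    exact (h8.congr_of_eventuallyEq (Eventually.of_forall hQ)).deriv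
  -- the terms of degree at least `m_∞ - 3` cancel
  obtain ⟨b, hb⟩ : ∃ b, HasLeadInf (fun x => ∑ i : Fin (2 * D.mInf - 6),
      if D.mInf - 3 ≤ (i : ℕ) then 0 else T i * x ^ (i : ℕ)) (4 - D.mInf) b := by
    refine HasLeadInf.exists_sum _ fun i _ => ?_
    split_ifs with h
    · exact ⟨0, HasLeadInf.zero⟩
    · exact (hasLeadInf_pow i (T i)).exists_of_le (by omega)
  have hE (k : ℕ) : ∃ b, HasLeadInf (fun x => -2 * q ^ k / (x - q) ^ 2
      - k * q ^ (k - 1) / (x - q) ^ 1) 1 b := by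
    exact ⟨_, ((hasLeadInf_div_pow q 2 (-2 * q ^ k)).weaken (by norm_num)).sub
      (hasLeadInf_div_pow q 1 (k * q ^ (k - 1)))⟩
  obtain ⟨d₁, h₁⟩ := hE r
  obtain ⟨d₂, h₂⟩ : ∃ b, HasLeadInf (fun x => ∑ k : Fin (2 * D.mInf - 6), a k *
      (-2 * q ^ (k : ℕ) / (x - q) ^ 2 - (k : ℕ) * q ^ ((k : ℕ) - 1) / (x - q) ^ 1)) 1 b :=
    HasLeadInf.exists_sum _ fun k _ => let ⟨d, hd⟩ := hE k; ⟨_, hd.const_mul _⟩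
  have h₃ := (((hg.mul hA.deriv).const_mul 2).weaken (l := 1) (by norm_num)).add
    ((hg.deriv.mul hA).weaken (l := 1) (by norm_num))
  obtain ⟨b', hb'⟩ := (((hg'.sub h₃).sub h₁).sub h₂).exists_of_le (l := 4 - D.mInf) (by lia)
  refine ⟨_, (hb'.sub hb).congr ?_⟩
  filter_upwards [hdQ0, eventually_cocompact_isRegularPoint ξ] with x h1 h3
  have hxq : x - q ≠ 0 := sub_ne_zero.2 (h3.2 I)
  have e1 : ∑ i, D.aInf (D.UBase ξ I) i * x ^ (i : ℕ) = ∑ i, T i * x ^ (i : ℕ)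
        - ∑ i : Fin (2 * D.mInf - 6),
          if D.mInf - 3 ≤ (i : ℕ) then 0 else T i * x ^ (i : ℕ) := by
    rw [← Finset.sum_sub_distrib]
    refine Finset.sum_congr rfl fun i _ => ?_
    simp only [aInf, UBase]
    split_ifs
    · simp [hT, hq]
    · simp
  have e3 : ∑ i, T i * x ^ (i : ℕ) =
      ∑ i ∈ Finset.range (r - 1), (2 * (i : ℂ) - r + 2) * q ^ (r - i - 2) * x ^ i
      + ∑ k : Fin (2 * D.mInf - 6), a k * ∑ i ∈ Finset.range ((k : ℕ) - 1),
          (2 * (i : ℂ) - (k : ℕ) + 2) * q ^ ((k : ℕ) - i - 2) * x ^ i := by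
    have (k : Fin (2 * D.mInf - 6)) := sum_range_eq_sum_fin (M := 2 * D.mInf - 6) (k := (k : ℕ) - 1)
      (by omega) (fun i => (2 * (i : ℂ) - (k : ℕ) + 2) * q ^ ((k : ℕ) - i - 2) * x ^ i)
    have h0 := sum_range_eq_sum_fin (M := 2 * D.mInf - 6) (k := r - 1)
      (by omega) (fun i => (2 * (i : ℂ) - r + 2) * q ^ (r - i - 2) * x ^ i)
    have hTi (i : Fin (2 * D.mInf - 6)) : T i * x ^ (i : ℕ) =
        (2 * (i : ℕ) - 2 * (D.mInf : ℂ) + 7) * q ^ (2 * D.mInf - 7 - (i : ℕ)) * x ^ (i : ℕ)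
        + ∑ k ∈ Finset.univ.filter (fun k : Fin (2 * D.mInf - 6) => (i : ℕ) + 2 ≤ k),
          (2 * (i : ℕ) - (k : ℕ) + 2) * a k * q ^ ((k : ℕ) - i - 2) * x ^ (i : ℕ) := by
      simp only [hT, TInf]
      rw [_root_.add_mul, Finset.sum_mul]
    simp only [this, h0, hTi, Finset.mul_sum]
    rw [Finset.sum_add_distrib]
    congr 1
    · refine Finset.sum_congr rfl fun i _ => ?_
      have hi := i.isLt
      rw [if_pos (by omega)]
      have h1 : (r : ℂ) = 2 * D.mInf - 5 := by
        rw [hr]; push_cast [Nat.cast_sub (by omega : 5 ≤ 2 * D.mInf)]; ring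
      have h2 : r - (i : ℕ) - 2 = 2 * D.mInf - 7 - (i : ℕ) := by omega
      rw [h1, h2]
      ring
    · rw [Finset.sum_comm' (t' := Finset.univ) (s' := fun k : Fin (2 * D.mInf - 6) =>
        Finset.univ.filter (fun i : Fin (2 * D.mInf - 6) => (i : ℕ) + 2 ≤ k)) (by simp)]
      refine Finset.sum_congr rfl fun k _ => ?_
      rw [Finset.sum_filter]
      refine Finset.sum_congr rfl fun i _ => ?_
      by_cases h : (i : ℕ) + 2 ≤ k
      · rw [if_pos h, if_pos (by omega)]
        simp only [ha]; ring
      · rw [if_neg h, if_neg (by omega)]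
        simp
  rw [hdQ, hQ, h1, e1, e3, deriv_inv_sub hxq]
  have e4 := principal_part_infinite hxq
  have e5 : ∑ k : Fin (2 * D.mInf - 6), a k * (2 * (x ^ (k : ℕ) * -((x - q) ^ 2)⁻¹)
      + (k : ℕ) * x ^ ((k : ℕ) - 1) * (x - q)⁻¹) =
      2 * ((∑ k, a k * x ^ (k : ℕ)) * -((x - q) ^ 2)⁻¹)
        + (∑ k, a k * ((k : ℕ) * x ^ ((k : ℕ) - 1))) * (x - q)⁻¹ := by
    rw [Finset.sum_mul, Finset.mul_sum, Finset.sum_mul, ← Finset.sum_add_distrib]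
    refine Finset.sum_congr rfl fun k _ => ?_
    ring
  have e6 : ∑ k : Fin (2 * D.mInf - 6), a k * (2 * (x ^ (k : ℕ) * -((x - q) ^ 2)⁻¹)
      + (k : ℕ) * x ^ ((k : ℕ) - 1) * (x - q)⁻¹) =
      ∑ k : Fin (2 * D.mInf - 6), a k * ∑ i ∈ Finset.range ((k : ℕ) - 1),
          (2 * (i : ℂ) - (k : ℕ) + 2) * q ^ ((k : ℕ) - i - 2) * x ^ i
      + ∑ k : Fin (2 * D.mInf - 6), a k *
        (-2 * q ^ (k : ℕ) / (x - q) ^ 2 - (k : ℕ) * q ^ ((k : ℕ) - 1) / (x - q) ^ 1) := by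
    rw [← Finset.sum_add_distrib]
    refine Finset.sum_congr rfl fun k _ => ?_
    rw [e4 k]
    ring
  linear_combination e5 - e6 - e4 r

/-! ### The components of the flows -/

lemma p_ne_zero {ξ : D.Ambient} (hξ : ξ ∈ D.X) (I : Fin D.n) : D.p ξ I ≠ 0 := fun h =>
  hξ.2.2.2.1 I (by rw [← hξ.2.2.2.2 I, h]; ring)

lemma dp_eq {ξ : D.Ambient} (hξ : ξ ∈ D.X) (db : D.Base) (dq : Fin D.n → ℂ) (K : Fin D.n) :
    D.dp ξ db dq K = (D.dQ0 ξ.1 db (D.q ξ K) + deriv (D.Q0 ξ.1) (D.q ξ K) * dq K)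
      / (2 * D.p ξ K) := by
  rw [dp, fderiv_Q0_prod (hξ.2.2.1 K)]

lemma tangentVector_mem {ξ : D.Ambient} (hξ : ξ ∈ D.X) (db : D.Base) (dq dv : Fin D.n → ℂ) :
    D.tangentVector ξ db dq dv ∈ D.tangentSpace ξ := by
  rw [mem_tangentSpace hξ]
  intro I
  have h := p_ne_zero hξ I
  change 2 * D.p ξ I * D.dp ξ db dq I = fderiv ℂ _ _ (db, dq I)
  rw [dp]
  field_simp

lemma dQ0_add (b db db' : D.Base) (x : ℂ) :
    D.dQ0 b (db + db') x = D.dQ0 b db x + D.dQ0 b db' x := by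
  simp only [dQ0, aInf, aFin, w, Prod.fst_add, Prod.snd_add, Pi.add_apply, _root_.add_mul,
    _root_.mul_add, add_div, Finset.sum_add_distrib]
  ring

lemma dQ0_smul (b db : D.Base) (z x : ℂ) : D.dQ0 b (z • db) x = z * D.dQ0 b db x := by
  simp only [dQ0, aInf, aFin, w, Prod.smul_fst, Prod.smul_snd, Pi.smul_apply, smul_eq_mul,
    mul_assoc, mul_left_comm _ z, mul_div_assoc, ← Finset.mul_sum]
  ring

@[simp]
lemma dQ0_zero (b : D.Base) (x : ℂ) : D.dQ0 b 0 x = 0 := by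
  simpa using dQ0_smul b 0 0 x

lemma dQ0_sum {ι : Type*} (s : Finset ι) (b : D.Base) (db : ι → D.Base) (z : ι → ℂ) (x : ℂ) :
    D.dQ0 b (∑ i ∈ s, z i • db i) x = ∑ i ∈ s, z i * D.dQ0 b (db i) x := by
  classical
  induction s using Finset.induction_on with
  | empty => simp
  | insert i s hi ih => rw [Finset.sum_insert hi, Finset.sum_insert hi, dQ0_add, dQ0_smul, ih]

/-- The coefficient `D_{IK}` is the derivative of `Q₀` along `U_I` at the fixed point `x = q_K`. -/
lemma Q0Dot_eq (ξ : D.Ambient) (I K : Fin D.n) :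
    D.Q0Dot ξ I K = D.dQ0 ξ.1 (D.UBase ξ I) (D.q ξ K) := by
  simp only [Q0Dot, dQ0]
  congr 1
  · congr 1
    · rw [Finset.sum_filter]
      refine Finset.sum_congr rfl fun i _ => ?_
      simp only [aInf, UBase]
      split_ifs <;> simp
    · refine Finset.sum_congr rfl fun α _ => ?_
      rw [Finset.sum_filter]
      refine Finset.sum_congr rfl fun i _ => ?_
      simp only [aFin, UBase]
      split_ifs <;> simp
  · refine Finset.sum_congr rfl fun α _ => Finset.sum_congr rfl fun i _ => ?_
    have : D.w (D.UBase ξ I) α = 1 / (D.q ξ I - D.w ξ.1 α) := rfl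
    rw [this, mul_one_div, div_div]

lemma U_mem {ξ : D.Ambient} (hξ : ξ ∈ D.X) (a : D.FlowIndex) : D.U a ξ ∈ D.tangentSpace ξ := by
  rcases a with k | I <;> exact tangentVector_mem hξ _ _ _

lemma V_mem {ξ : D.Ambient} (hξ : ξ ∈ D.X) (a : D.FlowIndex) : D.V a ξ ∈ D.tangentSpace ξ := by
  rcases a with k | I <;> exact tangentVector_mem hξ _ _ _

lemma flow_mem {ξ : D.Ambient} (hξ : ξ ∈ D.X) (ħ : ℂ) (a : D.FlowIndex) :
    D.flow ħ a ξ ∈ D.tangentSpace ξ :=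
  add_mem (U_mem hξ a) (Submodule.smul_mem _ _ (V_mem hξ a))

lemma flow_inl_fst (ħ : ℂ) (k : D.LowIndex) (ξ : D.Ambient) :
    (D.flow ħ (Sum.inl k) ξ).1 = D.lowDirection k := by
  simp [flow, U, V, UIso, VIso, tangentVector]

lemma q_flow_inl (ħ : ℂ) (k : D.LowIndex) (ξ : D.Ambient) (I : Fin D.n) :
    D.q (D.flow ħ (Sum.inl k) ξ) I = 0 := by
  simp [flow, U, V, UIso, VIso, tangentVector, q]

/-- `V_i^{(α)}` compensates the motion of the `p_I` under `U_i^{(α)}`. -/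
lemma residue_flow_inl {ξ : D.Ambient} (hξ : ξ ∈ D.X) (ħ : ℂ) (k : D.LowIndex) (I : Fin D.n) :
    D.residue ħ (D.flow ħ (Sum.inl k) ξ) I = 0 := by
  have h : D.dp ξ 0 0 I = 0 := by simp [dp_eq hξ]
  simp only [residue, p, v, flow, U, V, UIso, VIso, tangentVector, Sum.elim_inl, Prod.snd_add,
    Prod.fst_add, Prod.smul_snd, Prod.smul_fst, Pi.add_apply, Pi.smul_apply, h, Pi.zero_apply,
    smul_eq_mul]
  ring

lemma flow_inr_fst (ħ : ℂ) (I : Fin D.n) (ξ : D.Ambient) :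
    (D.flow ħ (Sum.inr I) ξ).1 = D.UBase ξ I := by
  simp [flow, U, V, UApp, VApp, tangentVector]

/-- The flow `L_I` moves its own point by `-2 u`, where `u` is the residue of `Q` at `q_I`. -/
lemma q_flow_inr_self (ħ : ℂ) (I : Fin D.n) (ξ : D.Ambient) :
    D.q (D.flow ħ (Sum.inr I) ξ) I = -2 * D.residue ħ ξ I := by
  simp [flow, U, V, UApp, VApp, tangentVector, q, p, v, residue]
  ring

/-- The flow `L_I` moves the other points by `-A(q_K)`, with `A = 1 / (x - q_I)`. -/
lemma q_flow_inr (ħ : ℂ) {I K : Fin D.n} (h : K ≠ I) (ξ : D.Ambient) :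
    D.q (D.flow ħ (Sum.inr I) ξ) K = -(D.q ξ K - D.q ξ I)⁻¹ := by
  simp [flow, U, V, UApp, VApp, tangentVector, q, h, neg_div]

/-- The residue at `q_K ≠ q_I` moves by `3 A'' / 4 + u A'`, with `A = 1 / (x - q_I)`. The derivative
of `p_K` cancels against the terms of `V_I` that contain `Q₀'` and the derivative of `Q₀`. -/
lemma residue_flow_inr {ħ : ℂ} {ξ : D.Ambient} (hξ : ξ ∈ D.X) {I K : Fin D.n} (h : K ≠ I) :
    D.residue ħ (D.flow ħ (Sum.inr I) ξ) K = 3 / 4 * (2 * ((D.q ξ K - D.q ξ I) ^ 3)⁻¹)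
      + D.residue ħ ξ K * -((D.q ξ K - D.q ξ I) ^ 2)⁻¹ := by
  have hp := p_ne_zero hξ K
  have hq : D.q ξ K - D.q ξ I ≠ 0 := sub_ne_zero.2 fun e => h (hξ.2.1 e)
  have e1 : D.p (D.flow ħ (Sum.inr I) ξ) K = (D.dQ0 ξ.1 (D.UBase ξ I) (D.q ξ K)
      + deriv (D.Q0 ξ.1) (D.q ξ K) * (-1 / (D.q ξ K - D.q ξ I))) / (2 * D.p ξ K) := by
    change D.dp ξ (D.UBase ξ I) _ K + ħ⁻¹ * D.dp ξ 0 _ K = _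
    simp [dp_eq hξ, h]
  have e2 : D.v (D.flow ħ (Sum.inr I) ξ) K =
      (3 / (2 * (D.q ξ K - D.q ξ I) ^ 3) - D.v ξ K / (D.q ξ K - D.q ξ I) ^ 2)
      + ħ⁻¹ * (- D.dQ0 ξ.1 (D.UBase ξ I) (D.q ξ K) / (2 * D.p ξ K)
        + (deriv (D.Q0 ξ.1) (D.q ξ K) / (2 * D.p ξ K * (D.q ξ K - D.q ξ I))
          - D.p ξ K / (D.q ξ K - D.q ξ I) ^ 2)) := by
    simp [flow, U, V, UApp, VApp, tangentVector, v, h, Q0Dot_eq]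
  rw [residue, e1, e2, residue]
  by_cases hħ : ħ = 0
  · simp only [hħ, div_zero, inv_zero, zero_mul]
    field_simp
    ring
  · field_simp
    ring

lemma deriv_H {ħ : ℂ} {ξ : D.Ambient} (hξ : ξ ∈ D.X) (I : Fin D.n) :
    deriv (D.H ħ ξ I) (D.q ξ I) = deriv (D.Q0 ξ.1) (D.q ξ I) / ħ ^ 2
      + (deriv (D.R ξ) (D.q ξ I) / ħ + deriv (D.S ξ) (D.q ξ I))
      + ∑ K ∈ Finset.univ.erase I, (-(3 / (2 * (D.q ξ I - D.q ξ K) ^ 3))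
        - D.residue ħ ξ K / (D.q ξ I - D.q ξ K) ^ 2) := by
  set x := D.q ξ I
  have hw := hξ.2.2.1 I
  have h1 := (analyticAt_Q0_x hw).differentiableAt.hasDerivAt
  have h2 : HasDerivAt (D.R ξ) (deriv (D.R ξ) x) x :=
    (analyticAt_R (f := fun _ => ξ) (x := fun x => x) analyticAt_const analyticAt_id hξ.2.1
      (F_ne_zero hw)).differentiableAt.hasDerivAt
  have h3 : HasDerivAt (D.S ξ) (deriv (D.S ξ) x) x :=
    (analyticAt_S (f := fun _ => ξ) (x := fun x => x) analyticAt_const analyticAt_id hξ.2.1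
      (F_ne_zero hw)).differentiableAt.hasDerivAt
  have h4 : HasDerivAt (D.G ħ ξ) (deriv (D.R ξ) x / ħ + deriv (D.S ξ) x) x :=
    ((h2.div_const ħ).fun_add h3).congr_of_eventuallyEq (Eventually.of_forall (D.G_eq ħ ξ))
  have h5 (K : Fin D.n) (hK : K ∈ Finset.univ.erase I) : HasDerivAt (D.polar ħ ξ K)
      (-(3 / (2 * (x - D.q ξ K) ^ 3)) - D.residue ħ ξ K / (x - D.q ξ K) ^ 2) x := by
    have hne : x - D.q ξ K ≠ 0 :=
      sub_ne_zero.2 fun e => (Finset.ne_of_mem_erase hK) (hξ.2.1 e).symm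
    have h6 : HasDerivAt (fun x => x - D.q ξ K) 1 x := (hasDerivAt_id x).sub_const _
    refine (((hasDerivAt_const x (3 : ℂ)).fun_div ((h6.fun_pow 2).const_mul 4)
      (by simp [hne])).fun_add ((hasDerivAt_const x
        (D.residue ħ ξ K)).fun_div h6 hne)).congr_deriv ?_
    field_simp
    push_cast
    ring
  exact (((h1.div_const _).fun_add h4).fun_add (HasDerivAt.fun_sum h5)).deriv

/-- The residue at `q_I` itself moves by minus the derivative of the regular part of `Q`. -/
lemma residue_flow_inr_self {ħ : ℂ} {ξ : D.Ambient} (hξ : ξ ∈ D.X) (I : Fin D.n) :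
    D.residue ħ (D.flow ħ (Sum.inr I) ξ) I = -deriv (D.H ħ ξ I) (D.q ξ I) := by
  have hp := p_ne_zero hξ I
  have e1 : D.p (D.flow ħ (Sum.inr I) ξ) I = (D.dQ0 ξ.1 (D.UBase ξ I) (D.q ξ I)
      + deriv (D.Q0 ξ.1) (D.q ξ I) * (-2 * D.v ξ I)) / (2 * D.p ξ I)
      + ħ⁻¹ * (deriv (D.Q0 ξ.1) (D.q ξ I) * (-2 * D.p ξ I) / (2 * D.p ξ I)) := by
    change D.dp ξ (D.UBase ξ I) _ I + ħ⁻¹ * D.dp ξ 0 _ I = _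
    simp [dp_eq hξ]
  have e2 : D.v (D.flow ħ (Sum.inr I) ξ) I =
      (∑ J ∈ Finset.univ.erase I, 3 / (2 * (D.q ξ I - D.q ξ J) ^ 3)
          + ∑ J ∈ Finset.univ.erase I, D.v ξ J / (D.q ξ I - D.q ξ J) ^ 2
          - deriv (D.S ξ) (D.q ξ I))
      + ħ⁻¹ * (- D.dQ0 ξ.1 (D.UBase ξ I) (D.q ξ I) / (2 * D.p ξ I)
        + (deriv (D.Q0 ξ.1) (D.q ξ I) * D.v ξ I / D.p ξ I - deriv (D.R ξ) (D.q ξ I)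
          + ∑ J ∈ Finset.univ.erase I, D.p ξ J / (D.q ξ I - D.q ξ J) ^ 2)) := by
    simp [flow, U, V, UApp, VApp, tangentVector, v, Q0Dot_eq]
  have e3 : ∑ K ∈ Finset.univ.erase I, (-(3 / (2 * (D.q ξ I - D.q ξ K) ^ 3))
        - D.residue ħ ξ K / (D.q ξ I - D.q ξ K) ^ 2) =
      -(∑ J ∈ Finset.univ.erase I, 3 / (2 * (D.q ξ I - D.q ξ J) ^ 3)
          + ∑ J ∈ Finset.univ.erase I, D.v ξ J / (D.q ξ I - D.q ξ J) ^ 2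
          + ħ⁻¹ * ∑ J ∈ Finset.univ.erase I, D.p ξ J / (D.q ξ I - D.q ξ J) ^ 2) := by
    rw [Finset.mul_sum, ← Finset.sum_add_distrib, ← Finset.sum_add_distrib,
      ← Finset.sum_neg_distrib]
    refine Finset.sum_congr rfl fun K _ => ?_
    rw [residue]
    ring
  rw [deriv_H hξ, e3, residue, e1, e2]
  by_cases hħ : ħ = 0
  · simp only [hħ, div_zero, inv_zero, zero_mul, ne_eq, OfNat.ofNat_ne_zero, not_false_eq_true,
      zero_pow]
    ring
  · field_simp
    ring

lemma w_lowDirection (k : D.LowIndex) (α : Fin D.N) : D.w (D.lowDirection k) α = 0 := by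
  rcases k with k | k <;> rfl

/-! ### The equations solved by the flows -/

lemma hasLead_dQ0_lowDirection {b : D.Base} (hw : Function.Injective (D.w b)) (k : D.LowIndex)
    (α : Fin D.N) : ∃ a, HasLead (D.dQ0 b (D.lowDirection k)) (D.w b α) (-D.m α) a := by
  obtain ⟨g, hg, h⟩ := exists_dQ0_eq_principal hw (D.lowDirection k) α
  have := D.one_le_m α
  obtain ⟨c, hc⟩ := (HasLead.of_analyticAt hg).exists_of_le (l := -D.m α) (by lia)
  obtain ⟨d, hd⟩ := HasLead.exists_sum (c := D.w b α) (k := -D.m α) Finset.univ (f := fun i x =>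
      D.aFin (D.lowDirection k) α i / (x - D.w b α) ^ ((i : ℕ) + 1)) fun i _ => by
    by_cases hi : (i : ℕ) + 1 ≤ D.m α
    · exact (hasLead_sub_pow (D.w b α) ((i : ℕ) + 1) _).exists_of_le (by push_cast; omega)
    · have : D.aFin (D.lowDirection k) α i = 0 := by
        rcases k with k | ⟨β, j⟩
        · rfl
        · by_cases hβ : α = β
          · subst hβ
            have hij : i ≠ Fin.castLE (by have := j.isLt; omega) j := by
              intro h
              have := congrArg Fin.val h
              have := j.isLt
              simp at *
              omega
            simp [aFin, lowDirection, hij]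
          · simp [aFin, lowDirection, hβ]
      exact ⟨0, by simpa [this] using HasLead.zero⟩
  refine ⟨_, (hd.add hc).congr (Eventually.of_forall fun x => ?_)⟩
  rw [h]
  simp [w_lowDirection]

lemma hasLeadInf_dQ0_lowDirection (b : D.Base) (k : D.LowIndex) :
    ∃ a, HasLeadInf (D.dQ0 b (D.lowDirection k)) (4 - D.mInf) a := by
  obtain ⟨g, ⟨z, hg⟩, h⟩ := exists_dQ0_eq_principal_inf b (D.lowDirection k)
  have := D.three_le_mInf
  obtain ⟨c, hc⟩ := hg.exists_of_le (l := 4 - D.mInf) (by lia)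
  obtain ⟨d, hd⟩ := HasLeadInf.exists_sum (k := 4 - D.mInf) Finset.univ (f := fun i x =>
      D.aInf (D.lowDirection k) i * x ^ (i : ℕ)) fun i _ => by
    by_cases hi : (i : ℕ) < D.mInf - 3
    · exact (hasLeadInf_pow i _).exists_of_le (by omega)
    · have : D.aInf (D.lowDirection k) i = 0 := by
        rcases k with k | k
        · have hij : i ≠ Fin.castLE (by omega) k := by
            intro h
            have := congrArg Fin.val h
            have := k.isLt
            simp at *
            omega
          simp [aInf, lowDirection, hij]
        · rfl
      exact ⟨0, by simpa [this] using HasLeadInf.zero⟩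
  exact ⟨_, (hd.add hc).congr (Eventually.of_forall fun x => h x)⟩

/-- The flows along the low coefficients preserve the potential. -/
lemma dQ_flow_inl {ħ : ℂ} {ξ : D.Ambient} (hξ : ξ ∈ D.X) (k : D.LowIndex) {x : ℂ}
    (hx : D.IsRegularPoint ξ x) : D.dQ ħ ξ (D.flow ħ (Sum.inl k) ξ) x = 0 := by
  have := dQ_eq_fuchs (ħ := ħ) hξ (flow_mem hξ ħ (Sum.inl k)) (A := fun _ => 0)
    (fun x _ => analyticAt_const) (fun α => ⟨analyticAt_const, by
      rw [flow_inl_fst, w_lowDirection, neg_zero]⟩) HasLeadInf.zero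
    (fun α => by simpa [flow_inl_fst] using hasLead_dQ0_lowDirection hξ.1.1 k α)
    (by simpa [flow_inl_fst] using hasLeadInf_dQ0_lowDirection ξ.1 k)
    (fun J => Or.inl ⟨analyticAt_const, by simp [q_flow_inl], by
      simp [residue_flow_inl hξ]⟩) hx
  rw [this, fuchs]
  simp

/-- The flow `L_I` solves the equation with `A = 1 / (x - q_I)`. -/
lemma dQ_flow_inr {ħ : ℂ} {ξ : D.Ambient} (hξ : ξ ∈ D.X) (I : Fin D.n) {x : ℂ}
    (hx : D.IsRegularPoint ξ x) : D.dQ ħ ξ (D.flow ħ (Sum.inr I) ξ) x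
      = fuchs (D.Q ħ ξ) (fun x => (x - D.q ξ I)⁻¹) x := by
  have hA (x : ℂ) (h : x ≠ D.q ξ I) : AnalyticAt ℂ (fun x => (x - D.q ξ I)⁻¹) x := by
    have := sub_ne_zero.2 h
    fun_prop (disch := exact this)
  refine dQ_eq_fuchs (ħ := ħ) hξ (flow_mem hξ ħ (Sum.inr I)) (fun x hx => hA x (hx.2 I))
    (fun α => ⟨hA _ (hξ.2.2.1 I α).symm, ?_⟩) (HasLeadInf.inv_sub_const _)
    (fun α => ?_) ?_ (fun J => ?_) hx
  · rw [flow_inr_fst]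
    change _ = -(1 / (D.q ξ I - D.w ξ.1 α))
    rw [one_div, ← inv_neg, neg_sub]
  · rw [flow_inr_fst]
    exact hasLead_dQ0_UBase hξ I α
  · rw [flow_inr_fst]
    exact hasLeadInf_dQ0_UBase I
  · by_cases h : J = I
    · subst h
      exact Or.inr ⟨fun x => rfl, q_flow_inr_self ħ J ξ, residue_flow_inr_self hξ J⟩
    · have hne : D.q ξ J ≠ D.q ξ I := fun e => h (hξ.2.1 e)
      refine Or.inl ⟨hA _ hne, q_flow_inr ħ h ξ, ?_⟩
      rw [deriv_deriv_inv_sub (sub_ne_zero.2 hne), deriv_inv_sub (sub_ne_zero.2 hne),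
        residue_flow_inr hξ h]

lemma solvesFuchs_iff {ħ : ℂ} {A : D.Ambient → ℂ → ℂ} {L : D.Ambient → D.Ambient} :
    D.SolvesFuchs ħ A L ↔ ∀ ξ ∈ D.X, ∀ x, D.IsRegularPoint ξ x →
      D.dQ ħ ξ (L ξ) x = fuchs (D.Q ħ ξ) (A ξ) x := by
  have h (f : ℂ → ℂ) : iteratedDeriv 3 f = deriv (deriv (deriv f)) := by
    rw [iteratedDeriv_succ, iteratedDeriv_succ, iteratedDeriv_one]
  refine forall₄_congr fun ξ _ x _ => ?_
  rw [fuchs, h]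
  constructor <;> intro e
  · linear_combination (-1 / 2) * e
  · linear_combination (-2) * e

lemma lowComponent_UBase (ξ : D.Ambient) (I : Fin D.n) (k : D.LowIndex) :
    D.lowComponent (D.UBase ξ I) k = 0 := by
  rcases k with k | ⟨α, i⟩
  · have := k.isLt
    simp [lowComponent, aInf, UBase]
    omega
  · have := i.isLt
    simp [lowComponent, aFin, UBase]

end
end PoleData

namespace PoleData

variable {D : PoleData}

/-! ### Functions meromorphic on the sphere -/

namespace MeromorphicOnSphere

variable {f g : ℂ → ℂ}

lemma sub (hf : MeromorphicOnSphere f) (hg : MeromorphicOnSphere g) :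
    MeromorphicOnSphere fun x => f x - g x :=
  ⟨fun x => (hf.1 x).sub (hg.1 x), hf.2.sub hg.2⟩

lemma mul (hf : MeromorphicOnSphere f) (hg : MeromorphicOnSphere g) :
    MeromorphicOnSphere fun x => f x * g x :=
  ⟨fun x => (hf.1 x).mul (hg.1 x), hf.2.mul hg.2⟩

lemma const (z : ℂ) : MeromorphicOnSphere fun _ => z :=
  ⟨fun x => MeromorphicAt.const z x, MeromorphicAt.const z 0⟩

lemma deriv (hf : MeromorphicOnSphere f) : MeromorphicOnSphere (deriv f) := by
  refine ⟨fun x => (hf.1 x).deriv, ?_⟩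
  obtain ⟨k, a, h⟩ := hf.2.exists_order_hasLead
  exact HasLead.meromorphicAt (HasLeadInf.deriv h)

end MeromorphicOnSphere

noncomputable section

lemma meromorphicOnSphere_inv_sub (c : ℂ) : MeromorphicOnSphere fun x => (x - c)⁻¹ :=
  ⟨fun x => ((MeromorphicAt.id x).sub (MeromorphicAt.const c x)).inv,
    HasLead.meromorphicAt (HasLeadInf.inv_sub_const c)⟩

lemma meromorphicAt_Q_w {ħ : ℂ} {ξ : D.Ambient} (hξ : ξ ∈ D.X) (α : Fin D.N) :
    MeromorphicAt (D.Q ħ ξ) (D.w ξ.1 α) := by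
  obtain ⟨b, hb⟩ := hasLead_G hξ ħ α
  have h := (((hasLead_Q0 hξ.1.1 α).const_mul (ħ ^ 2)⁻¹).meromorphicAt.add
    hb.meromorphicAt).add (analyticAt_polar_w (ħ := ħ) hξ α).meromorphicAt
  refine h.congr (Eventually.of_forall fun x => ?_)
  simp only [Pi.add_apply, Q_eq]
  ring

lemma meromorphicOnSphere_Q {ħ : ℂ} {ξ : D.Ambient} (hξ : ξ ∈ D.X) :
    MeromorphicOnSphere (D.Q ħ ξ) := by
  refine ⟨fun x => ?_, HasLead.meromorphicAt (hasLeadInf_Q ξ)⟩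
  by_cases hx : D.IsRegularPoint ξ x
  · exact (analyticAt_Q_x hξ hx).meromorphicAt
  · rw [← notMem_poles, not_not] at hx
    rcases hx with ⟨α, rfl⟩ | ⟨I, rfl⟩
    · exact meromorphicAt_Q_w hξ α
    · exact (hasLead_Q_node hξ I).meromorphicAt

/-! ### Isomonodromy -/

/-- Flatness of the connection follows from the equation `∂_t Q = 2 Q A' + Q' A - A''' / 2`: the
matrix `B` with upper right entry `A` and vanishing trace is determined by `A`. -/
lemma isIsomonodromic_of_dQ_eq {ħ : ℂ} {L : D.Ambient → D.Ambient} {A : D.Ambient → ℂ → ℂ}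
    (hA : ∀ ξ, MeromorphicOnSphere (A ξ))
    (hA' : ∀ ξ ∈ D.X, ∀ x, D.IsRegularPoint ξ x →
      AnalyticAt ℂ (fun z : D.Ambient × ℂ => A z.1 z.2) (ξ, x))
    (h : ∀ ξ ∈ D.X, ∀ x, D.IsRegularPoint ξ x →
      D.dQ ħ ξ (L ξ) x = fuchs (D.Q ħ ξ) (A ξ) x) : D.IsIsomonodromic ħ L := by
  -- flatness and `tr B = 0` force the diagonal of `B`, then its lower left entry
  refine ⟨fun ξ x => !![-(1 / 2) * deriv (A ξ) x, A ξ x;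
    D.Q ħ ξ x * A ξ x - 1 / 2 * deriv (deriv (A ξ)) x, 1 / 2 * deriv (A ξ) x],
    fun _ => ∅, fun ξ hξ i j => ⟨?_, fun x _ hx => ?_⟩⟩
  · have h1 := (hA ξ).deriv
    have h2 := h1.deriv
    have h3 := (meromorphicOnSphere_Q (ħ := ħ) hξ).mul (hA ξ)
    fin_cases i <;> fin_cases j
    · exact (MeromorphicOnSphere.const _).mul h1
    · exact hA ξ
    · exact h3.sub ((MeromorphicOnSphere.const _).mul h2)
    · exact (MeromorphicOnSphere.const _).mul h1
  · have hQ : AnalyticAt ℂ (fun z : D.Ambient × ℂ => D.Q ħ z.1 z.2) (ξ, x) :=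
      analyticAt_Q ħ (f := Prod.fst) (x := Prod.snd) analyticAt_fst analyticAt_snd hξ.2.1 hx
    have h0 := hA' ξ hξ x hx
    have h1 := h0.deriv_snd
    have h2 := h1.deriv_snd
    have a0 := h0.curry_right'
    have a1 := h1.curry_right'
    have a2 := h2.curry_right'
    have aQ := hQ.curry_right'
    constructor
    · apply AnalyticAt.analyticWithinAt
      fin_cases i <;> fin_cases j
      · exact analyticAt_const.mul h1
      · exact h0
      · exact (hQ.mul h0).sub (analyticAt_const.mul h2)
      · exact analyticAt_const.mul h1
    · have e := h ξ hξ x hx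
      have d1 := a1.differentiableAt.hasDerivAt.const_mul (1 / 2 : ℂ)
      have d1' := a1.differentiableAt.hasDerivAt.const_mul (-(1 / 2) : ℂ)
      have d2 := (aQ.differentiableAt.hasDerivAt.fun_mul a0.differentiableAt.hasDerivAt).fun_sub
        (a2.differentiableAt.hasDerivAt.const_mul (1 / 2 : ℂ))
      fin_cases i <;> fin_cases j
      · simp [potentialMatrix]
        ring
      · simp [potentialMatrix]
        ring
      · have e1 : deriv (fun y => D.Q ħ ξ y * A ξ y - 1 / 2 * deriv (deriv (A ξ)) y) x = _ :=
          d2.deriv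
        rw [dQ, fuchs] at e
        simp only [potentialMatrix, Matrix.mul_apply, Fin.sum_univ_two, Matrix.sub_apply]
        simp
        simp at e1
        rw [e1, e]
        ring
      · simp [potentialMatrix]

lemma isIsomonodromic_flow (ħ : ℂ) (a : D.FlowIndex) : D.IsIsomonodromic ħ (D.flow ħ a) := by
  rcases a with k | I
  · refine isIsomonodromic_of_dQ_eq (A := fun _ _ => 0) (fun _ => MeromorphicOnSphere.const 0)
      (fun _ _ _ _ => analyticAt_const) fun ξ hξ x hx => ?_
    rw [dQ_flow_inl hξ k hx, fuchs]
    simp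
  · refine isIsomonodromic_of_dQ_eq (A := fun ξ x => (x - D.q ξ I)⁻¹)
      (fun _ => meromorphicOnSphere_inv_sub _) (fun ξ hξ x hx => ?_)
      fun ξ hξ x hx => dQ_flow_inr hξ I hx
    have := sub_ne_zero.2 (hx.2 I)
    fun_prop (disch := exact this)

/-! ### Holomorphy of the vector fields -/

section Analytic

variable {E : Type*} [NormedAddCommGroup E] [NormedSpace ℂ E] {e : E} {f : E → D.Ambient}

lemma analyticAt_dp (hf : AnalyticAt ℂ f e) (hξ : f e ∈ D.X) {db : E → D.Base}
    {dq : E → Fin D.n → ℂ} (hdb : AnalyticAt ℂ db e) (hdq : AnalyticAt ℂ dq e) (K : Fin D.n) :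
    AnalyticAt ℂ (fun e => D.dp (f e) (db e) (dq e) K) e := by
  have h1 : AnalyticAt ℂ (fun z : D.Base × ℂ => D.Q0 z.1 z.2) ((f e).1, D.q (f e) K) :=
    analyticAt_Q0 analyticAt_fst analyticAt_snd (hξ.2.2.1 K)
  have h2 : AnalyticAt ℂ (fun e => ((f e).1, D.q (f e) K)) e :=
    hf.comp_fst.prod (analyticAt_q hf K)
  have h3 := AnalyticAt.fun_comp (f := fun e => ((f e).1, D.q (f e) K)) h1.fderiv h2
  have h4 : AnalyticAt ℂ (fun e => (db e, dq e K)) e := hdb.prod (analyticAt_pi_iff.1 hdq K)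
  have h5 := AnalyticAt.fun_comp (f := fun e => (fderiv ℂ (fun z : D.Base × ℂ => D.Q0 z.1 z.2)
    ((f e).1, D.q (f e) K), (db e, dq e K)))
    ((ContinuousLinearMap.id ℂ (D.Base × ℂ →L[ℂ] ℂ)).analyticAt_bilinear _) (h3.prod h4)
  have h6 : (2 * D.p (f e) K) ≠ 0 := mul_ne_zero two_ne_zero (p_ne_zero hξ K)
  exact h5.div (by fun_prop) h6

lemma analyticAt_tangentVector (hf : AnalyticAt ℂ f e) (hξ : f e ∈ D.X) {db : E → D.Base}
    {dq dv : E → Fin D.n → ℂ} (hdb : AnalyticAt ℂ db e) (hdq : ∀ K, AnalyticAt ℂ (dq · K) e)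
    (hdv : ∀ K, AnalyticAt ℂ (dv · K) e) :
    AnalyticAt ℂ (fun e => D.tangentVector (f e) (db e) (dq e) (dv e)) e :=
  hdb.prod ((analyticAt_pi_iff.2 hdq).prod ((analyticAt_pi_iff.2 fun K =>
    analyticAt_dp hf hξ hdb (analyticAt_pi_iff.2 hdq) K).prod (analyticAt_pi_iff.2 hdv)))

lemma analyticAt_TInf (hf : AnalyticAt ℂ f e) (i) (I : Fin D.n) :
    AnalyticAt ℂ (fun e => D.TInf (f e).1 i (D.q (f e) I)) e := by
  have := hf.comp_fst
  unfold TInf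
  fun_prop

lemma analyticAt_TFin (hf : AnalyticAt ℂ f e) (hξ : f e ∈ D.X) (α i) (I : Fin D.n) :
    AnalyticAt ℂ (fun e => D.TFin (f e).1 α i (D.q (f e) I - D.w (f e).1 α)) e := by
  have := hf.comp_fst
  have h := sub_ne_zero.2 (hξ.2.2.1 I α)
  unfold TFin
  fun_prop (disch := exact pow_ne_zero _ h)

lemma analyticAt_UBase (hf : AnalyticAt ℂ f e) (hξ : f e ∈ D.X) (I : Fin D.n) :
    AnalyticAt ℂ (fun e => D.UBase (f e) I) e := by
  have h1 := hf.comp_fst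
  refine AnalyticAt.prod (analyticAt_pi_iff.2 fun i => ?_)
    (AnalyticAt.prod (analyticAt_pi_iff.2 fun α => analyticAt_pi_iff.2 fun i => ?_)
      (analyticAt_pi_iff.2 fun α => ?_))
  · split_ifs
    · exact analyticAt_TInf hf i I
    · exact analyticAt_const
  · split_ifs
    · exact analyticAt_TFin hf hξ α i I
    · exact analyticAt_const
  · have h := sub_ne_zero.2 (hξ.2.2.1 I α)
    fun_prop (disch := exact h)

lemma analyticAt_Q0Dot (hf : AnalyticAt ℂ f e) (hξ : f e ∈ D.X) (I K : Fin D.n) :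
    AnalyticAt ℂ (fun e => D.Q0Dot (f e) I K) e := by
  have h1 := hf.comp_fst
  have h (α) (I) := sub_ne_zero.2 (hξ.2.2.1 I α)
  have h2 (i) := analyticAt_TInf hf i I
  have h3 (α) (i) := analyticAt_TFin hf hξ α i I
  unfold Q0Dot
  fun_prop (disch := simp [h])

lemma analyticAt_deriv_Q0 (hf : AnalyticAt ℂ f e) (hξ : f e ∈ D.X) (I : Fin D.n) :
    AnalyticAt ℂ (fun e => deriv (D.Q0 (f e).1) (D.q (f e) I)) e := by
  have h1 : AnalyticAt ℂ (fun z : D.Base × ℂ => D.Q0 z.1 z.2) ((f e).1, D.q (f e) I) :=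
    analyticAt_Q0 analyticAt_fst analyticAt_snd (hξ.2.2.1 I)
  exact AnalyticAt.fun_comp (f := fun e => ((f e).1, D.q (f e) I)) h1.deriv_snd
    (hf.comp_fst.prod (analyticAt_q hf I))

lemma analyticAt_deriv_R (hf : AnalyticAt ℂ f e) (hξ : f e ∈ D.X) (I : Fin D.n) :
    AnalyticAt ℂ (fun e => deriv (D.R (f e)) (D.q (f e) I)) e := by
  have h1 : AnalyticAt ℂ (fun z : D.Ambient × ℂ => D.R z.1 z.2) (f e, D.q (f e) I) :=
    analyticAt_R analyticAt_fst analyticAt_snd hξ.2.1 (F_ne_zero (hξ.2.2.1 I))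
  exact AnalyticAt.fun_comp (f := fun e => (f e, D.q (f e) I)) h1.deriv_snd
    (hf.prod (analyticAt_q hf I))

lemma analyticAt_deriv_S (hf : AnalyticAt ℂ f e) (hξ : f e ∈ D.X) (I : Fin D.n) :
    AnalyticAt ℂ (fun e => deriv (D.S (f e)) (D.q (f e) I)) e := by
  have h1 : AnalyticAt ℂ (fun z : D.Ambient × ℂ => D.S z.1 z.2) (f e, D.q (f e) I) :=
    analyticAt_S analyticAt_fst analyticAt_snd hξ.2.1 (F_ne_zero (hξ.2.2.1 I))
  exact AnalyticAt.fun_comp (f := fun e => (f e, D.q (f e) I)) h1.deriv_snd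
    (hf.prod (analyticAt_q hf I))

end Analytic

lemma analyticAt_UApp {ξ : D.Ambient} (hξ : ξ ∈ D.X) (I : Fin D.n) :
    AnalyticAt ℂ (D.UApp I) ξ := by
  have hid : AnalyticAt ℂ (fun ξ : D.Ambient => ξ) ξ := analyticAt_id
  have hS := analyticAt_deriv_S hid hξ I
  refine analyticAt_tangentVector hid hξ (analyticAt_UBase hid hξ I) (fun K => ?_) fun K => ?_
  · by_cases h : K = I
    · simp only [h, if_true]
      fun_prop
    · have hne := sub_ne_zero.2 fun e => h (hξ.2.1 e)
      simp only [h, if_false]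
      fun_prop (disch := exact hne)
  · by_cases h : K = I
    · have h1 := analyticAt_sum_div hid hξ.2.1 I 3 (g := fun _ _ => 3) (fun _ => analyticAt_const)
        2 two_ne_zero
      have h2 := analyticAt_sum_div hid hξ.2.1 I 2 (g := fun J ξ => D.v ξ J) (fun J => by fun_prop)
        1 one_ne_zero
      simp only [one_mul] at h2
      simp only [h, if_true]
      exact (h1.add h2).sub hS
    · have hne := sub_ne_zero.2 fun e => h (hξ.2.1 e)
      simp only [h, if_false]
      fun_prop (disch := simp [hne])

lemma analyticAt_VApp {ξ : D.Ambient} (hξ : ξ ∈ D.X) (I : Fin D.n) :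
    AnalyticAt ℂ (D.VApp I) ξ := by
  have hid : AnalyticAt ℂ (fun ξ : D.Ambient => ξ) ξ := analyticAt_id
  have hR := analyticAt_deriv_R hid hξ I
  have hp := p_ne_zero hξ
  refine analyticAt_tangentVector hid hξ analyticAt_const (fun K => ?_) fun K => ?_
  · by_cases h : K = I
    · simp only [h, if_true]
      fun_prop
    · simp only [h, if_false]
      exact analyticAt_const
  · have hD := analyticAt_Q0Dot hid hξ I K
    have h0 := analyticAt_deriv_Q0 hid hξ K
    have h3 : AnalyticAt ℂ (fun ξ : D.Ambient => -D.Q0Dot ξ I K / (2 * D.p ξ K)) ξ := by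
      fun_prop (disch := simp [hp])
    by_cases h : K = I
    · subst h
      have h2 := analyticAt_sum_div hid hξ.2.1 K 2 (g := fun J ξ => D.p ξ J) (fun J => by fun_prop)
        1 one_ne_zero
      simp only [one_mul] at h2
      simp only [if_true]
      have h4 : AnalyticAt ℂ (fun ξ : D.Ambient => deriv (D.Q0 ξ.1) (D.q ξ K) * D.v ξ K / D.p ξ K)
          ξ := by
        fun_prop (disch := simp [hp])
      exact h3.add ((h4.sub hR).add h2)
    · have hne := sub_ne_zero.2 fun e => h (hξ.2.1 e)
      simp only [h, if_false]
      refine h3.add ?_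
      fun_prop (disch := simp [hne, hp])

lemma analyticAt_U {ξ : D.Ambient} (hξ : ξ ∈ D.X) (a : D.FlowIndex) : AnalyticAt ℂ (D.U a) ξ := by
  have hid : AnalyticAt ℂ (fun ξ : D.Ambient => ξ) ξ := analyticAt_id
  rcases a with k | I
  · exact analyticAt_tangentVector hid hξ analyticAt_const (fun _ => analyticAt_const)
      fun _ => analyticAt_const
  · exact analyticAt_UApp hξ I

lemma analyticAt_V {ξ : D.Ambient} (hξ : ξ ∈ D.X) (a : D.FlowIndex) : AnalyticAt ℂ (D.V a) ξ := by
  have hid : AnalyticAt ℂ (fun ξ : D.Ambient => ξ) ξ := analyticAt_id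
  rcases a with k | I
  · exact analyticAt_tangentVector hid hξ analyticAt_const (fun _ => analyticAt_const)
      fun K => (analyticAt_dp hid hξ analyticAt_const analyticAt_const K).neg
  · exact analyticAt_VApp hξ I

lemma analyticAt_flow {ξ : D.Ambient} (hξ : ξ ∈ D.X) (ħ : ℂ) (a : D.FlowIndex) :
    AnalyticAt ℂ (D.flow ħ a) ξ :=
  (analyticAt_U hξ a).add ((analyticAt_V hξ a).const_smul (c := ħ⁻¹))

lemma isVectorField_U (a : D.FlowIndex) : D.IsVectorField (D.U a) :=
  ⟨fun _ hξ => (analyticAt_U hξ a).analyticWithinAt, fun _ hξ => U_mem hξ a⟩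

lemma isVectorField_V (a : D.FlowIndex) : D.IsVectorField (D.V a) :=
  ⟨fun _ hξ => (analyticAt_V hξ a).analyticWithinAt, fun _ hξ => V_mem hξ a⟩

lemma isVectorField_flow (ħ : ℂ) (a : D.FlowIndex) : D.IsVectorField (D.flow ħ a) :=
  ⟨fun _ hξ => (analyticAt_flow hξ ħ a).analyticWithinAt, fun _ hξ => flow_mem hξ ħ a⟩

/-! ### Dimensions -/

lemma card_lowIndex (D : PoleData) : Fintype.card D.LowIndex = D.n := by
  simp [n]

lemma card_flowIndex (D : PoleData) : Fintype.card D.FlowIndex = 2 * D.n := by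
  rw [Fintype.card_sum, card_lowIndex, Fintype.card_fin]
  ring

lemma finrank_base (D : PoleData) : Module.finrank ℂ D.Base = 2 * D.n := by
  have h : ∑ α, (2 * D.m α - 1) + D.N = 2 * ∑ α, D.m α := by
    calc _ = ∑ α, (2 * D.m α - 1) + ∑ _α : Fin D.N, 1 := by simp
      _ = _ := ?_
    rw [Finset.mul_sum, ← Finset.sum_add_distrib]
    refine Finset.sum_congr rfl fun α _ => ?_
    have := D.one_le_m α
    omega
  have hm := D.three_le_mInf
  rw [Module.finrank_prod, Module.finrank_prod, Module.finrank_pi, Module.finrank_pi_fintype,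
    Module.finrank_pi]
  simp only [Module.finrank_pi, Fintype.card_fin, n]
  omega

/-- `(a, w, q, v)` are coordinates on `X`: a tangent vector is determined by its components along
them, which are arbitrary. -/
lemma finrank_tangentSpace {ξ : D.Ambient} (hξ : ξ ∈ D.X) :
    Module.finrank ℂ (D.tangentSpace ξ) = 4 * D.n := by
  let f : D.Ambient →ₗ[ℂ] D.Base × (Fin D.n → ℂ) × (Fin D.n → ℂ) :=
    (LinearMap.fst ℂ _ _).prod (((LinearMap.fst ℂ _ _).comp (LinearMap.snd ℂ _ _)).prod
      ((LinearMap.snd ℂ _ _).comp ((LinearMap.snd ℂ _ _).comp (LinearMap.snd ℂ _ _))))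
  have hf : Function.Bijective (f.domRestrict (D.tangentSpace ξ)) := by
    constructor
    · rw [← LinearMap.ker_eq_bot, LinearMap.ker_eq_bot']
      rintro ⟨t, ht⟩ h
      have h1 : t.1 = 0 := congrArg (fun z => z.1) h
      have h2 : t.2.1 = 0 := congrArg (fun z => z.2.1) h
      have h3 : t.2.2.2 = 0 := congrArg (fun z => z.2.2) h
      have h4 : t.2.2.1 = 0 := by
        ext I
        have := (mem_tangentSpace hξ).1 ht I
        have h5 : D.q t I = 0 := congrFun h2 I
        rw [h1, h5, fderiv_Q0_prod (hξ.2.2.1 I)] at this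
        have h6 : D.p t I = 0 := by simpa [p_ne_zero hξ I] using this
        exact h6
      exact Subtype.ext (Prod.ext h1 (Prod.ext h2 (Prod.ext h4 h3)))
    · intro z
      exact ⟨⟨D.tangentVector ξ z.1 z.2.1 z.2.2, tangentVector_mem hξ _ _ _⟩, rfl⟩
  rw [(LinearEquiv.ofBijective _ hf).finrank_eq, Module.finrank_prod (M := D.Base), finrank_base,
    Module.finrank_prod, Module.finrank_pi, Fintype.card_fin]
  ring

/-! ### Linear independence -/

/-- The component at a low coefficient as a linear form. -/
def lowForm (k : D.LowIndex) : D.Base →ₗ[ℂ] ℂ where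
  toFun db := D.lowComponent db k
  map_add' _ _ := by rcases k with k | k <;> rfl
  map_smul' _ _ := by rcases k with k | k <;> rfl

lemma lowForm_apply (k : D.LowIndex) (db : D.Base) : lowForm k db = D.lowComponent db k := rfl

lemma lowComponent_lowDirection (k l : D.LowIndex) :
    D.lowComponent (D.lowDirection k) l = if k = l then 1 else 0 := by
  rcases k with k | ⟨α, i⟩ <;> rcases l with l | ⟨β, j⟩
  · simp [lowComponent, lowDirection, aInf, Pi.single_apply, Fin.ext_iff, eq_comm]
  · simp [lowComponent, lowDirection, aFin]
  · simp [lowComponent, lowDirection, aInf]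
  · by_cases h : α = β
    · subst h
      simp [lowComponent, lowDirection, aFin, Pi.single_apply, Fin.ext_iff, eq_comm]
    · simp [lowComponent, lowDirection, aFin, h, Ne.symm h]

lemma lowForm_sum_lowDirection (z : D.LowIndex → ℂ) (l : D.LowIndex) :
    lowForm l (∑ k, z k • D.lowDirection k) = z l := by
  rw [map_sum, Finset.sum_eq_single l (fun k _ h => by simp [lowForm_apply,
    lowComponent_lowDirection, h]) (by simp)]
  simp [lowForm_apply, lowComponent_lowDirection]

/-- If a derivative of `Q₀` in a direction that fixes `w_α` has a pole of order at most `-k` there,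
then this direction has no component along `a_i^{(α)}` for `i > -k`. -/
lemma aFin_eq_zero_of_hasLead {b db : D.Base} (hw : Function.Injective (D.w b)) {α : Fin D.N}
    (h0 : D.w db α = 0) {k : ℤ} (hk : k ≤ 0) {a : ℂ} (h : HasLead (D.dQ0 b db) (D.w b α) k a)
    (i : Fin (2 * D.m α - 1)) (hi : -((i : ℤ) + 1) < k) : D.aFin db α i = 0 := by
  obtain ⟨g, hg, hQ⟩ := exists_dQ0_eq_principal hw db α
  obtain ⟨c, hc⟩ := (HasLead.of_analyticAt hg).exists_of_le hk
  refine HasLead.coeff_eq_zero Finset.univ (D.aFin db α)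
    (fun i : Fin (2 * D.m α - 1) => -((i : ℤ) + 1)) (fun i _ j _ h => ?_) ((h.sub hc).congr
    (Eventually.of_forall fun x => ?_)) i (Finset.mem_univ i) hi
  · apply Fin.ext
    simp only at h
    omega
  · rw [hQ]
    simp only [h0, mul_zero, zero_div, Finset.sum_const_zero, add_zero, add_sub_cancel_right]
    refine Finset.sum_congr rfl fun i _ => ?_
    rw [zpow_neg, div_eq_mul_inv]
    norm_cast

lemma aInf_eq_zero_of_hasLeadInf {b db : D.Base} {k : ℤ} (hk : k ≤ 1) {a : ℂ}
    (h : HasLeadInf (D.dQ0 b db) k a) (i : Fin (2 * D.mInf - 6)) (hi : -(i : ℤ) < k) :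
    D.aInf db i = 0 := by
  obtain ⟨g, ⟨z, hg⟩, hQ⟩ := exists_dQ0_eq_principal_inf b db
  obtain ⟨c, hc⟩ := hg.exists_of_le hk
  refine HasLeadInf.coeff_eq_zero Finset.univ (D.aInf db)
    (fun i : Fin (2 * D.mInf - 6) => (i : ℕ)) (fun i _ j _ h => Fin.ext h) ((h.sub hc).congr
    (Eventually.of_forall fun x => ?_)) i (Finset.mem_univ i) hi
  rw [hQ]
  ring

/-- `∑ c_J / (x - q_J)`. -/
def poleSum (ξ : D.Ambient) (c : Fin D.n → ℂ) (x : ℂ) : ℂ := ∑ J, c J * (x - D.q ξ J)⁻¹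

lemma analyticAt_poleSum {ξ : D.Ambient} (c : Fin D.n → ℂ) {x : ℂ} (h : ∀ J, x ≠ D.q ξ J) :
    AnalyticAt ℂ (D.poleSum ξ c) x := by
  have this (J) := sub_ne_zero.2 (h J)
  unfold poleSum
  fun_prop (disch := simp [this])

lemma hasLead_poleSum {ξ : D.Ambient} (hq : Function.Injective (D.q ξ)) (c : Fin D.n → ℂ)
    (J : Fin D.n) : HasLead (D.poleSum ξ c) (D.q ξ J) (-1) (c J) := by
  have h1 : AnalyticAt ℂ (fun x => ∑ K ∈ Finset.univ.erase J, c K * (x - D.q ξ K)⁻¹) (D.q ξ J) := by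
    refine Finset.analyticAt_fun_sum _ fun K hK => ?_
    have := sub_ne_zero.2 fun e => (Finset.ne_of_mem_erase hK) (hq e).symm
    fun_prop (disch := exact this)
  have h2 := ((hasLead_sub_pow (D.q ξ J) 1 (c J)).congr_order (l := -1) (by simp)).add
    ((HasLead.of_analyticAt h1).weaken (l := -1) (by norm_num))
  refine (h2.congr (Eventually.of_forall fun x => ?_)).congr_coeff (by ring)
  rw [poleSum, ← Finset.add_sum_erase _ _ (Finset.mem_univ J), pow_one, div_eq_mul_inv]

lemma hasLeadInf_poleSum (ξ : D.Ambient) (c : Fin D.n → ℂ) :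
    HasLeadInf (D.poleSum ξ c) 1 (∑ J, c J) :=
  (HasLeadInf.sum Finset.univ fun J _ =>
    (HasLeadInf.inv_sub_const (D.q ξ J)).const_mul (c J)).congr_coeff (by simp)

lemma meromorphicOnSphere_poleSum {ξ : D.Ambient} (hq : Function.Injective (D.q ξ))
    (c : Fin D.n → ℂ) : MeromorphicOnSphere (D.poleSum ξ c) := by
  refine ⟨fun x => ?_, (hasLeadInf_poleSum ξ c).meromorphicAt⟩
  by_cases h : ∃ J, x = D.q ξ J
  · obtain ⟨J, rfl⟩ := h
    exact (hasLead_poleSum hq c J).meromorphicAt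
  · exact (analyticAt_poleSum c (by simpa using h)).meromorphicAt

lemma deriv_poleSum {ξ : D.Ambient} (c : Fin D.n → ℂ) {x : ℂ} (h : ∀ J, x ≠ D.q ξ J) :
    deriv (D.poleSum ξ c) x = ∑ J, c J * deriv (fun x => (x - D.q ξ J)⁻¹) x := by
  refine (HasDerivAt.fun_sum fun J _ => ?_).deriv
  have := sub_ne_zero.2 (h J)
  have h1 : AnalyticAt ℂ (fun x => (x - D.q ξ J)⁻¹) x := by fun_prop (disch := exact this)
  exact h1.differentiableAt.hasDerivAt.const_mul (c J)

/-- The components of `U_1, …, U_n` along the parameters of `Q₀` are linearly independent: for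
`A = ∑ c_I / (x - q_I)` a relation makes `2 Q₀ A' + Q₀' A`, and hence `A`, vanish to high order at
all poles of `Q₀`, which leaves no room for `n` poles of `A`. -/
lemma eq_zero_of_sum_UBase {ξ : D.Ambient} (hξ : ξ ∈ D.X) {c : Fin D.n → ℂ}
    (h : ∑ I, c I • D.UBase ξ I = 0) : c = 0 := by
  have hm := D.three_le_mInf
  have hn := D.n_eq
  set A := D.poleSum ξ c with hA
  have hAm := meromorphicOnSphere_poleSum hξ.2.1 c
  have key : ∀ x, D.IsRegularPoint ξ x →
      ∑ I, c I * (D.dQ0 ξ.1 (D.UBase ξ I) x - (2 * (D.Q0 ξ.1 x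
        * deriv (fun x => (x - D.q ξ I)⁻¹) x) + deriv (D.Q0 ξ.1) x * (x - D.q ξ I)⁻¹))
      = -(2 * (D.Q0 ξ.1 x * deriv A x) + deriv (D.Q0 ξ.1) x * A x) := by
    intro x hx
    have h1 := dQ0_sum Finset.univ ξ.1 (D.UBase ξ) c x
    rw [h, dQ0_zero] at h1
    rw [hA, deriv_poleSum c hx.2, poleSum]
    simp only [mul_sub, Finset.sum_sub_distrib, ← h1, Finset.mul_sum, mul_add,
      Finset.sum_add_distrib]
    rw [zero_sub]
    congr 1
    congr 1 <;> exact Finset.sum_congr rfl fun I _ => by ring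
  have hw (α : Fin D.N) : ∃ a, HasLead A (D.w ξ.1 α) (D.m α) a := by
    obtain ⟨b, hb⟩ := HasLead.exists_sum Finset.univ fun I _ =>
      let ⟨d, hd⟩ := hasLead_dQ0_UBase hξ I α; ⟨_, hd.const_mul (c I)⟩
    have h2 : ∃ b, HasLead (fun x => 2 * (D.Q0 ξ.1 x * deriv A x) + deriv (D.Q0 ξ.1) x * A x
        + 0 * deriv (deriv (deriv A)) x) (D.w ξ.1 α) (-D.m α) b := by
      refine ⟨_, hb.neg.congr ?_⟩
      filter_upwards [eventually_isRegularPoint ξ (D.w ξ.1 α)] with x hx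
      rw [key x hx]
      ring
    obtain ⟨d, hd⟩ := exists_hasLead_of_odd_pole (r := 2 * D.m α - 1) ⟨D.m α - 1, by ring⟩
      (hξ.1.2.1 α (D.top α) (by have := D.one_le_m α; simp [top]; omega)) (hasLead_Q0 hξ.1.1 α)
      (hAm.1 _) (Or.inl rfl) h2
    exact ⟨d, hd.congr_order (by ring)⟩
  have hi : ∃ a, HasLeadInf A (D.mInf - 2) a := by
    obtain ⟨b, hb⟩ := HasLeadInf.exists_sum Finset.univ fun I _ =>
      let ⟨d, hd⟩ := hasLeadInf_dQ0_UBase (ξ := ξ) I; ⟨_, hd.const_mul (c I)⟩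
    have h2 : ∃ b, HasLeadInf (fun x => 2 * (D.Q0 ξ.1 x * deriv A x) + deriv (D.Q0 ξ.1) x * A x
        + 0 * deriv (deriv (deriv A)) x) (4 - D.mInf) b := by
      refine ⟨_, hb.neg.congr ?_⟩
      filter_upwards [eventually_cocompact_isRegularPoint ξ] with x hx
      rw [key x hx]
      ring
    obtain ⟨d, hd⟩ := exists_hasLeadInf_of_odd_pole (r := 2 * D.mInf - 5) ⟨D.mInf - 3, by ring⟩
      (by omega) one_ne_zero (hasLeadInf_Q0 ξ.1) hAm.2 h2
    exact ⟨d, hd.congr_order (by ring)⟩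
  -- the square of `∏ (x - q_J) / F` turns these orders into those of the vanishing criterion
  have h0 := eq_zero_of_hasLead_poles hξ
    (f := fun x => A x * (D.nodePoly ξ x ^ 2 * (D.F ξ.1 x ^ 2)⁻¹)) (fun x hx => ?_) (fun α => ?_)
    (fun J => ?_) ?_
  · ext J
    refine (hasLead_poleSum hξ.2.1 c J).unique (HasLead.zero.congr ?_)
    filter_upwards [eventually_isRegularPoint ξ (D.q ξ J)] with x hx
    simpa [nodePoly_ne_zero hx.2, F_ne_zero hx.1] using h0 x hx
  · have h1 := analyticAt_poleSum c hx.2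
    have h2 := analyticAt_nodePoly ξ x
    have h3 := analyticAt_F' ξ.1 x
    have h4 := F_ne_zero hx.1
    fun_prop (disch := simp [h4])
  · obtain ⟨a, ha⟩ := hw α
    obtain ⟨f, hf, hF⟩ := hasLead_F hξ.1.1 α
    exact ⟨_, (ha.mul (((HasLead.of_analyticAt (analyticAt_nodePoly ξ _)).pow 2).mul
      ((hF.pow 2).inv (pow_ne_zero 2 hf)))).congr_order (by push_cast; ring)⟩
  · obtain ⟨f, hf, hF⟩ := hasLead_nodePoly hξ.2.1 J
    have h3 := analyticAt_F' ξ.1 (D.q ξ J)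
    have h4 := F_ne_zero (hξ.2.2.1 J)
    have h5 : AnalyticAt ℂ (fun x => (D.F ξ.1 x ^ 2)⁻¹) (D.q ξ J) := by
      fun_prop (disch := simp [h4])
    exact ⟨_, ((hasLead_poleSum hξ.2.1 c J).mul ((hF.pow 2).mul
      (HasLead.of_analyticAt h5))).congr_order (by norm_num)⟩
  · obtain ⟨a, ha⟩ := hi
    exact ⟨_, (ha.mul (((hasLeadInf_nodePoly ξ).pow 2).mul
      (((hasLeadInf_F ξ.1).pow 2).inv (by simp)))).congr_order (by push_cast; rw [hn]; ring)⟩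

/-- The differentials of the `Q₀(q_I)` are linearly independent along the low coefficients. -/
lemma eq_zero_of_sum_lowDirection {ξ : D.Ambient} (hξ : ξ ∈ D.X) {c : D.LowIndex → ℂ}
    (h : ∀ I, D.dQ0 ξ.1 (∑ k, c k • D.lowDirection k) (D.q ξ I) = 0) : c = 0 := by
  have hm := D.three_le_mInf
  set db := ∑ k, c k • D.lowDirection k with hdb
  have e := dQ0_sum Finset.univ ξ.1 D.lowDirection c
  have hr : ∀ x, (∀ α, x ≠ D.w ξ.1 α) → AnalyticAt ℂ (D.dQ0 ξ.1 db) x := by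
    intro x hx
    have this (α) := sub_ne_zero.2 (hx α)
    unfold dQ0
    fun_prop (disch := simp [this])
  have h0 := eq_zero_of_hasLead_poles hξ (f := D.dQ0 ξ.1 db) (fun x hx => hr x hx.1) (fun α => ?_)
    (fun J => ?_) ?_
  · have hwdb (α) : D.w db α = 0 := by
      have : D.w db α = ∑ k, c k * D.w (D.lowDirection k) α := by
        simp [hdb, w, Prod.snd_sum]
      rw [this]
      simp [w_lowDirection]
    ext k
    rw [← lowForm_sum_lowDirection c k, lowForm_apply, ← hdb]
    rcases k with k | ⟨α, i⟩
    · refine aInf_eq_zero_of_hasLeadInf le_rfl (HasLeadInf.zero.congr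
        ((eventually_cocompact_isRegularPoint ξ).mono h0)) _ ?_
      simp only [Fin.val_castLE]
      omega
    · refine aFin_eq_zero_of_hasLead hξ.1.1 (hwdb α) le_rfl (HasLead.zero.congr
        ((eventually_isRegularPoint ξ _).mono h0)) _ ?_
      simp
      omega
  · obtain ⟨b, hb⟩ := HasLead.exists_sum Finset.univ fun k _ =>
      let ⟨d, hd⟩ := hasLead_dQ0_lowDirection hξ.1.1 k α; ⟨_, hd.const_mul (c k)⟩
    exact ⟨b, hb.congr (Eventually.of_forall e)⟩
  · exact (((HasLead.of_analyticAt (hr _ (hξ.2.2.1 J)))).congr_coeff (h J).symm).succ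
  · obtain ⟨b, hb⟩ := HasLeadInf.exists_sum Finset.univ fun k _ =>
      let ⟨d, hd⟩ := hasLeadInf_dQ0_lowDirection ξ.1 k; ⟨_, hd.const_mul (c k)⟩
    exact ⟨b, hb.congr (Eventually.of_forall e)⟩

/-- The `4 n` fields are independent: in a relation, the low components eliminate the `U_i^{(α)}`,
the other parameters of `Q₀` the `U_I`, the `q_I` the `V_I`, and the `v_I` the `V_i^{(α)}`. -/
lemma linearIndependent_U_V {ξ : D.Ambient} (hξ : ξ ∈ D.X) :
    LinearIndependent ℂ (Sum.elim (fun a => D.U a ξ) (fun a => D.V a ξ)) := by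
  rw [Fintype.linearIndependent_iff]
  intro z hz
  rw [Fintype.sum_sum_type, Fintype.sum_sum_type (α₁ := D.LowIndex) (α₂ := Fin D.n),
    Fintype.sum_sum_type (α₁ := D.LowIndex) (α₂ := Fin D.n)] at hz
  obtain ⟨x₁, hx₁⟩ : ∃ x : D.LowIndex → ℂ, x = fun k => z (Sum.inl (Sum.inl k)) := ⟨_, rfl⟩
  obtain ⟨x₂, hx₂⟩ : ∃ x : Fin D.n → ℂ, x = fun I => z (Sum.inl (Sum.inr I)) := ⟨_, rfl⟩
  obtain ⟨y₁, hy₁⟩ : ∃ x : D.LowIndex → ℂ, x = fun k => z (Sum.inr (Sum.inl k)) := ⟨_, rfl⟩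
  obtain ⟨y₂, hy₂⟩ : ∃ x : Fin D.n → ℂ, x = fun I => z (Sum.inr (Sum.inr I)) := ⟨_, rfl⟩
  have hz : ∑ k, x₁ k • D.UIso k ξ + ∑ I, x₂ I • D.UApp I ξ
      + (∑ k, y₁ k • D.VIso k ξ + ∑ I, y₂ I • D.VApp I ξ) = 0 := by
    rw [hx₁, hx₂, hy₁, hy₂]
    exact hz
  have e1 : ∑ k, x₁ k • D.lowDirection k + ∑ I, x₂ I • D.UBase ξ I = 0 := by
    have := congrArg Prod.fst hz
    simp only [Prod.fst_add, Prod.fst_sum, Prod.smul_fst, UIso, UApp, VIso, VApp, tangentVector,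
      smul_zero, Finset.sum_const_zero, add_zero] at this
    exact this
  have hx1 : x₁ = 0 := by
    ext l
    have := congrArg (lowForm l) e1
    rw [map_add, lowForm_sum_lowDirection, map_sum] at this
    simpa only [map_smul, lowForm_apply, lowComponent_UBase, smul_zero, Finset.sum_const_zero,
      add_zero, map_zero, Pi.zero_apply] using this
  have hx2 : x₂ = 0 := by
    refine eq_zero_of_sum_UBase hξ ?_
    simpa only [hx1, Pi.zero_apply, zero_smul, Finset.sum_const_zero, zero_add] using e1
  subst hx1 hx2
  simp only [Pi.zero_apply, zero_smul, Finset.sum_const_zero, zero_add] at hz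
  have hy2 : y₂ = 0 := by
    ext I
    have := congrArg (fun t => D.q t I) hz
    simp only [q, Prod.snd_add, Prod.fst_add, Prod.snd_sum, Prod.fst_sum, Prod.smul_snd,
      Prod.smul_fst, Pi.add_apply, Finset.sum_apply, Pi.smul_apply, VIso, VApp, tangentVector,
      Pi.zero_apply, smul_zero, Finset.sum_const_zero, zero_add, smul_eq_mul, mul_ite,
      mul_zero, Finset.sum_ite_eq, Finset.mem_univ, if_true, Prod.snd_zero, Prod.fst_zero] at this
    simpa [p_ne_zero hξ I] using this
  subst hy2
  simp only [Pi.zero_apply, zero_smul, Finset.sum_const_zero, add_zero] at hz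
  have hy1 : y₁ = 0 := by
    refine eq_zero_of_sum_lowDirection hξ fun I => ?_
    have := congrArg (fun t => D.v t I) hz
    simp only [v, Prod.snd_sum, Prod.smul_snd, Finset.sum_apply, Pi.smul_apply, VIso,
      tangentVector, Prod.snd_zero, Pi.zero_apply, dp_eq hξ, smul_eq_mul] at this
    rw [dQ0_sum]
    have hp := p_ne_zero hξ I
    simp only [mul_zero, add_zero, mul_neg, Finset.sum_neg_distrib, neg_eq_zero, ← mul_div_assoc,
      ← Finset.sum_div, div_eq_zero_iff, mul_eq_zero, OfNat.ofNat_ne_zero, hp, or_self,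
      or_false] at this
    exact this
  rintro ((k | I) | (k | I))
  · exact (congrFun hx₁ k).symm
  · exact (congrFun hx₂ I).symm
  · rw [hy1] at hy₁
    exact (congrFun hy₁ k).symm
  · exact (congrFun hy₂ I).symm

lemma linearIndependent_flow {ħ : ℂ} {ξ : D.Ambient} (hξ : ξ ∈ D.X) :
    LinearIndependent ℂ (fun a => D.flow ħ a ξ) := by
  rw [Fintype.linearIndependent_iff]
  intro z hz a
  refine Fintype.linearIndependent_iff.1 (linearIndependent_U_V hξ)
    (Sum.elim z fun a => ħ⁻¹ * z a) ?_ (Sum.inl a)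
  rw [Fintype.sum_sum_type (α₁ := D.FlowIndex) (α₂ := D.FlowIndex), ← hz, ← Finset.sum_add_distrib]
  refine Finset.sum_congr rfl fun a _ => ?_
  simp only [Sum.elim_inl, Sum.elim_inr, flow, smul_add, smul_smul, mul_comm]

lemma span_U_V {ξ : D.Ambient} (hξ : ξ ∈ D.X) :
    Submodule.span ℂ (Set.range (Sum.elim (fun a => D.U a ξ) (fun a => D.V a ξ)))
      = D.tangentSpace ξ := by
  refine Submodule.eq_of_le_of_finrank_eq (Submodule.span_le.2 ?_) ?_
  · rintro _ ⟨a | a, rfl⟩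
    · exact U_mem hξ a
    · exact V_mem hξ a
  · rw [finrank_span_eq_card (linearIndependent_U_V hξ), finrank_tangentSpace hξ, Fintype.card_sum,
      card_flowIndex]
    ring

/-! ### Vector fields that preserve the potential -/

/-- `Q(x) dx²` has a pole of order exactly `2 m_α - 1` at every `w_α`. This can only fail at poles
with `m_α = 1`, where `R / ħ + S` may cancel the leading coefficient of `Q₀ / ħ²`. -/
def IsNondegenerate (ħ : ℂ) (ξ : D.Ambient) : Prop :=
  ∀ α, ∃ a, a ≠ 0 ∧ HasLead (D.Q ħ ξ) (D.w ξ.1 α) (-(2 * D.m α - 1)) a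

/-- The coefficient of the highest possible pole of `∂_t Q` at `w_α` is due to the motion of
`w_α`. -/
lemma hasLead_dQ_w {ħ : ℂ} {ξ : D.Ambient} (hξ : ξ ∈ D.X) (t : D.Ambient) {α : Fin D.N} {a : ℂ}
    (ha : HasLead (D.Q ħ ξ) (D.w ξ.1 α) (-(2 * D.m α - 1)) a) :
    HasLead (D.dQ ħ ξ t) (D.w ξ.1 α) (-(2 * D.m α)) ((2 * D.m α - 1) * a * D.w t.1 α) := by
  have hm := D.one_le_m α
  obtain ⟨g, hg, hdg⟩ : ∃ g, HasLead (D.G ħ ξ) (D.w ξ.1 α) (-(2 * D.m α - 1)) g ∧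
      HasLead (D.dG ħ ξ t) (D.w ξ.1 α) (-(2 * D.m α)) ((2 * D.m α - 1) * D.w t.1 α * g) := by
    obtain ⟨g, hg⟩ := hasLead_G hξ ħ α
    have hdg := hasLead_dG hξ ħ t α hg
    rcases hm.eq_or_lt with h | h
    · refine ⟨g, hg.congr_order (by rw [← h]; norm_num),
        (hdg.congr_order (by rw [← h]; norm_num)).congr_coeff (by rw [← h]; push_cast; ring)⟩
    · exact ⟨0, hg.weaken (by lia), (hdg.weaken (by lia)).congr_coeff (by ring)⟩
  have h1 := (HasLead.of_analyticAt (analyticAt_polar_w (ħ := ħ) hξ α)).weaken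
    (l := -(2 * D.m α - 1)) (by lia)
  have h2 := (HasLead.of_analyticAt (analyticAt_dpolar_w (ħ := ħ) hξ t α)).weaken
    (l := -(2 * D.m α)) (by lia)
  have e := ha.unique (((((hasLead_Q0 hξ.1.1 α).const_mul (ħ ^ 2)⁻¹).add hg).add h1).congr
    (Eventually.of_forall fun x => by rw [Q_eq]; ring))
  refine (((((hasLead_dQ0 hξ.1.1 t.1 α).const_mul (ħ ^ 2)⁻¹).add hdg).add h2).congr ?_).congr_coeff
    (by rw [e]; ring)
  filter_upwards [eventually_isRegularPoint ξ (D.w ξ.1 α)] with x hx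
  rw [dQ_eq hξ t hx]
  ring

/-- A tangent vector that preserves the potential fixes its double poles and their residues. -/
lemma q_eq_zero_of_dQ {ħ : ℂ} {ξ t : D.Ambient} (hξ : ξ ∈ D.X)
    (h : ∀ x, D.IsRegularPoint ξ x → D.dQ ħ ξ t x = 0) (J : Fin D.n) :
    D.q t J = 0 ∧ D.residue ħ t J = 0 := by
  have hH := HasLead.of_analyticAt (analyticAt_dH (ħ := ħ) hξ t J)
  have e : ∀ᶠ x in 𝓝[≠] (D.q ξ J), D.dpolar ħ ξ t J x + D.dH ħ ξ t J x = 0 := by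
    filter_upwards [eventually_isRegularPoint ξ (D.q ξ J)] with x hx
    rw [← dQ_eq_dpolar_add_dH hξ t J hx, h x hx]
  have hq : D.q t J = 0 := by
    have h1 := (((hasLead_sub_pow (D.q ξ J) 3 (3 / 2 * D.q t J)).congr_order (l := -3)
      (by simp)).add ((hasLead_sub_pow (D.q ξ J) 2 (D.residue ħ ξ J * D.q t J)).weaken (l := -3)
      (by norm_num))).add
      ((hasLead_sub_pow (D.q ξ J) 1 (D.residue ħ t J)).weaken (l := -3) (by norm_num))
    have h2 := (h1.add (hH.weaken (l := -3) (by norm_num))).unique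
      (HasLead.zero.congr (e.mono fun x hx => by rw [← hx, dpolar, pow_one]))
    simpa using h2
  refine ⟨hq, ?_⟩
  have h1 := (hasLead_sub_pow (D.q ξ J) 1 (D.residue ħ t J)).congr_order (l := -1) (by simp)
  have h2 := (h1.add (hH.weaken (l := -1) (by norm_num))).unique
    (HasLead.zero.congr (e.mono fun x hx => by rw [← hx, dpolar, hq, pow_one]; ring))
  simpa using h2

/-- A tangent vector at a nondegenerate point which preserves the potential and has no component
along the low coefficients vanishes. -/
theorem eq_zero_of_dQ_eq_zero {ħ : ℂ} (hħ : ħ ≠ 0) {ξ t : D.Ambient} (hξ : ξ ∈ D.X)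
    (hnd : D.IsNondegenerate ħ ξ) (ht : t ∈ D.tangentSpace ξ)
    (h : ∀ x, D.IsRegularPoint ξ x → D.dQ ħ ξ t x = 0)
    (hlow : ∀ k, D.lowComponent t.1 k = 0) : t = 0 := by
  have hmInf := D.three_le_mInf
  have hw (α : Fin D.N) : D.w t.1 α = 0 := by
    obtain ⟨a, ha, hQ⟩ := hnd α
    have h1 := (hasLead_dQ_w hξ t hQ).unique (HasLead.zero.congr
      ((eventually_isRegularPoint ξ _).mono h))
    have h2 : (2 * (D.m α : ℂ) - 1) ≠ 0 := by
      have := D.one_le_m α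
      have h3 : ((2 * D.m α - 1 : ℤ) : ℂ) ≠ 0 := Int.cast_ne_zero.2 (by lia)
      simpa using h3
    simpa [ha, h2] using h1
  have hdQ0 : ∀ x, D.IsRegularPoint ξ x → D.dQ0 ξ.1 t.1 x
      = -ħ ^ 2 * (D.dG ħ ξ t x + ∑ J, D.dpolar ħ ξ t J x) := by
    intro x hx
    have := dQ_eq (ħ := ħ) hξ t hx
    rw [h x hx] at this
    field_simp at this
    linear_combination -this
  -- the high coefficients are fixed, since all other terms have poles of order at most `m_α` only
  have hFin (α : Fin D.N) (i : Fin (2 * D.m α - 1)) : D.aFin t.1 α i = 0 := by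
    have hm := D.one_le_m α
    by_cases hi : (i : ℕ) < D.m α
    · exact hlow (Sum.inr ⟨α, ⟨i, hi⟩⟩)
    · obtain ⟨g, hg⟩ := hasLead_G hξ ħ α
      obtain ⟨b, hb⟩ := ((hasLead_dG hξ ħ t α hg).congr_coeff (b := 0) (by rw [hw]; ring)).succ
      have h2 := (HasLead.of_analyticAt (analyticAt_dpolar_w (ħ := ħ) hξ t α)).weaken
        (l := -D.m α) (by lia)
      have h3 := ((hb.congr_order (l := -D.m α) (by ring)).add h2).const_mul (-ħ ^ 2)
      exact aFin_eq_zero_of_hasLead hξ.1.1 (hw α) (by lia) (h3.congr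
        ((eventually_isRegularPoint ξ _).mono hdQ0)) i (by omega)
  have hInf (i : Fin (2 * D.mInf - 6)) : D.aInf t.1 i = 0 := by
    by_cases hi : (i : ℕ) < D.mInf - 3
    · exact hlow (Sum.inl ⟨i, hi⟩)
    · obtain ⟨g, hg⟩ := hasLeadInf_dG hξ ħ t
      obtain ⟨b, hb⟩ := (HasLeadInf.sum Finset.univ fun J _ =>
        hasLeadInf_dpolar ħ ξ t J).exists_of_le (l := 4 - D.mInf) (by lia)
      exact aInf_eq_zero_of_hasLeadInf (by lia) (((hg.add hb).const_mul (-ħ ^ 2)).congr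
        ((eventually_cocompact_isRegularPoint ξ).mono hdQ0)) i (by omega)
  have h1 : t.1 = 0 :=
    Prod.ext (funext hInf) (Prod.ext (funext fun α => funext (hFin α)) (funext hw))
  have h2 (I) := q_eq_zero_of_dQ hξ h I
  have h3 (I : Fin D.n) : D.p t I = 0 := by
    have := (mem_tangentSpace hξ).1 ht I
    rw [h1, (h2 I).1, fderiv_Q0_prod (hξ.2.2.1 I)] at this
    simpa [p_ne_zero hξ I] using this
  have h4 (I : Fin D.n) : D.v t I = 0 := by
    simpa [residue, h3 I] using (h2 I).2
  exact Prod.ext h1 (Prod.ext (funext fun I => (h2 I).1) (Prod.ext (funext h3) (funext h4)))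

/-! ### Nondegenerate points are dense -/

/-- The point `ξ + s ∂/∂v_I`. -/
def shift (ξ : D.Ambient) (I : Fin D.n) (s : ℂ) : D.Ambient :=
  (ξ.1, ξ.2.1, ξ.2.2.1, ξ.2.2.2 + Pi.single I s)

lemma shift_mem {ξ : D.Ambient} (hξ : ξ ∈ D.X) (I : Fin D.n) (s : ℂ) : D.shift ξ I s ∈ D.X := hξ

lemma v_shift (ξ : D.Ambient) (I : Fin D.n) (s : ℂ) (K : Fin D.n) :
    D.v (D.shift ξ I s) K = D.v ξ K + if K = I then s else 0 := by
  simp [v, shift, Pi.single_apply]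

/-- The numerator of `R / ħ + S` is quadratic in `v_I`. -/
lemma exists_numer_shift (ħ : ℂ) (ξ : D.Ambient) (I : Fin D.n) (x : ℂ) :
    ∃ b, ∀ s, D.numer ħ (D.shift ξ I s) x
      = D.numer ħ ξ x + b * s + D.F ξ.1 (D.q ξ I) * D.lagrange ξ I x * s ^ 2 := by
  have h (K : Fin D.n) : ∃ b, ∀ s, D.nodeValue ħ (D.shift ξ I s) K
      = D.nodeValue ħ ξ K + b * s + if K = I then s ^ 2 else 0 := by
    have e (s : ℂ) : ∑ J ∈ Finset.univ.erase K, D.v (D.shift ξ I s) J / (D.q ξ K - D.q ξ J) =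
        ∑ J ∈ Finset.univ.erase K, D.v ξ J / (D.q ξ K - D.q ξ J)
        + (∑ J ∈ Finset.univ.erase K, (if J = I then 1 else 0) / (D.q ξ K - D.q ξ J)) * s := by
      rw [Finset.sum_mul, ← Finset.sum_add_distrib]
      refine Finset.sum_congr rfl fun J _ => ?_
      rw [v_shift]
      split_ifs <;> ring
    have hv (s : ℂ) : D.nodeValue ħ (D.shift ξ I s) K = (2 * D.p ξ K * D.v (D.shift ξ I s) K
        - ∑ K_1 ∈ Finset.univ.erase K, D.p ξ K_1 / (D.q ξ K - D.q ξ K_1)) / ħ +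
      (D.v (D.shift ξ I s) K ^ 2
        - ∑ J ∈ Finset.univ.erase K, 3 / (4 * (D.q ξ K - D.q ξ J) ^ 2)
        - ∑ J ∈ Finset.univ.erase K, D.v (D.shift ξ I s) J / (D.q ξ K - D.q ξ J)) := rfl
    by_cases hK : K = I
    · refine ⟨2 * D.p ξ K / ħ + 2 * D.v ξ K
        - ∑ J ∈ Finset.univ.erase K, (if J = I then 1 else 0) / (D.q ξ K - D.q ξ J), fun s => ?_⟩
      rw [hv, e, v_shift, if_pos hK, if_pos hK, nodeValue]
      ring
    · refine ⟨- ∑ J ∈ Finset.univ.erase K, (if J = I then 1 else 0) / (D.q ξ K - D.q ξ J),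
        fun s => ?_⟩
      rw [hv, e, v_shift, if_neg hK, if_neg hK, nodeValue]
      ring
  choose b hb using h
  refine ⟨∑ K, D.F ξ.1 (D.q ξ K) * b K * D.lagrange ξ K x, fun s => ?_⟩
  have e1 : D.numer ħ (D.shift ξ I s) x = ∑ K, D.F ξ.1 (D.q ξ K)
      * D.nodeValue ħ (D.shift ξ I s) K * D.lagrange ξ K x := rfl
  have e2 : D.F ξ.1 (D.q ξ I) * D.lagrange ξ I x * s ^ 2
      = ∑ K, D.F ξ.1 (D.q ξ K) * (if K = I then s ^ 2 else 0) * D.lagrange ξ K x := by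
    simp only [mul_ite, ite_mul, mul_zero, zero_mul, Finset.sum_ite_eq', Finset.mem_univ, if_true]
    ring
  rw [e1, e2, numer, Finset.sum_mul, ← Finset.sum_add_distrib, ← Finset.sum_add_distrib]
  refine Finset.sum_congr rfl fun K _ => ?_
  rw [hb]
  ring

lemma _root_.eventually_quadratic_ne_zero {a b c : ℂ} (hc : c ≠ 0) :
    ∀ᶠ s in 𝓝[≠] (0 : ℂ), a + b * s + c * s ^ 2 ≠ 0 := by
  have hP :
      Polynomial.C c * Polynomial.X ^ 2 + Polynomial.C b * Polynomial.X + Polynomial.C a ≠ 0 :=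
    Polynomial.leadingCoeff_ne_zero.1 (by rwa [Polynomial.leadingCoeff_quadratic hc])
  filter_upwards [nhdsNE_le_cofinite 0 (Polynomial.finite_setOfPred_isRoot hP).compl_mem_cofinite]
    with s hs h
  refine hs ?_
  simp only [Set.mem_ofPred_eq, Polynomial.IsRoot, Polynomial.eval_add, Polynomial.eval_mul,
    Polynomial.eval_C, Polynomial.eval_pow, Polynomial.eval_X]
  linear_combination h

/-- Every point of `X` is the limit, along a coordinate line, of nondegenerate points. -/
lemma eventually_isNondegenerate_shift {ħ : ℂ} (hħ : ħ ≠ 0) {ξ : D.Ambient} (hξ : ξ ∈ D.X)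
    (I : Fin D.n) : ∀ᶠ s in 𝓝[≠] (0 : ℂ), D.IsNondegenerate ħ (D.shift ξ I s) := by
  refine eventually_all.2 fun α => ?_
  have hm := D.one_le_m α
  set a₀ := D.aFin ξ.1 α (D.top α) with ha₀
  have ha : a₀ ≠ 0 := hξ.1.2.1 α (D.top α) (by simp [top]; omega)
  have hG (s : ℂ) := hasLead_G (shift_mem hξ I s) ħ α
  obtain ⟨f, hf, hF⟩ := hasLead_F hξ.1.1 α
  have hpol (s : ℂ) := (HasLead.of_analyticAt (analyticAt_polar_w (ħ := ħ)
    (shift_mem hξ I s) α)).weaken (l := -(2 * D.m α - 1)) (by lia)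
  rcases hm.eq_or_lt with h | h
  · -- the leading coefficient is a quadratic polynomial in the shift of `v_I`
    obtain ⟨b, hb⟩ := exists_numer_shift ħ ξ I (D.w ξ.1 α)
    have hL : D.F ξ.1 (D.q ξ I) * D.lagrange ξ I (D.w ξ.1 α) * f⁻¹ ≠ 0 := by
      refine mul_ne_zero (mul_ne_zero (F_ne_zero (hξ.2.2.1 I)) ?_) (inv_ne_zero hf)
      refine Finset.prod_ne_zero_iff.2 fun J hJ => div_ne_zero (sub_ne_zero.2 (hξ.2.2.1 J α).symm)
        (sub_ne_zero.2 fun e => (Finset.ne_of_mem_erase hJ) (hξ.2.1 e).symm)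
    filter_upwards [eventually_quadratic_ne_zero
      (a := (ħ ^ 2)⁻¹ * a₀ + D.numer ħ ξ (D.w ξ.1 α) * f⁻¹) (b := b * f⁻¹) hL] with s hs
    have hN : AnalyticAt ℂ (fun x => D.numer ħ (D.shift ξ I s) x) (D.w ξ.1 α) :=
      analyticAt_numer ħ analyticAt_const analyticAt_id hξ.2.1
    have h1 := ((HasLead.of_analyticAt hN).mul (hF.inv hf)).congr_order (l := -(2 * D.m α - 1))
      (by rw [← h]; norm_num)
    refine ⟨_, hs, ((((hasLead_Q0 hξ.1.1 α).const_mul (ħ ^ 2)⁻¹).add h1).add (hpol s)).congr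
      (Eventually.of_forall fun x => ?_) |>.congr_coeff ?_⟩
    · rw [Q_eq, G, div_eq_mul_inv (D.numer _ _ _)]
      change D.Q0 ξ.1 x / _ + _ * (D.F ξ.1 x)⁻¹ + _ = _
      ring
    · rw [hb]
      ring
  · -- for `m_α ≥ 2` the pole of `R / ħ + S` is of lower order than that of `Q₀`
    refine Eventually.of_forall fun s => ?_
    obtain ⟨g, hg⟩ := hG s
    refine ⟨(ħ ^ 2)⁻¹ * a₀, mul_ne_zero (inv_ne_zero (pow_ne_zero 2 hħ)) ha,
      ((((hasLead_Q0 hξ.1.1 α).const_mul (ħ ^ 2)⁻¹).add (hg.weaken (l := -(2 * D.m α - 1))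
        (by lia))).add (hpol s)).congr (Eventually.of_forall fun x => ?_) |>.congr_coeff (by ring)⟩
    rw [Q_eq]
    change D.Q0 ξ.1 x / _ + _ + _ = _
    ring

/-! ### Classification of the isomonodromic flows -/

/-- Flatness of the connection implies that the upper right entry `A` of `B` solves
`∂_t Q = 2 Q A' + Q' A - A''' / 2`. -/
lemma IsIsomonodromic.exists_dQ_eq {ħ : ℂ} {L : D.Ambient → D.Ambient} (hL : D.IsIsomonodromic ħ L)
    {ξ : D.Ambient} (hξ : ξ ∈ D.X) :
    ∃ (A : ℂ → ℂ) (W : Set ℂ), MeromorphicOnSphere A ∧ W.Finite ∧ ∀ x ∉ W,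
      D.IsRegularPoint ξ x ∧ AnalyticAt ℂ A x ∧ D.dQ ħ ξ (L ξ) x = fuchs (D.Q ħ ξ) A x := by
  obtain ⟨B, Z, hB⟩ := hL
  have hB := hB ξ hξ
  set W : Set ℂ := D.poles ξ ∪ Z ξ with hW
  have hWf : W.Finite := (D.finite_poles ξ).union (Z ξ).finite_toSet
  refine ⟨fun x => B ξ x 0 1, W, (hB 0 1).1, hWf, fun x hx => ?_⟩
  have good : ∀ x ∉ W, D.IsRegularPoint ξ x ∧ x ∉ Z ξ := by
    intro x hx
    simp only [hW, Set.mem_union, not_or, notMem_poles] at hx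
    exact hx
  have han (i j : Fin 2) : ∀ x ∉ W, AnalyticAt ℂ (fun y => B ξ y i j) x := by
    intro x hx
    have h1 := ((hB i j).2 x (good x hx).2 (good x hx).1).1
    rw [← analyticWithinAt_univ]
    exact h1.comp_of_eq (f := fun y : ℂ => (ξ, y))
      (analyticAt_const.prod analyticAt_id).analyticWithinAt (fun y _ => ⟨hξ, trivial⟩) rfl
  have hnear : ∀ᶠ y in 𝓝 x, y ∉ W := hWf.isClosed.isOpen_compl.mem_nhds hx
  -- the four entries of the flatness equation
  have e00 : ∀ y ∉ W, deriv (fun y => B ξ y 0 0) y = B ξ y 1 0 - B ξ y 0 1 * D.Q ħ ξ y := by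
    intro y hy
    have := ((hB 0 0).2 y (good y hy).2 (good y hy).1).2
    rw [Matrix.sub_apply, Matrix.mul_apply, Matrix.mul_apply, Fin.sum_univ_two,
      Fin.sum_univ_two] at this
    simpa [potentialMatrix] using this
  have e01 : ∀ y ∉ W, deriv (fun y => B ξ y 0 1) y = B ξ y 1 1 - B ξ y 0 0 := by
    intro y hy
    have := ((hB 0 1).2 y (good y hy).2 (good y hy).1).2
    rw [Matrix.sub_apply, Matrix.mul_apply, Matrix.mul_apply, Fin.sum_univ_two,
      Fin.sum_univ_two] at this
    simpa [potentialMatrix] using this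
  have e10 : ∀ y ∉ W, deriv (fun y => B ξ y 1 0) y - D.dQ ħ ξ (L ξ) y
      = D.Q ħ ξ y * B ξ y 0 0 - B ξ y 1 1 * D.Q ħ ξ y := by
    intro y hy
    have := ((hB 1 0).2 y (good y hy).2 (good y hy).1).2
    rw [Matrix.sub_apply, Matrix.mul_apply, Matrix.mul_apply, Fin.sum_univ_two,
      Fin.sum_univ_two] at this
    simpa [potentialMatrix, dQ] using this
  have e11 : ∀ y ∉ W, deriv (fun y => B ξ y 1 1) y = D.Q ħ ξ y * B ξ y 0 1 - B ξ y 1 0 := by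
    intro y hy
    have := ((hB 1 1).2 y (good y hy).2 (good y hy).1).2
    rw [Matrix.sub_apply, Matrix.mul_apply, Matrix.mul_apply, Fin.sum_univ_two,
      Fin.sum_univ_two] at this
    simpa [potentialMatrix] using this
  have d2 : ∀ y ∉ W, deriv (deriv fun y => B ξ y 0 1) y
      = 2 * (D.Q ħ ξ y * B ξ y 0 1 - B ξ y 1 0) := by
    intro y hy
    have h1 : ∀ᶠ z in 𝓝 y, z ∉ W := hWf.isClosed.isOpen_compl.mem_nhds hy
    have h2 := (han 1 1 y hy).differentiableAt.hasDerivAt.fun_sub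
      (han 0 0 y hy).differentiableAt.hasDerivAt
    rw [(h2.congr_of_eventuallyEq (h1.mono e01)).deriv, e11 y hy, e00 y hy]
    ring
  have hQ := (analyticAt_Q_x (ħ := ħ) hξ (good x hx).1).differentiableAt.hasDerivAt
  have d3 : deriv (deriv (deriv fun y => B ξ y 0 1)) x
      = 2 * (deriv (D.Q ħ ξ) x * B ξ x 0 1 + D.Q ħ ξ x * deriv (fun y => B ξ y 0 1) x
        - deriv (fun y => B ξ y 1 0) x) :=
    ((((hQ.fun_mul (han 0 1 x hx).differentiableAt.hasDerivAt).fun_sub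
      (han 1 0 x hx).differentiableAt.hasDerivAt).const_mul 2).congr_of_eventuallyEq
      (hnear.mono d2)).deriv
  refine ⟨(good x hx).1, han 0 1 x hx, ?_⟩
  rw [fuchs, d3, e01 x hx]
  linear_combination -(e10 x hx)

/-- At a nondegenerate point, a solution `A` of the equation that is meromorphic on the sphere has
at most simple poles, all of them at the apparent singularities, and vanishes at infinity. -/
lemma exists_eq_poleSum {ħ : ℂ} (hħ : ħ ≠ 0) {ξ t : D.Ambient} (hξ : ξ ∈ D.X)
    (hnd : D.IsNondegenerate ħ ξ) {A : ℂ → ℂ} {W : Set ℂ} (hA : MeromorphicOnSphere A)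
    (hW : W.Finite) (h : ∀ x ∉ W, D.IsRegularPoint ξ x ∧ AnalyticAt ℂ A x ∧
      D.dQ ħ ξ t x = fuchs (D.Q ħ ξ) A x) :
    ∃ c, ∀ x ∉ W, A x = D.poleSum ξ c x := by
  have hm := D.three_le_mInf
  have hne (c : ℂ) : ∀ᶠ x in 𝓝[≠] c, x ∉ W := nhdsNE_le_cofinite c hW.compl_mem_cofinite
  have hlead {c : ℂ} {k : ℤ} (h1 : ∃ a, HasLead (D.dQ ħ ξ t) c k a) :
      ∃ a, HasLead (fun x => 2 * (D.Q ħ ξ x * deriv A x) + deriv (D.Q ħ ξ) x * A x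
        + (-1 / 2) * deriv (deriv (deriv A)) x) c k a := by
    obtain ⟨a, ha⟩ := h1
    exact ⟨a, ha.congr ((hne c).mono fun x hx => (h x hx).2.2.symm)⟩
  have hq (J : Fin D.n) : ∃ b, HasLead A (D.q ξ J) (-1) b := by
    refine exists_hasLead_of_apparent_pole (hasLead_Q_node (ħ := ħ) hξ J) (hA.1 _) (hlead ?_)
    have h1 := (((hasLead_sub_pow (D.q ξ J) 3 (3 / 2 * D.q t J)).weaken (l := -4) (by norm_num)).add
      ((hasLead_sub_pow (D.q ξ J) 2 (D.residue ħ ξ J * D.q t J)).weaken (l := -4)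
        (by norm_num))).add
      ((hasLead_sub_pow (D.q ξ J) 1 (D.residue ħ t J)).weaken (l := -4) (by norm_num))
    refine ⟨_, (h1.add ((HasLead.of_analyticAt (analyticAt_dH (ħ := ħ) hξ t J)).weaken (l := -4)
      (by norm_num))).congr ?_⟩
    filter_upwards [eventually_isRegularPoint ξ (D.q ξ J)] with x hx
    rw [dQ_eq_dpolar_add_dH hξ t J hx, dpolar, pow_one]
  have hw (α : Fin D.N) : ∃ b, HasLead A (D.w ξ.1 α) 0 b := by
    have hmα := D.one_le_m α
    obtain ⟨a, ha, hQ⟩ := hnd α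
    have hdQ := hasLead_dQ_w hξ t hQ
    -- a simple pole of `Q` is weaker than `A'''`, a pole of order `2 m_α - 1 ≥ 3` is stronger
    rcases hmα.eq_or_lt with h1 | h1
    · exact exists_hasLead_of_simple_pole (hQ.congr_order (by rw [← h1]; norm_num)) (hA.1 _)
        (hlead (hdQ.exists_of_le (by lia)))
    · obtain ⟨b, hb⟩ := exists_hasLead_of_odd_pole (r := 2 * D.m α - 1) ⟨D.m α - 1, by ring⟩ ha hQ
        (hA.1 _) (Or.inr (by lia)) (hlead ⟨_, hdQ⟩)
      exact ⟨b, hb.congr_order (by ring)⟩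
  have hreg (x : ℂ) (hx : D.IsRegularPoint ξ x) : ∃ b, HasLead A x 0 b :=
    exists_hasLead_of_simple_pole ((HasLead.of_analyticAt (analyticAt_Q_x (ħ := ħ) hξ hx)).weaken
      (by norm_num)) (hA.1 _)
      (hlead ((HasLead.of_analyticAt (analyticAt_dQ (ħ := ħ) hξ t hx)).exists_of_le (by norm_num)))
  have hi : ∃ b, HasLeadInf A 1 b := by
    obtain ⟨a, ha⟩ := hasLeadInf_dQ (ħ := ħ) hξ t
    have h1 : ∃ a, HasLeadInf (fun x => 2 * (D.Q ħ ξ x * deriv A x) + deriv (D.Q ħ ξ) x * A x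
        + (-1 / 2) * deriv (deriv (deriv A)) x) (-(2 * D.mInf - 7)) a :=
      ⟨a, ha.congr (mem_of_superset hW.isCompact.compl_mem_cocompact
        fun x hx => (h x hx).2.2.symm)⟩
    obtain ⟨b, hb⟩ := exists_hasLeadInf_of_odd_pole (r := 2 * D.mInf - 5) ⟨D.mInf - 3, by ring⟩
      (by lia) (inv_ne_zero (pow_ne_zero 2 hħ)) (hasLeadInf_Q ξ) hA.2 h1
    exact ⟨b, hb.congr_order (by ring)⟩
  -- `A` minus its principal parts at the `q_J` is entire and vanishes at infinity
  choose c hc using hq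
  have hreg' (x : ℂ) (hx : ∀ J, x ≠ D.q ξ J) : ∃ b, HasLead (D.poleSum ξ c) x 0 b :=
    ⟨_, HasLead.of_analyticAt (analyticAt_poleSum c hx)⟩
  refine ⟨c, fun x hx => sub_eq_zero.1 (eq_zero_of_hasLead (f := fun x => A x - D.poleSum ξ c x)
    (W ∪ D.poles ξ) (hW.union (finite_poles ξ)) (fun x hx => ?_) (fun x _ => ?_) ?_ x ?_)⟩
  · simp only [Set.mem_union, not_or, notMem_poles] at hx
    exact ((h x hx.1).2.1.sub (analyticAt_poleSum c hx.2.2)).differentiableAt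
  · by_cases hx : D.IsRegularPoint ξ x
    · obtain ⟨b, hb⟩ := hreg x hx
      obtain ⟨b', hb'⟩ := hreg' x hx.2
      exact ⟨_, hb.sub hb'⟩
    · rw [← notMem_poles, not_not] at hx
      rcases hx with ⟨α, rfl⟩ | ⟨J, rfl⟩
      · obtain ⟨b, hb⟩ := hw α
        obtain ⟨b', hb'⟩ := hreg' _ fun J => (hξ.2.2.1 J α).symm
        exact ⟨_, hb.sub hb'⟩
      · exact (((hc J).sub (hasLead_poleSum hξ.2.1 c J)).congr_coeff (sub_self _).symm).succ
  · obtain ⟨b, hb⟩ := hi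
    exact ⟨_, hb.sub (hasLeadInf_poleSum ξ c)⟩
  · simp only [Set.mem_union, not_or, notMem_poles]
    exact ⟨hx, (h x hx).1⟩

lemma dQ_sub (ħ : ℂ) (ξ t t' : D.Ambient) (x : ℂ) :
    D.dQ ħ ξ (t - t') x = D.dQ ħ ξ t x - D.dQ ħ ξ t' x := map_sub _ _ _

lemma dQ_sum_smul {ι : Type*} [Fintype ι] (ħ : ℂ) (ξ : D.Ambient) (c : ι → ℂ) (t : ι → D.Ambient)
    (x : ℂ) : D.dQ ħ ξ (∑ i, c i • t i) x = ∑ i, c i * D.dQ ħ ξ (t i) x := by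
  simp [dQ, map_sum]

lemma fuchs_poleSum (Q : ℂ → ℂ) {ξ : D.Ambient} (c : Fin D.n → ℂ) {x : ℂ}
    (hx : D.IsRegularPoint ξ x) :
    fuchs Q (D.poleSum ξ c) x = ∑ J, c J * fuchs Q (fun x => (x - D.q ξ J)⁻¹) x := by
  have hA (J) (x) (h : D.IsRegularPoint ξ x) : AnalyticAt ℂ (fun x => (x - D.q ξ J)⁻¹) x := by
    have := sub_ne_zero.2 (h.2 J)
    fun_prop (disch := exact this)
  have h1 (y) (hy : D.IsRegularPoint ξ y) : deriv (D.poleSum ξ c) y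
      = ∑ J, c J * deriv (fun x => (x - D.q ξ J)⁻¹) y := deriv_poleSum c hy.2
  have h2 (y) (hy : D.IsRegularPoint ξ y) : deriv (deriv (D.poleSum ξ c)) y
      = ∑ J, c J * deriv (deriv (fun x => (x - D.q ξ J)⁻¹)) y :=
    ((HasDerivAt.fun_sum fun J _ => (hA J y hy).deriv.differentiableAt.hasDerivAt.const_mul
      (c J)).congr_of_eventuallyEq (hy.eventually.mono h1)).deriv
  have h3 : deriv (deriv (deriv (D.poleSum ξ c))) x
      = ∑ J, c J * deriv (deriv (deriv (fun x => (x - D.q ξ J)⁻¹))) x :=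
    ((HasDerivAt.fun_sum fun J _ => (hA J x hx).deriv.deriv.differentiableAt.hasDerivAt.const_mul
      (c J)).congr_of_eventuallyEq (hx.eventually.mono h2)).deriv
  simp only [fuchs, h1 x hx, h3, poleSum, mul_add, Finset.sum_add_distrib, Finset.mul_sum]
  congr 1
  · congr 1 <;> exact Finset.sum_congr rfl fun J _ => by ring
  · exact Finset.sum_congr rfl fun J _ => by ring

/-- A tangent vector at a nondegenerate point that generates an isomonodromic deformation is a
combination of the flows. -/
lemma mem_span_flow_of_isNondegenerate {ħ : ℂ} (hħ : ħ ≠ 0) {L : D.Ambient → D.Ambient}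
    (hL : D.IsIsomonodromic ħ L) {ξ : D.Ambient} (hξ : ξ ∈ D.X) (ht : L ξ ∈ D.tangentSpace ξ)
    (hnd : D.IsNondegenerate ħ ξ) :
    L ξ ∈ Submodule.span ℂ (Set.range fun a => D.flow ħ a ξ) := by
  obtain ⟨A, W, hA, hW, h⟩ := hL.exists_dQ_eq hξ
  obtain ⟨c, hc⟩ := exists_eq_poleSum hħ hξ hnd hA hW h
  -- what remains of `L` preserves the potential and has no low components
  set t := L ξ - ∑ J, c J • D.flow ħ (Sum.inr J) ξ
    - ∑ k, D.lowComponent (L ξ).1 k • D.flow ħ (Sum.inl k) ξ with ht'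
  have hsum {ι : Type} [Fintype ι] (c : ι → ℂ) (f : ι → D.FlowIndex) :
      ∑ i, c i • D.flow ħ (f i) ξ ∈ Submodule.span ℂ (Set.range fun a => D.flow ħ a ξ) :=
    Submodule.sum_mem _ fun i _ => Submodule.smul_mem _ _ (Submodule.subset_span ⟨f i, rfl⟩)
  have htan {ι : Type} [Fintype ι] (c : ι → ℂ) (f : ι → D.FlowIndex) :
      ∑ i, c i • D.flow ħ (f i) ξ ∈ D.tangentSpace ξ :=
    Submodule.sum_mem _ fun i _ => Submodule.smul_mem _ _ (flow_mem hξ ħ (f i))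
  have hdQ : ∀ x ∉ W, D.dQ ħ ξ t x = 0 := by
    intro x hx
    have hx' := (h x hx).1
    have hAc : fuchs (D.Q ħ ξ) A x = fuchs (D.Q ħ ξ) (D.poleSum ξ c) x := by
      have e : A =ᶠ[𝓝 x] D.poleSum ξ c :=
        mem_of_superset (hW.isClosed.isOpen_compl.mem_nhds hx) hc
      simp only [fuchs, e.deriv.deriv.deriv.eq_of_nhds, e.deriv.eq_of_nhds, e.eq_of_nhds]
    rw [ht', dQ_sub, dQ_sub, dQ_sum_smul, dQ_sum_smul, (h x hx).2.2, hAc, fuchs_poleSum _ _ hx']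
    simp only [dQ_flow_inl hξ _ hx', dQ_flow_inr hξ _ hx', mul_zero, Finset.sum_const_zero,
      sub_self]
  have hzero : t = 0 := by
    refine eq_zero_of_dQ_eq_zero hħ hξ hnd (sub_mem (sub_mem ht (htan _ _)) (htan _ _))
      (fun x hx => ?_) fun l => ?_
    · have h1 : ∀ᶠ y in 𝓝[≠] x, y ∉ W := nhdsNE_le_cofinite x hW.compl_mem_cofinite
      exact (HasLead.of_analyticAt (analyticAt_dQ hξ t hx)).unique
        (HasLead.zero.congr (h1.mono hdQ))
    · rw [← lowForm_apply, ht', Prod.fst_sub, Prod.fst_sub, map_sub, map_sub, Prod.fst_sum,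
        Prod.fst_sum]
      simp only [Prod.smul_fst, flow_inl_fst, flow_inr_fst, lowForm_sum_lowDirection]
      rw [map_sum]
      simp [lowForm_apply, lowComponent_UBase]
  have e : L ξ = ∑ J, c J • D.flow ħ (Sum.inr J) ξ
      + ∑ k, D.lowComponent (L ξ).1 k • D.flow ħ (Sum.inl k) ξ := by
    rw [ht', sub_sub, sub_eq_zero] at hzero
    exact hzero
  rw [e]
  exact add_mem (hsum _ _) (hsum _ _)

/-! ### Passage to degenerate points -/

lemma tendsto_shift (ξ : D.Ambient) (I : Fin D.n) : Tendsto (D.shift ξ I) (𝓝[≠] 0) (𝓝 ξ) := by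
  have h1 : Continuous (D.shift ξ I) := by
    unfold shift
    exact continuous_const.prodMk (continuous_const.prodMk (continuous_const.prodMk
      (continuous_const.add (continuous_single (A := fun _ : Fin D.n => ℂ) I))))
  have h2 := h1.tendsto 0
  have h3 : D.shift ξ I 0 = ξ := by simp [shift]
  rw [h3] at h2
  exact h2.mono_left nhdsWithin_le_nhds

lemma IsVectorField.tendsto_shift {L : D.Ambient → D.Ambient} (hL : D.IsVectorField L)
    {ξ : D.Ambient} (hξ : ξ ∈ D.X) (I : Fin D.n) :
    Tendsto (fun s => L (D.shift ξ I s)) (𝓝[≠] 0) (𝓝 (L ξ)) :=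
  (hL.1 ξ hξ).continuousWithinAt.tendsto.comp (tendsto_nhdsWithin_iff.2
    ⟨D.tendsto_shift ξ I, Eventually.of_forall fun s => shift_mem hξ I s⟩)

/-- Membership in the span of a family of vectors is a closed condition where the family stays
linearly independent. -/
lemma _root_.mem_span_range_of_tendsto {E ι α : Type*} [NormedAddCommGroup E] [NormedSpace ℂ E]
    [Finite ι] {l : Filter α} [l.NeBot] {f : α → ι → E} {g : α → E} {f₀ : ι → E} {g₀ : E}
    (hf : ∀ i, Tendsto (fun a => f a i) l (𝓝 (f₀ i))) (hg : Tendsto g l (𝓝 g₀))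
    (h₀ : LinearIndependent ℂ f₀) (h : ∀ᶠ a in l, g a ∈ Submodule.span ℂ (Set.range (f a))) :
    g₀ ∈ Submodule.span ℂ (Set.range f₀) := by
  by_contra hmem
  have h1 := linearIndependent_option'.2 ⟨h₀, hmem⟩
  have h2 : Tendsto (fun a => (fun o : Option ι => (Option.casesOn' o (g a) (f a) : E))) l
      (𝓝 fun o => Option.casesOn' o g₀ f₀) := by
    refine tendsto_pi_nhds.2 fun o => ?_
    cases o with
    | none => exact hg
    | some i => exact hf i
  obtain ⟨a, ha, ha'⟩ := ((h2.eventually (isOpen_setOfPred_linearIndependent.mem_nhds h1)).and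
    h).exists
  exact (linearIndependent_option'.1 ha).2 ha'

/-- Every isomonodromic flow is in the span of the fields `L_i^{(α)}` and `L_I`, also at degenerate
points, as these are limits of nondegenerate ones. -/
lemma mem_span_flow {ħ : ℂ} (hħ : ħ ≠ 0) {L : D.Ambient → D.Ambient} (hL : D.IsVectorField L)
    (hL' : D.IsIsomonodromic ħ L) {ξ : D.Ambient} (hξ : ξ ∈ D.X) :
    L ξ ∈ Submodule.span ℂ (Set.range fun a => D.flow ħ a ξ) := by
  let I : Fin D.n := ⟨0, D.n_pos⟩
  exact mem_span_range_of_tendsto (l := 𝓝[≠] (0 : ℂ))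
    (fun a => (isVectorField_flow ħ a).tendsto_shift hξ I) (hL.tendsto_shift hξ I)
    (linearIndependent_flow hξ) ((eventually_isNondegenerate_shift hħ hξ I).mono fun s hs =>
      mem_span_flow_of_isNondegenerate hħ hL' (shift_mem hξ I s) (hL.2 _ (shift_mem hξ I s)) hs)

lemma isomonodromicDistribution_eq {ħ : ℂ} (hħ : ħ ≠ 0) {ξ : D.Ambient} (hξ : ξ ∈ D.X) :
    D.isomonodromicDistribution ħ ξ = Submodule.span ℂ (Set.range fun a => D.flow ħ a ξ) := by
  refine le_antisymm (Submodule.span_le.2 ?_) (Submodule.span_mono ?_)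
  · rintro _ ⟨L, hL, hL', rfl⟩
    exact mem_span_flow hħ hL hL' hξ
  · rintro _ ⟨a, rfl⟩
    exact ⟨D.flow ħ a, isVectorField_flow ħ a, isIsomonodromic_flow ħ a, rfl⟩

/-- Two vector fields without low components which solve the same equation agree at nondegenerate
points, hence everywhere. -/
lemma eq_of_solvesFuchs {ħ : ℂ} (hħ : ħ ≠ 0) {A : D.Ambient → ℂ → ℂ}
    {L L' : D.Ambient → D.Ambient} (hL : D.IsVectorField L) (hL' : D.IsVectorField L')
    (h : D.SolvesFuchs ħ A L)
    (h' : D.SolvesFuchs ħ A L') (hlow : ∀ ξ ∈ D.X, ∀ k, D.lowComponent (L ξ).1 k = 0)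
    (hlow' : ∀ ξ ∈ D.X, ∀ k, D.lowComponent (L' ξ).1 k = 0) {ξ : D.Ambient} (hξ : ξ ∈ D.X) :
    L ξ = L' ξ := by
  let I : Fin D.n := ⟨0, D.n_pos⟩
  refine tendsto_nhds_unique_of_eventuallyEq (l := 𝓝[≠] (0 : ℂ)) (hL.tendsto_shift hξ I)
    (hL'.tendsto_shift hξ I) ?_
  filter_upwards [eventually_isNondegenerate_shift hħ hξ I] with s hs
  have hX := shift_mem hξ I s
  refine sub_eq_zero.1 (eq_zero_of_dQ_eq_zero hħ hX hs (sub_mem (hL.2 _ hX) (hL'.2 _ hX))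
    (fun x hx => ?_) fun k => ?_)
  · rw [dQ_sub, solvesFuchs_iff.1 h _ hX x hx, solvesFuchs_iff.1 h' _ hX x hx, sub_self]
  · rw [← lowForm_apply, Prod.fst_sub, map_sub, lowForm_apply, lowForm_apply, hlow _ hX,
      hlow' _ hX, sub_zero]

lemma solvesFuchs_congr {ħ : ℂ} {A : D.Ambient → ℂ → ℂ} {L L' : D.Ambient → D.Ambient}
    (h : ∀ ξ ∈ D.X, L ξ = L' ξ) : D.SolvesFuchs ħ A L ↔ D.SolvesFuchs ħ A L' :=
  forall₂_congr fun ξ hξ => by rw [h ξ hξ]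

lemma isTwistorDistribution_isomonodromicDistribution (D : PoleData) :
    D.IsTwistorDistribution D.isomonodromicDistribution := by
  let e : D.FlowIndex ≃ Fin (2 * D.n) := Fintype.equivFinOfCardEq D.card_flowIndex
  refine ⟨fun a => D.U (e.symm a), fun a => D.V (e.symm a),
    fun a => ⟨isVectorField_U _, isVectorField_V _⟩, fun ħ hħ ξ hξ => ?_, fun ξ hξ => ?_⟩
  · rw [isomonodromicDistribution_eq hħ hξ]
    congr 1
    exact (e.symm.surjective.range_comp fun a => D.flow ħ a ξ).symm
  · rw [← span_U_V hξ, Set.Sum.elim_range]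
    congr 2
    · exact (e.symm.surjective.range_comp fun a => D.U a ξ).symm
    · exact (e.symm.surjective.range_comp fun a => D.V a ξ).symm

end

end PoleData

theorem mainTheorem5 (D : PoleData) :
    -- there are `2n` fields `U` and `2n` fields `V`, holomorphic on the `4n`-dimensional `X`
    Fintype.card D.LowIndex = D.n ∧
    Fintype.card D.FlowIndex = 2 * D.n ∧
    (∀ ξ ∈ D.X, Module.finrank ℂ (D.tangentSpace ξ) = 4 * D.n) ∧
    (∀ a, D.IsVectorField (D.U a) ∧ D.IsVectorField (D.V a)) ∧
    -- the first `n` flows are isopotential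
    (∀ ħ : ℂ, ħ ≠ 0 → ∀ k : D.LowIndex, D.IsIsopotential ħ (D.flow ħ (Sum.inl k))) ∧
    -- `L_I` is the unique solution for `A = 1 / (x - q_I)` without low components
    (∀ ħ : ℂ, ħ ≠ 0 → ∀ I : Fin D.n, ∀ L : D.Ambient → D.Ambient, D.IsVectorField L →
      ((D.SolvesFuchs ħ (fun ξ x => (x - D.q ξ I)⁻¹) L ∧
          ∀ ξ ∈ D.X, ∀ k, D.lowComponent (L ξ).1 k = 0) ↔
        ∀ ξ ∈ D.X, L ξ = D.flow ħ (Sum.inr I) ξ)) ∧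
    -- all `2n` flows are isomonodromic and they are linearly independent at every point
    (∀ ħ : ℂ, ħ ≠ 0 → ∀ a, D.IsIsomonodromic ħ (D.flow ħ a)) ∧
    (∀ ħ : ℂ, ħ ≠ 0 → ∀ ξ ∈ D.X, LinearIndependent ℂ (fun a => D.flow ħ a ξ)) ∧
    -- the `4n` fields `U`, `V` trivialise the tangent bundle of `X`
    (∀ ξ ∈ D.X,
      LinearIndependent ℂ (Sum.elim (fun a => D.U a ξ) (fun a => D.V a ξ)) ∧
      Submodule.span ℂ (Set.range (Sum.elim (fun a => D.U a ξ) (fun a => D.V a ξ)))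
        = D.tangentSpace ξ) ∧
    -- the flows span the distribution of all isomonodromic flows, a twistor distribution
    (∀ ħ : ℂ, ħ ≠ 0 → ∀ ξ ∈ D.X,
      D.isomonodromicDistribution ħ ξ = Submodule.span ℂ (Set.range fun a => D.flow ħ a ξ)) ∧
    D.IsTwistorDistribution D.isomonodromicDistribution := by
  refine ⟨D.card_lowIndex, D.card_flowIndex, fun ξ hξ => PoleData.finrank_tangentSpace hξ,
    fun a => ⟨PoleData.isVectorField_U a, PoleData.isVectorField_V a⟩,
    fun ħ _ k ξ hξ x hx => PoleData.dQ_flow_inl hξ k hx, fun ħ hħ I L hL => ?_,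
    fun ħ _ a => PoleData.isIsomonodromic_flow ħ a,
    fun ħ _ ξ hξ => PoleData.linearIndependent_flow hξ,
    fun ξ hξ => ⟨PoleData.linearIndependent_U_V hξ, PoleData.span_U_V hξ⟩,
    fun ħ hħ ξ hξ => PoleData.isomonodromicDistribution_eq hħ hξ,
    D.isTwistorDistribution_isomonodromicDistribution⟩
  have hflow : D.SolvesFuchs ħ (fun ξ x => (x - D.q ξ I)⁻¹) (D.flow ħ (Sum.inr I)) :=
    PoleData.solvesFuchs_iff.2 fun ξ hξ x hx => PoleData.dQ_flow_inr hξ I hx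
  have hlow (ξ : D.Ambient) (k) : D.lowComponent (D.flow ħ (Sum.inr I) ξ).1 k = 0 := by
    rw [PoleData.flow_inr_fst, PoleData.lowComponent_UBase]
  constructor
  · rintro ⟨h, h'⟩ ξ hξ
    exact PoleData.eq_of_solvesFuchs hħ hL (PoleData.isVectorField_flow ħ _) h hflow h'
      (fun ξ _ => hlow ξ) hξ
  · intro h
    refine ⟨(PoleData.solvesFuchs_congr h).2 hflow, fun ξ hξ k => ?_⟩
    rw [h ξ hξ, hlow]
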